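/- Let $d\ge 2$ be a fixed integer. The $d$-process on $n$ vertices starts with the empty graph $G_0$ on $n$ labelled vertices; given $G_s$, the graph $G_{s+1}$ is obtained by adding one edge, chosen uniformly at random from all pairs of distinct vertices that are not yet edges and whose two vertices both have degree less than $d$ in $G_s$ (if there is no such pair, the process stops and we put $G_{s+1}=G_s$). Let $D_j(s)$ be the number of vertices of degree $j$ in $G_s$, and let $N=\lfloor dn/2\rfloor$. For an integer $k\ge 1$ write $[x]_k=x(x-1)\cdots(x-k+1)$, and let $\log$ be the natural logarithm. **Theorem.** Let $0\le j\le d-2$ and $k\ge 1$ be fixed integers, let $\gamma>0$ be a fixed real number, and let $t=t(n)$ be nonnegative integers with $t(n)\to\infty$ as $n\to\infty$ and $t(n)<\log^\gamma n$ for all sufficiently large $n$. Then, as $n\to\infty$, $$\mathbb E\big([D_j(N-t)]_k\big)\sim\left(\frac{2\,[d-1]_{d-1-j}\,t}{\log^{d-1-j}n}\right)^k .$$ -/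

import Mathlib

open Filter Asymptotics

noncomputable section

namespace DegreeBounded

open Classical in
/-- The pairs that the `d`-process may choose next when the current graph is `G`: pairs of distinct
vertices that are not yet edges and whose two vertices are both unsaturated (degree less than
`d`). -/
def availablePairs (d : ℕ) {n : ℕ} (G : SimpleGraph (Fin n)) : Finset (Sym2 (Fin n)) :=
  {e | ¬ e.IsDiag ∧ e ∉ G.edgeSet ∧ ∀ v ∈ e, G.degree v < d}

/-- The graph obtained from `G` by adding the pair `e` as an edge. -/
def addEdge {n : ℕ} (G : SimpleGraph (Fin n)) (e : Sym2 (Fin n)) : SimpleGraph (Fin n) :=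
  SimpleGraph.fromEdgeSet (insert e G.edgeSet)

open Classical in
/-- One step of the `d`-process: the law of the next graph, given that the current graph is `G`.
A uniformly random available pair is added. If no pair is available, the process has got stuck at
its final graph and stays there. -/
def step (d : ℕ) {n : ℕ} (G : SimpleGraph (Fin n)) : PMF (SimpleGraph (Fin n)) :=
  if h : (availablePairs d G).Nonempty then
    (PMF.uniformOfFinset (availablePairs d G) h).map (addEdge G)
  else PMF.pure G

/-- The law of the random graph `G_s`, the state of the `d`-process on `n` vertices after `s`
steps, started from the empty graph. A graph without available pairs has all its unsaturated
vertices in a clique, so there are at most `d` of them, and it has at least `(d * n - d ^ 2) / 2`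
edges. Hence, for every `s` up to this bound, the graph `G_s` almost surely has exactly `s`
edges. -/
def graphLaw (d n : ℕ) : ℕ → PMF (SimpleGraph (Fin n))
  | 0 => PMF.pure ⊥
  | s + 1 => (graphLaw d n s).bind (step d)

open Classical in
/-- The number of vertices of degree `j` in `G`. -/
def degreeCount (j : ℕ) {n : ℕ} (G : SimpleGraph (Fin n)) : ℕ :=
  Finset.card {v : Fin n | G.degree v = j}

open Classical in
/-- The expectation `E [D_j(s)]_k` of the `k`-fold falling factorial of the number of vertices of
degree `j` in `G_s`. -/
def factorialMoment (d n j k s : ℕ) : ℝ :=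
  ∑ G : SimpleGraph (Fin n), (graphLaw d n s G).toReal * ((degreeCount j G).descFactorial k : ℝ)

/-- The function `f_j(d, t, n) = 2 [d - 1]_{d - 1 - j} t / log ^ {d - 1 - j} n`, for
`j + 2 ≤ d`. -/
def f (j d t n : ℕ) : ℝ :=
  2 * ((d - 1).descFactorial (d - 1 - j) : ℝ) * (t : ℝ) / Real.log (n : ℝ) ^ (d - 1 - j)

end DegreeBounded

end

noncomputable section

namespace DegreeBounded

/-! Write x = dn - 2s for the deficiency after s steps, u for the number of unsaturated vertices and
L = log n. The next pair contains a given unsaturated vertex with probability close to 2/u. In an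
internal clock τ that advances by 2/u per step, the degree counts thus follow D_j' = D_{j-1} - D_j,
so e^τ D_j is close to n τ^j / j!. When x is a power of L, τ is close to L, almost all unsaturated
vertices have degree d - 1, and D_j is about c x / L^q with c = (d-1)!/j! and q = d - 1 - j. Putting
x = 2t gives the claimed value.

Concentration of D_j cannot be expected down to a slowly growing t, so the process is cut at a burn
time, when a large power of L of steps remains.

Before the burn time the squares of the deviations (e^τ D_j - n τ^j / j!) / (n L^j) are summed to a
potential. Index j is driven only by index j - 1, and the weights L^j make the potential grow at
rate at most 2/L in the clock τ, hence by a bounded factor while τ = O(L); the noise contributes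
O(L^{2d} / x) in total (`pexp_step_fluidPotential_le`, `pexp_graphLaw_le_of_fluidPotential`). So the
counts are close to their predicted values except with probability O(L^{2d} / x)
(`pexp_graphLaw_atypical_le`).

After the burn time, at deficiency x₁, only moments are followed. For the upper bound a vertex of
degree i ≤ m gets weight lam^(m - i) with lam = √L. Any hit on a vertex reduces its weight by a
factor lam at least, and since u ≤ x every relevant k-tuple is hit with probability at least 2k/x -
O(1/x²), whatever the graph. The weighted moment therefore decays like x^k, up to a factor exp(k log
x₁ / lam), which tends to 1 because log x₁ = O(log log n) (`pexp_step_tupleSum_le`,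
`pexp_graphLaw_tupleSum_le_explicit`). For the lower bound gains are discarded. The hit probability
exceeds 2k/x by an amount governed by the number W of vertices of degree at most d - 2, and the
expectation of W [D_j]_k is bounded by the upper bound for k + 1 indices. It carries an extra factor
1/L, so the accumulated relative loss is O(log x₁ / L) (`pexp_step_descFactorial_ge`,
`pexp_graphLaw_descFactorial_ge_explicit`). -/

/-- The expectation of a real function under a probability mass function on a finite type. -/
def pexp {α : Type*} [Fintype α] (p : PMF α) (h : α → ℝ) : ℝ := ∑ a, (p a).toReal * h a

/-! ### Expectations on finite types -/

section Expectation

variable {α β : Type*} [Fintype α] [Fintype β]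

lemma pexp_pure (a : α) (h : α → ℝ) : pexp (PMF.pure a) h = h a := by
  classical
  unfold pexp
  rw [Finset.sum_eq_single a]
  · simp
  · intro b _ hb
    simp [PMF.pure_apply, hb]
  · simp

lemma pexp_bind (p : PMF α) (f : α → PMF β) (h : β → ℝ) :
    pexp (p.bind f) h = pexp p (fun a => pexp (f a) h) := by
  unfold pexp
  have hb : ∀ b, ((p.bind f) b).toReal = ∑ a, (p a).toReal * (f a b).toReal := by
    intro b
    rw [PMF.bind_apply, tsum_fintype, ENNReal.toReal_sum]
    · simp [ENNReal.toReal_mul]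
    · intro a _
      exact ENNReal.mul_ne_top (p.apply_ne_top a) ((f a).apply_ne_top b)
  simp_rw [hb, Finset.sum_mul, Finset.mul_sum]
  rw [Finset.sum_comm]
  simp [mul_assoc]

lemma pexp_map (p : PMF α) (f : α → β) (h : β → ℝ) :
    pexp (p.map f) h = pexp p (fun a => h (f a)) := by
  unfold PMF.map
  rw [pexp_bind]
  simp [pexp_pure]

lemma pexp_uniformOfFinset (s : Finset α) (hs : s.Nonempty) (h : α → ℝ) :
    pexp (PMF.uniformOfFinset s hs) h = (∑ a ∈ s, h a) / (s.card : ℝ) := by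
  classical
  unfold pexp
  have : ∀ a, ((PMF.uniformOfFinset s hs) a).toReal * h a =
      if a ∈ s then h a / (s.card : ℝ) else 0 := by
    intro a
    rw [PMF.uniformOfFinset_apply]
    split_ifs <;> simp [div_eq_inv_mul]
  simp_rw [this]
  rw [Finset.sum_ite_mem, Finset.univ_inter, Finset.sum_div]

lemma pexp_const (p : PMF α) (c : ℝ) : pexp p (fun _ => c) = c := by
  unfold pexp
  rw [← Finset.sum_mul]
  have : ∑ a, (p a).toReal = 1 := by
    rw [← ENNReal.toReal_sum (fun a _ => p.apply_ne_top a), ← tsum_fintype (L := .unconditional α),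
      p.tsum_coe]
    simp
  rw [this, one_mul]

lemma pexp_add (p : PMF α) (h g : α → ℝ) :
    pexp p (fun a => h a + g a) = pexp p h + pexp p g := by
  simp [pexp, mul_add, Finset.sum_add_distrib]

lemma pexp_const_mul (p : PMF α) (c : ℝ) (h : α → ℝ) :
    pexp p (fun a => c * h a) = c * pexp p h := by
  unfold pexp
  rw [Finset.mul_sum]
  exact Finset.sum_congr rfl fun a _ => by ring

lemma pexp_sum {ι : Type*} (p : PMF α) (s : Finset ι) (h : ι → α → ℝ) :
    pexp p (fun a => ∑ i ∈ s, h i a) = ∑ i ∈ s, pexp p (h i) := by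
  unfold pexp
  simp_rw [Finset.mul_sum]
  rw [Finset.sum_comm]

lemma pexp_mono (p : PMF α) {h g : α → ℝ} (hg : ∀ a ∈ p.support, h a ≤ g a) :
    pexp p h ≤ pexp p g := by
  unfold pexp
  refine Finset.sum_le_sum fun a _ => ?_
  by_cases ha : a ∈ p.support
  · exact mul_le_mul_of_nonneg_left (hg a ha) ENNReal.toReal_nonneg
  · rw [PMF.mem_support_iff, not_not] at ha
    simp [ha]

lemma pexp_nonneg (p : PMF α) {h : α → ℝ} (hh : ∀ a, 0 ≤ h a) : 0 ≤ pexp p h :=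
  Finset.sum_nonneg fun a _ => mul_nonneg ENNReal.toReal_nonneg (hh a)

end Expectation

/-! ### Degrees, unsaturated vertices and available pairs -/

section Graphs

variable {n : ℕ}

open Classical in
/-- The degree of a vertex, with the decidability instances of `degreeCount`. -/
def deg (G : SimpleGraph (Fin n)) (v : Fin n) : ℕ := G.degree v

/-- The unsaturated vertices. -/
def unsat (d : ℕ) (G : SimpleGraph (Fin n)) : Finset (Fin n) := {v | deg G v < d}

open Classical in
/-- The number of available pairs that contain the vertex `v`. -/
def pairCount (d : ℕ) (G : SimpleGraph (Fin n)) (v : Fin n) : ℕ :=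
  ((availablePairs d G).filter (fun e => v ∈ e)).card

lemma mem_unsat {d : ℕ} {G : SimpleGraph (Fin n)} {v : Fin n} : v ∈ unsat d G ↔ deg G v < d := by
  simp [unsat]

lemma mk_mem_availablePairs {d : ℕ} {G : SimpleGraph (Fin n)} {a b : Fin n} :
    s(a, b) ∈ availablePairs d G ↔ a ≠ b ∧ ¬ G.Adj a b ∧ deg G a < d ∧ deg G b < d := by
  simp [availablePairs, deg]

lemma degreeCount_eq (j : ℕ) (G : SimpleGraph (Fin n)) :
    degreeCount j G = (Finset.univ.filter (fun v => deg G v = j)).card := by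
  simp only [degreeCount, deg]
  congr

lemma degreeCount_cast (j : ℕ) (G : SimpleGraph (Fin n)) :
    (degreeCount j G : ℝ) = ∑ v, if deg G v = j then (1 : ℝ) else 0 := by
  rw [degreeCount_eq, Finset.sum_boole]

open Classical in
lemma deg_addEdge {d : ℕ} {G : SimpleGraph (Fin n)} {e : Sym2 (Fin n)}
    (he : e ∈ availablePairs d G) (v : Fin n) :
    deg (addEdge G e) v = deg G v + if v ∈ e then 1 else 0 := by
  induction e with
  | _ a b =>
  obtain ⟨hab, hadj, -, -⟩ := mk_mem_availablePairs.1 he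
  have hA : ∀ x y, (addEdge G s(a, b)).Adj x y ↔ G.Adj x y ∨ (x = a ∧ y = b) ∨ (x = b ∧ y = a) := by
    intro x y
    simp only [addEdge, SimpleGraph.fromEdgeSet_adj, Set.mem_insert_iff, SimpleGraph.mem_edgeSet,
      Sym2.eq_iff]
    constructor
    · rintro ⟨h | h, -⟩
      · exact Or.inr h
      · exact Or.inl h
    · rintro (h | h)
      · exact ⟨Or.inr h, h.ne⟩
      · refine ⟨Or.inl h, ?_⟩
        rcases h with ⟨rfl, rfl⟩ | ⟨rfl, rfl⟩
        · exact hab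
        · exact hab.symm
  unfold deg
  rw [← SimpleGraph.card_neighborFinset_eq_degree, ← SimpleGraph.card_neighborFinset_eq_degree]
  by_cases hva : v = a
  · subst hva
    have : (addEdge G s(v, b)).neighborFinset v = insert b (G.neighborFinset v) := by
      ext y
      simp only [SimpleGraph.mem_neighborFinset, hA, Finset.mem_insert]
      grind
    rw [this, Finset.card_insert_of_notMem (by simpa using hadj)]
    simp
  by_cases hvb : v = b
  · subst hvb
    have : (addEdge G s(a, v)).neighborFinset v = insert a (G.neighborFinset v) := by
      ext y
      simp only [SimpleGraph.mem_neighborFinset, hA, Finset.mem_insert]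
      grind
    rw [this, Finset.card_insert_of_notMem (by simpa using fun h => hadj h.symm)]
    simp
  · have : (addEdge G s(a, b)).neighborFinset v = G.neighborFinset v := by
      ext y
      simp only [SimpleGraph.mem_neighborFinset, hA]
      grind
    rw [this]
    simp [hva, hvb]

lemma mem_unsat_of_mem_available {d : ℕ} {G : SimpleGraph (Fin n)} {e : Sym2 (Fin n)}
    (he : e ∈ availablePairs d G) {v : Fin n} (hv : v ∈ e) : v ∈ unsat d G := by
  induction e with
  | _ a b =>
  obtain ⟨-, -, ha, hb⟩ := mk_mem_availablePairs.1 he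
  rw [mem_unsat]
  rcases Sym2.mem_iff.1 hv with rfl | rfl <;> assumption

open Classical in
lemma card_mem_of_mem_available {d : ℕ} {G : SimpleGraph (Fin n)} {e : Sym2 (Fin n)}
    (he : e ∈ availablePairs d G) : (Finset.univ.filter (fun v => v ∈ e)).card = 2 := by
  induction e with
  | _ a b =>
  obtain ⟨hab, -, -, -⟩ := mk_mem_availablePairs.1 he
  rw [← Finset.card_pair hab]
  congr 1
  ext v
  simp

open Classical in
lemma pairCount_eq {d : ℕ} {G : SimpleGraph (Fin n)} {v : Fin n} (hv : v ∈ unsat d G) :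
    pairCount d G v = ((unsat d G).filter (fun w => v ≠ w ∧ ¬ G.Adj v w)).card := by
  unfold pairCount
  symm
  refine Finset.card_bij (fun w _ => s(v, w)) ?_ ?_ ?_
  · intro w hw
    rw [Finset.mem_filter] at hw
    simp only [Finset.mem_filter, mk_mem_availablePairs]
    exact ⟨⟨hw.2.1, hw.2.2, mem_unsat.1 hv, mem_unsat.1 hw.1⟩, by simp⟩
  · intro a _ b _ h
    exact Sym2.congr_right.1 h
  · intro e he
    rw [Finset.mem_filter] at he
    obtain ⟨w, rfl⟩ := he.2
    obtain ⟨h1, h2, -, h3⟩ := mk_mem_availablePairs.1 he.1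
    exact ⟨w, by simp [mem_unsat, h1, h2, h3], rfl⟩

lemma pairCount_add_one_le {d : ℕ} {G : SimpleGraph (Fin n)} {v : Fin n} (hv : v ∈ unsat d G) :
    pairCount d G v + 1 ≤ (unsat d G).card := by
  classical
  rw [pairCount_eq hv, ← Finset.card_erase_add_one hv]
  gcongr
  intro w hw
  rw [Finset.mem_filter] at hw
  exact Finset.mem_erase.2 ⟨hw.2.1.symm, hw.1⟩

/-- The only unsaturated vertices that `v` cannot be joined to are `v` itself and its at most `d -
1` neighbours. -/
lemma card_unsat_le_pairCount_add {d : ℕ} {G : SimpleGraph (Fin n)} {v : Fin n}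
    (hv : v ∈ unsat d G) : (unsat d G).card ≤ pairCount d G v + d := by
  classical
  rw [pairCount_eq hv]
  have hsub : unsat d G ⊆ (unsat d G).filter (fun w => v ≠ w ∧ ¬ G.Adj v w) ∪
      insert v (G.neighborFinset v) := by
    intro w hw
    simp only [Finset.mem_union, Finset.mem_filter, hw, Finset.mem_insert,
      SimpleGraph.mem_neighborFinset, true_and]
    by_cases h1 : w = v
    · simp [h1]
    · by_cases h2 : G.Adj v w
      · simp [h2]
      · exact Or.inl ⟨fun h => h1 h.symm, h2⟩
  have h1 := Finset.card_le_card hsub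
  have h2 := Finset.card_union_le ((unsat d G).filter (fun w => v ≠ w ∧ ¬ G.Adj v w))
    (insert v (G.neighborFinset v))
  have h3 := Finset.card_insert_le v (G.neighborFinset v)
  have h4 : (G.neighborFinset v).card = deg G v := by
    rw [SimpleGraph.card_neighborFinset_eq_degree]
    unfold deg
    congr
  have h5 := mem_unsat.1 hv
  omega

open Classical in
lemma pairCount_eq_zero {d : ℕ} {G : SimpleGraph (Fin n)} {v : Fin n} (hv : v ∉ unsat d G) :
    pairCount d G v = 0 := by
  unfold pairCount
  rw [Finset.card_eq_zero, Finset.filter_eq_empty_iff]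
  exact fun e he hve => hv (mem_unsat_of_mem_available he hve)

-- Double counting of incidences: it turns sums over available pairs, as they occur in one-step
-- expectations, into vertex sums weighted by `pairCount`.
open Classical in
lemma sum_available_sum_mem (d : ℕ) (G : SimpleGraph (Fin n)) (φ : Fin n → ℝ) :
    ∑ e ∈ availablePairs d G, ∑ v, (if v ∈ e then φ v else 0) = ∑ v, (pairCount d G v : ℝ) * φ v := by
  rw [Finset.sum_comm]
  refine Finset.sum_congr rfl fun v _ => ?_
  rw [← Finset.sum_filter, Finset.sum_const, nsmul_eq_mul, pairCount]

lemma two_mul_card_available (d : ℕ) (G : SimpleGraph (Fin n)) :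
    2 * ((availablePairs d G).card : ℝ) = ∑ v ∈ unsat d G, (pairCount d G v : ℝ) := by
  classical
  have h := sum_available_sum_mem d G (fun _ => 1)
  have h1 : ∑ e ∈ availablePairs d G, ∑ v : Fin n, (if v ∈ e then (1 : ℝ) else 0) =
      ∑ e ∈ availablePairs d G, 2 := by
    refine Finset.sum_congr rfl fun e he => ?_
    rw [Finset.sum_boole, card_mem_of_mem_available he]
    norm_num
  rw [h1, Finset.sum_const, nsmul_eq_mul] at h
  rw [mul_comm, h]
  simp only [mul_one]
  symm
  refine Finset.sum_subset (Finset.subset_univ _) fun v _ hv => ?_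
  rw [pairCount_eq_zero hv, Nat.cast_zero]

lemma two_mul_card_available_le (d : ℕ) (G : SimpleGraph (Fin n)) :
    2 * ((availablePairs d G).card : ℝ) ≤ (unsat d G).card * ((unsat d G).card - 1) := by
  rw [two_mul_card_available, ← nsmul_eq_mul, ← Finset.sum_const]
  refine Finset.sum_le_sum fun v hv => ?_
  have := pairCount_add_one_le hv
  have : ((pairCount d G v + 1 : ℕ) : ℝ) ≤ (unsat d G).card := by exact_mod_cast this
  push_cast at this
  linarith

lemma le_two_mul_card_available (d : ℕ) (G : SimpleGraph (Fin n)) :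
    (unsat d G).card * ((unsat d G).card - d : ℝ) ≤ 2 * ((availablePairs d G).card : ℝ) := by
  rw [two_mul_card_available, ← nsmul_eq_mul, ← Finset.sum_const]
  refine Finset.sum_le_sum fun v hv => ?_
  have := card_unsat_le_pairCount_add hv
  have : ((unsat d G).card : ℝ) ≤ ((pairCount d G v + d : ℕ) : ℝ) := by exact_mod_cast this
  push_cast at this
  linarith

/-! ### Reachable graphs and their deficiency -/

/-- The graphs that the process can reach in exactly `s` effective steps satisfy this. -/
def Reach (d s : ℕ) (G : SimpleGraph (Fin n)) : Prop :=
  (∀ v, deg G v ≤ d) ∧ ∑ v, deg G v = 2 * s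

lemma reach_bot (d : ℕ) : Reach d 0 (⊥ : SimpleGraph (Fin n)) := by
  constructor <;> simp [deg]

lemma Reach.addEdge {d s : ℕ} {G : SimpleGraph (Fin n)} (hG : Reach d s G) {e : Sym2 (Fin n)}
    (he : e ∈ availablePairs d G) : Reach d (s + 1) (addEdge G e) := by
  classical
  constructor
  · intro v
    rw [deg_addEdge he]
    split_ifs with hv
    · exact mem_unsat.1 (mem_unsat_of_mem_available he hv)
    · exact hG.1 v
  · simp_rw [deg_addEdge he]
    rw [Finset.sum_add_distrib, hG.2, Finset.sum_boole, card_mem_of_mem_available he]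
    push_cast
    ring

/-- Saturated vertices contribute nothing. As every unsaturated vertex contributes between 1 and
`d`, this ties the random number u of unsaturated vertices to the deterministic x = dn - 2s by u ≤ x
≤ du. -/
lemma Reach.deficiency {d s : ℕ} {G : SimpleGraph (Fin n)} (hG : Reach d s G) :
    (d * n : ℝ) - 2 * s = ∑ v ∈ unsat d G, ((d : ℝ) - deg G v) := by
  have h1 : ∑ v ∈ unsat d G, ((d : ℝ) - deg G v) = ∑ v : Fin n, ((d : ℝ) - deg G v) := by
    refine Finset.sum_subset (Finset.subset_univ _) fun v _ hv => ?_
    rw [mem_unsat, not_lt] at hv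
    rw [le_antisymm (hG.1 v) hv, sub_self]
  have h2 : ∑ v, (deg G v : ℝ) = 2 * s := by exact_mod_cast hG.2
  rw [h1, Finset.sum_sub_distrib, h2]
  simp [mul_comm]

lemma Reach.card_unsat_le {d s : ℕ} {G : SimpleGraph (Fin n)} (hG : Reach d s G) :
    ((unsat d G).card : ℝ) ≤ d * n - 2 * s := by
  rw [hG.deficiency, ← nsmul_one, ← Finset.sum_const]
  refine Finset.sum_le_sum fun v hv => ?_
  have := mem_unsat.1 hv
  have : ((deg G v + 1 : ℕ) : ℝ) ≤ d := by exact_mod_cast this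
  push_cast at this
  linarith

lemma Reach.le_card_unsat {d s : ℕ} {G : SimpleGraph (Fin n)} (hG : Reach d s G) :
    (d * n : ℝ) - 2 * s ≤ d * (unsat d G).card := by
  rw [hG.deficiency, mul_comm, ← nsmul_eq_mul, ← Finset.sum_const]
  refine Finset.sum_le_sum fun v _ => ?_
  have : (0 : ℝ) ≤ deg G v := Nat.cast_nonneg _
  linarith

/-- Deficiency above `d ^ 2` forces more than `d` unsaturated vertices, too many for a clique of
vertices of degree below `d`. -/
lemma Reach.available_nonempty {d s : ℕ} {G : SimpleGraph (Fin n)} (hG : Reach d s G)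
    (h : 2 * s + d * d < d * n) : (availablePairs d G).Nonempty := by
  rw [← Finset.card_pos]
  have h1 := hG.le_card_unsat
  have h2 := le_two_mul_card_available d G
  have h3 : (2 * s + d * d : ℝ) < d * n := by exact_mod_cast h
  have hd : (0 : ℝ) ≤ d := Nat.cast_nonneg _
  have h4 : (d : ℝ) < (unsat d G).card := by
    by_contra hc
    push Not at hc
    nlinarith
  have h5 : (0 : ℝ) < (availablePairs d G).card := by
    have : (0 : ℝ) < (unsat d G).card * ((unsat d G).card - d : ℝ) :=
      mul_pos (by linarith) (by linarith)
    linarith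
  exact_mod_cast h5

lemma pexp_step {d : ℕ} {G : SimpleGraph (Fin n)} (h : (availablePairs d G).Nonempty)
    (φ : SimpleGraph (Fin n) → ℝ) :
    pexp (step d G) φ =
      (∑ e ∈ availablePairs d G, φ (addEdge G e)) / ((availablePairs d G).card : ℝ) := by
  unfold step
  rw [dif_pos h, pexp_map, pexp_uniformOfFinset]

lemma reach_of_mem_support_step {d s : ℕ} {G H : SimpleGraph (Fin n)} (hG : Reach d s G)
    (h : 2 * s + d * d < d * n) (hH : H ∈ (step d G).support) : Reach d (s + 1) H := by
  unfold step at hH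
  rw [dif_pos (hG.available_nonempty h), PMF.mem_support_map_iff] at hH
  obtain ⟨e, he, rfl⟩ := hH
  rw [PMF.mem_support_uniformOfFinset_iff] at he
  exact hG.addEdge he

/-- Only the steps before `s` must find an available pair, so the condition is needed for `s - 1`;
this is the `+ 2`. -/
lemma reach_of_mem_support {d s : ℕ} {G : SimpleGraph (Fin n)}
    (h : 2 * s + d * d < d * n + 2) (hG : G ∈ (graphLaw d n s).support) : Reach d s G := by
  induction s generalizing G with
  | zero =>
    simp only [graphLaw, PMF.mem_support_pure_iff] at hG
    subst hG
    exact reach_bot d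
  | succ s ih =>
    simp only [graphLaw, PMF.mem_support_bind_iff] at hG
    obtain ⟨G', hG', hG⟩ := hG
    exact reach_of_mem_support_step (ih (by omega) hG') (by omega) hG

lemma pexp_graphLaw_succ (d s : ℕ) (φ : SimpleGraph (Fin n) → ℝ) :
    pexp (graphLaw d n (s + 1)) φ = pexp (graphLaw d n s) (fun G => pexp (step d G) φ) := by
  simp only [graphLaw, pexp_bind]

lemma factorialMoment_eq (d n j k s : ℕ) :
    factorialMoment d n j k s =
      pexp (graphLaw d n s) (fun G => ((degreeCount j G).descFactorial k : ℝ)) := rfl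

/-! ### One-step drift of the degree counts -/

/-- Here u counts unsaturated vertices, c the available pairs at one of them and Q all available
pairs. Both cu and 2Q lie between u(u - d) and u(u - 1), so they differ by at most du, while u² ≤
4Q. -/
lemma abs_pick_sub_le {u d c Q : ℝ} (hd : 1 ≤ d) (hu : 2 * d ≤ u) (hc1 : c + 1 ≤ u)
    (hc2 : u ≤ c + d) (hQ1 : 2 * Q ≤ u * (u - 1)) (hQ2 : u * (u - d) ≤ 2 * Q) :
    |c / Q - 2 / u| ≤ 4 * d / u ^ 2 := by
  have hu0 : 0 < u := by linarith
  have hud : u / 2 ≤ u - d := by linarith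
  have hQ : 0 < Q := by nlinarith [mul_pos hu0 (by linarith : 0 < u - d)]
  have hQ3 : u ^ 2 ≤ 4 * Q := by nlinarith
  rw [div_sub_div _ _ hQ.ne' hu0.ne', abs_div, abs_of_pos (mul_pos hQ hu0),
    div_le_div_iff₀ (mul_pos hQ hu0) (by positivity)]
  have h1 : |c * u - Q * 2| ≤ d * u := by
    rw [abs_le]
    constructor <;> nlinarith
  calc |c * u - Q * 2| * u ^ 2 ≤ (d * u) * (4 * Q) := by gcongr
    _ = 4 * d * (Q * u) := by ring

lemma abs_pairCount_div_sub_le {d : ℕ} (hd : 1 ≤ d) {G : SimpleGraph (Fin n)}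
    (hu : 2 * d ≤ (unsat d G).card) {v : Fin n} (hv : v ∈ unsat d G) :
    |(pairCount d G v : ℝ) / ((availablePairs d G).card : ℝ) - 2 / ((unsat d G).card : ℝ)| ≤
      4 * d / ((unsat d G).card : ℝ) ^ 2 := by
  refine abs_pick_sub_le (by exact_mod_cast hd) (by exact_mod_cast hu)
    (by exact_mod_cast pairCount_add_one_le hv) (by exact_mod_cast card_unsat_le_pairCount_add hv)
    (two_mul_card_available_le d G) (le_two_mul_card_available d G)

lemma available_nonempty_of_card {d : ℕ} (hd : 1 ≤ d) {G : SimpleGraph (Fin n)}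
    (hu : 2 * d ≤ (unsat d G).card) : (availablePairs d G).Nonempty := by
  rw [← Finset.card_pos]
  have h := le_two_mul_card_available d G
  have h1 : (2 * d : ℝ) ≤ (unsat d G).card := by exact_mod_cast hu
  have h2 : (1 : ℝ) ≤ d := by exact_mod_cast hd
  have : (0 : ℝ) < (availablePairs d G).card := by nlinarith
  exact_mod_cast this

/-- The number of vertices whose degree is `i - 1`; it is zero for `i = 0`. -/
def predCount (i : ℕ) (G : SimpleGraph (Fin n)) : ℝ := ∑ v, if deg G v + 1 = i then (1 : ℝ) else 0

lemma predCount_zero (G : SimpleGraph (Fin n)) : predCount 0 G = 0 := by simp [predCount]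

lemma predCount_succ (i : ℕ) (G : SimpleGraph (Fin n)) :
    predCount (i + 1) G = degreeCount i G := by
  simp [predCount, degreeCount_cast]

lemma predCount_nonneg (i : ℕ) (G : SimpleGraph (Fin n)) : 0 ≤ predCount i G :=
  Finset.sum_nonneg fun v _ => by split_ifs <;> norm_num

lemma predCount_add_degreeCount_le {i d : ℕ} (hi : i < d) (G : SimpleGraph (Fin n)) :
    predCount i G + degreeCount i G ≤ (unsat d G).card := by
  unfold predCount unsat
  rw [degreeCount_cast, ← Finset.sum_add_distrib, ← Finset.sum_boole]
  refine Finset.sum_le_sum fun v _ => ?_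
  split_ifs <;> first | (exfalso; omega) | norm_num

open Classical in
lemma degreeCount_addEdge {d : ℕ} {G : SimpleGraph (Fin n)} {e : Sym2 (Fin n)}
    (he : e ∈ availablePairs d G) (i : ℕ) :
    (degreeCount i (addEdge G e) : ℝ) = degreeCount i G + ∑ v, if v ∈ e then
      ((if deg G v + 1 = i then (1 : ℝ) else 0) - if deg G v = i then 1 else 0) else 0 := by
  rw [degreeCount_cast, degreeCount_cast, ← Finset.sum_add_distrib]
  refine Finset.sum_congr rfl fun v _ => ?_
  rw [deg_addEdge he]
  by_cases hv : v ∈ e <;> simp [hv]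

lemma abs_degreeCount_addEdge_sub_le {d : ℕ} {G : SimpleGraph (Fin n)} {e : Sym2 (Fin n)}
    (he : e ∈ availablePairs d G) (i : ℕ) :
    |(degreeCount i (addEdge G e) : ℝ) - degreeCount i G| ≤ 2 := by
  classical
  rw [degreeCount_addEdge he, add_sub_cancel_left]
  refine (Finset.abs_sum_le_sum_abs _ _).trans ?_
  have : (2 : ℝ) = ∑ v : Fin n, if v ∈ e then (1 : ℝ) else 0 := by
    rw [Finset.sum_boole, card_mem_of_mem_available he]
    norm_num
  rw [this]
  refine Finset.sum_le_sum fun v _ => ?_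
  split_ifs <;> norm_num

/-- Vertices of degree i - 1 that are hit enter the count and those of degree i leave it, each with
probability 2/u up to 4d/u². At most u vertices are concerned, so the error is 4d/u, that is, 2d
times the clock increment 2/u. -/
lemma abs_pexp_step_degreeCount_le {d i : ℕ} (hi : i < d) {G : SimpleGraph (Fin n)}
    (hu : 2 * d ≤ (unsat d G).card) :
    |pexp (step d G) (fun H => (degreeCount i H : ℝ)) - degreeCount i G -
      2 / (unsat d G).card * (predCount i G - degreeCount i G)| ≤
      2 * d * (2 / (unsat d G).card) := by
  classical
  have hd : 1 ≤ d := by omega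
  have hne := available_nonempty_of_card hd hu
  have hQ : ((availablePairs d G).card : ℝ) ≠ 0 := by
    exact_mod_cast (Finset.card_pos.2 hne).ne'
  have hu0 : (0 : ℝ) < (unsat d G).card := by
    have : 0 < (unsat d G).card := by omega
    exact_mod_cast this
  set u : ℝ := ((unsat d G).card : ℝ) with hudef
  set w : Fin n → ℝ := fun v =>
    (if deg G v + 1 = i then (1 : ℝ) else 0) - if deg G v = i then 1 else 0 with hw
  have h1 : pexp (step d G) (fun H => (degreeCount i H : ℝ)) - degreeCount i G =
      ∑ v, (pairCount d G v : ℝ) / ((availablePairs d G).card : ℝ) * w v := by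
    rw [pexp_step hne, Finset.sum_congr rfl fun e he => degreeCount_addEdge he i,
      Finset.sum_add_distrib, sum_available_sum_mem, Finset.sum_const, nsmul_eq_mul]
    rw [add_div, mul_div_cancel_left₀ _ hQ, add_sub_cancel_left, Finset.sum_div]
    refine Finset.sum_congr rfl fun v _ => ?_
    rw [mul_div_right_comm]
  have h2 : 2 / u * (predCount i G - degreeCount i G) = ∑ v, 2 / u * w v := by
    rw [predCount, degreeCount_cast, ← Finset.sum_sub_distrib, Finset.mul_sum]
  rw [h1, h2, ← Finset.sum_sub_distrib]
  calc |∑ v, ((pairCount d G v : ℝ) / ((availablePairs d G).card : ℝ) * w v - 2 / u * w v)|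
      ≤ ∑ v, 4 * d / u ^ 2 *
        ((if deg G v + 1 = i then (1 : ℝ) else 0) + if deg G v = i then 1 else 0) := by
        refine (Finset.abs_sum_le_sum_abs _ _).trans (Finset.sum_le_sum fun v _ => ?_)
        rw [← sub_mul, abs_mul]
        by_cases hv : v ∈ unsat d G
        · have := abs_pairCount_div_sub_le hd hu hv
          refine mul_le_mul this ?_ (abs_nonneg _) (by positivity)
          refine (abs_sub _ _).trans (add_le_add (le_of_eq (abs_of_nonneg ?_))
            (le_of_eq (abs_of_nonneg ?_))) <;> split_ifs <;> norm_num
        · have hv' : d ≤ deg G v := by simpa [mem_unsat] using hv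
          have : w v = 0 := by
            rw [hw]
            dsimp only
            rw [if_neg (by omega), if_neg (by omega), sub_zero]
          rw [this, abs_zero, mul_zero, if_neg (by omega), if_neg (by omega), add_zero, mul_zero]
    _ = 4 * d / u ^ 2 * (predCount i G + degreeCount i G) := by
        rw [predCount, degreeCount_cast, ← Finset.sum_add_distrib, Finset.mul_sum]
    _ ≤ 4 * d / u ^ 2 * u := by
        gcongr
        exact predCount_add_degreeCount_le hi G
    _ = 2 * d * (2 / u) := by
        field_simp
        ring

/-! ### The fluid limit and its quadratic potential -/

-- With Y the old deviation and Y + Δ the new one, the square expands to Y² + 2YΔ + Δ². In the mean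
-- of Δ the factor e^h cancels the term -hD of the drift, leaving h(e^τ P - q') up to (7 + 3K)Bh²;
-- and |Δ| ≤ 12Bh pointwise. This gives 158 + 6K = 2(7 + 3K) + 12². The hypothesis `hτ` says that
-- one edge moves the rescaled count by O(Bh) only.
set_option maxHeartbeats 400000 in
lemma pexp_sq_le {α : Type*} [Fintype α] (p : PMF α) (X : α → ℝ) {D P K h τ B q q₁ q' : ℝ}
    (hh0 : 0 < h) (hh1 : h ≤ 1) (hD0 : 0 ≤ D) (hP0 : 0 ≤ P) (hD : h * D ≤ 2)
    (hP : h * P ≤ 2) (hX : ∀ a ∈ p.support, |X a - D| ≤ 2)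
    (hE : |pexp p X - D - h * (P - D)| ≤ K * h) (hτ : Real.exp τ ≤ B * h)
    (hq : |q₁ - q - h * q'| ≤ B * h ^ 2) (hq' : |q'| ≤ B) (hY : |Real.exp τ * D - q| ≤ B) :
    pexp p (fun a => (Real.exp (τ + h) * X a - q₁) ^ 2) ≤
      (Real.exp τ * D - q) ^ 2 + 2 * h * ((Real.exp τ * D - q) * (Real.exp τ * P - q')) +
        (158 + 6 * K) * B ^ 2 * h ^ 2 := by
  have hB : 0 ≤ B := (abs_nonneg _).trans hq'
  obtain ⟨r, hr⟩ : ∃ r, r = Real.exp h - 1 - h := ⟨_, rfl⟩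
  have hr1 : |r| ≤ h ^ 2 := by
    rw [hr]
    exact Real.abs_exp_sub_one_sub_id_le (by rwa [abs_of_pos hh0])
  have hexp : Real.exp h = 1 + h + r := by rw [hr]; ring
  have hr0 : 0 ≤ r := by
    have := Real.add_one_le_exp h
    rw [hr]; linarith
  have hr2 : r ≤ h ^ 2 := (le_abs_self r).trans hr1
  have hhh : h ^ 2 ≤ h := by nlinarith
  set E := Real.exp τ with hEdef
  have hE0 : 0 < E := Real.exp_pos τ
  set Y := E * D - q with hYdef
  set Δ : α → ℝ := fun a => E * Real.exp h * X a - q₁ - Y with hΔ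
  have hsq : pexp p (fun a => (Real.exp (τ + h) * X a - q₁) ^ 2) =
      Y ^ 2 + 2 * Y * pexp p Δ + pexp p (fun a => Δ a ^ 2) := by
    rw [← pexp_const p (Y ^ 2), ← pexp_const_mul, ← pexp_add, ← pexp_add]
    congr 1
    funext a
    rw [hΔ, Real.exp_add]
    ring
  have hmean : |pexp p Δ - h * (E * P - q')| ≤ (7 + 3 * K) * B * h ^ 2 := by
    have h1 : pexp p Δ = E * Real.exp h * pexp p X - q₁ - Y := by
      rw [← pexp_const_mul, sub_sub, sub_eq_add_neg, ← pexp_const p (-(q₁ + Y)), ← pexp_add]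
      congr 1
      funext a
      rw [hΔ]
      ring
    obtain ⟨κ, hκ⟩ : ∃ κ, κ = pexp p X - D - h * (P - D) := ⟨_, rfl⟩
    rw [← hκ] at hE
    have h2 : pexp p X = D + h * (P - D) + κ := by rw [hκ]; ring
    have h3 : pexp p Δ - h * (E * P - q') =
        E * (h * (h * P) - h * (h * D) + r * (D + h * P - h * D) + (1 + h + r) * κ) -
          (q₁ - q - h * q') := by
      rw [h1, h2, hexp, hYdef]
      ring
    have hrD : r * D ≤ 2 * h := by nlinarith [mul_le_mul_of_nonneg_right hr2 hD0]
    have hrD0 : 0 ≤ r * D := mul_nonneg hr0 hD0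
    have hhP0 : 0 ≤ h * P := mul_nonneg hh0.le hP0
    have hhD0 : 0 ≤ h * D := mul_nonneg hh0.le hD0
    have hrh : r ≤ h := hr2.trans hhh
    have hκ1 : |(1 + h + r) * κ| ≤ 3 * (K * h) := by
      rw [abs_mul, abs_of_nonneg (by linarith)]
      exact mul_le_mul (by linarith) hE (abs_nonneg _) (by norm_num)
    have h4 : |h * (h * P) - h * (h * D) + r * (D + h * P - h * D) + (1 + h + r) * κ| ≤
        (6 + 3 * K) * h := by
      have e1 : h * (h * P) ≤ h * 2 := mul_le_mul_of_nonneg_left hP hh0.le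
      have e2 : h * (h * D) ≤ h * 2 := mul_le_mul_of_nonneg_left hD hh0.le
      have e3 : r * (h * P) ≤ h * 2 := mul_le_mul hrh hP hhP0 hh0.le
      have e4 : r * (h * D) ≤ h * 2 := mul_le_mul hrh hD hhD0 hh0.le
      have e5 : 0 ≤ h * (h * P) := mul_nonneg hh0.le hhP0
      have e6 : 0 ≤ h * (h * D) := mul_nonneg hh0.le hhD0
      have e7 : 0 ≤ r * (h * P) := mul_nonneg hr0 hhP0
      have e8 : 0 ≤ r * (h * D) := mul_nonneg hr0 hhD0
      have e9 : r * (D + h * P - h * D) = r * D + r * (h * P) - r * (h * D) := by ring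
      have e10 : (6 + 3 * K) * h = 6 * h + 3 * (K * h) := by ring
      obtain ⟨f1, f2⟩ := abs_le.1 hκ1
      rw [abs_le, e9, e10]
      constructor <;> linarith
    rw [h3]
    calc _ ≤ |E * (h * (h * P) - h * (h * D) + r * (D + h * P - h * D) + (1 + h + r) * κ)| +
          |q₁ - q - h * q'| := abs_sub _ _
      _ ≤ (B * h) * ((6 + 3 * K) * h) + B * h ^ 2 := by
          gcongr
          rw [abs_mul, abs_of_pos hE0]
          gcongr
      _ = _ := by ring
  have hdev : ∀ a ∈ p.support, Δ a ^ 2 ≤ (12 * B * h) ^ 2 := by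
    intro a ha
    obtain ⟨κ, hκ⟩ : ∃ κ, κ = X a - D := ⟨_, rfl⟩
    have h1 := hX a ha
    rw [← hκ] at h1
    have h2 : X a = D + κ := by rw [hκ]; ring
    have h3 : Δ a = E * (h * D + r * D + (1 + h + r) * κ) - (q₁ - q - h * q') - h * q' := by
      simp only [hΔ]
      rw [h2, hexp, hYdef]
      ring
    have hrD : r * D ≤ 2 * h := by nlinarith [mul_le_mul_of_nonneg_right hr2 hD0]
    have hrD0 : 0 ≤ r * D := mul_nonneg hr0 hD0
    have hhD0 : 0 ≤ h * D := mul_nonneg hh0.le hD0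
    have hrh : r ≤ h := hr2.trans hhh
    have h4 : |h * D + r * D + (1 + h + r) * κ| ≤ 10 := by
      have : |(1 + h + r) * κ| ≤ 3 * 2 := by
        rw [abs_mul, abs_of_nonneg (by linarith)]
        exact mul_le_mul (by linarith) h1 (abs_nonneg _) (by norm_num)
      have := abs_le.1 this
      rw [abs_le]
      constructor <;> linarith
    refine sq_le_sq' ?_ ?_ <;> rw [h3]
    all_goals
      have e1 : |E * (h * D + r * D + (1 + h + r) * κ)| ≤ (B * h) * 10 := by
        rw [abs_mul, abs_of_pos hE0]
        gcongr
      have e2 : |h * q'| ≤ h * B := by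
        rw [abs_mul, abs_of_pos hh0]
        gcongr
      have e3 : B * h ^ 2 ≤ B * h := by gcongr
      have := abs_le.1 e1
      have := abs_le.1 e2
      have := abs_le.1 hq
      linarith
  have hvar : pexp p (fun a => Δ a ^ 2) ≤ (12 * B * h) ^ 2 := by
    rw [← pexp_const p ((12 * B * h) ^ 2)]
    exact pexp_mono p hdev
  rw [hsq]
  have hcross : Y * pexp p Δ ≤ Y * (h * (E * P - q')) + B * ((7 + 3 * K) * B * h ^ 2) := by
    have : |Y * (pexp p Δ - h * (E * P - q'))| ≤ B * ((7 + 3 * K) * B * h ^ 2) := by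
      rw [abs_mul]
      gcongr
    have := (abs_le.1 this).2
    linarith
  have e1 : (158 + 6 * K) * B ^ 2 * h ^ 2 =
      2 * (B * ((7 + 3 * K) * B * h ^ 2)) + (12 * B * h) ^ 2 := by ring
  rw [e1]
  linarith

lemma pow_taylor_le (j : ℕ) {τ h : ℝ} (hτ : 0 ≤ τ) (h0 : 0 ≤ h) (h1 : h ≤ 1) :
    |(τ + h) ^ j - τ ^ j - h * (j * τ ^ (j - 1))| ≤ h ^ 2 * (j ^ 2 * (τ + 1) ^ j) := by
  have key : 0 ≤ (τ + h) ^ j - τ ^ j - h * (j * τ ^ (j - 1)) ∧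
      (τ + h) ^ j - τ ^ j - h * (j * τ ^ (j - 1)) ≤ h ^ 2 * (j ^ 2 * (τ + 1) ^ j) := by
    induction j with
    | zero => simp
    | succ j ih =>
      -- The Taylor remainder R_j satisfies R_{j+1} = h² j τ^(j-1) + (τ + h) R_j; for j = 0 the
      -- truncated exponent is harmless because of the factor j.
      have hrec : (τ + h) ^ (j + 1) - τ ^ (j + 1) - h * (((j + 1 : ℕ) : ℝ) * τ ^ (j + 1 - 1)) =
          h ^ 2 * (j * τ ^ (j - 1)) + (τ + h) * ((τ + h) ^ j - τ ^ j - h * (j * τ ^ (j - 1))) := by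
        rcases j with _ | j
        · simp
        · simp only [Nat.add_sub_cancel]
          push_cast
          ring
      rw [hrec]
      refine ⟨add_nonneg (by positivity) (mul_nonneg (by positivity) ih.1), ?_⟩
      have e1 : τ ^ (j - 1) ≤ (τ + 1) ^ (j + 1) :=
        (pow_le_pow_left₀ hτ (by linarith) _).trans
          (pow_le_pow_right₀ (by linarith) (by omega))
      calc h ^ 2 * (j * τ ^ (j - 1)) + (τ + h) * ((τ + h) ^ j - τ ^ j - h * (j * τ ^ (j - 1)))
          ≤ h ^ 2 * (j * (τ + 1) ^ (j + 1)) + (τ + 1) * (h ^ 2 * (j ^ 2 * (τ + 1) ^ j)) := by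
            gcongr
            · exact ih.1
            · exact ih.2
        _ = h ^ 2 * ((j + j ^ 2) * (τ + 1) ^ (j + 1)) := by ring
        _ ≤ h ^ 2 * (((j + 1 : ℕ) : ℝ) ^ 2 * (τ + 1) ^ (j + 1)) := by
            gcongr
            push_cast
            nlinarith [(Nat.cast_nonneg j : (0 : ℝ) ≤ j)]
  rw [abs_of_nonneg key.1]
  exact key.2

/-- The deviation `e ^ τ D_j - n τ ^ j / j!` of the rescaled degree count from its fluid limit at
internal time `τ`. -/
def fluidDev (j : ℕ) (τ : ℝ) (G : SimpleGraph (Fin n)) : ℝ :=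
  Real.exp τ * degreeCount j G - n * (τ ^ j / j.factorial)

/-- The sum of the squares of the normalised deviations from the fluid limit. -/
def fluidPotential (d : ℕ) (L τ : ℝ) (G : SimpleGraph (Fin n)) : ℝ :=
  ∑ j ∈ Finset.range d, (fluidDev j τ G / (n * L ^ j)) ^ 2

lemma fluidPotential_nonneg (d : ℕ) (L τ : ℝ) (G : SimpleGraph (Fin n)) :
    0 ≤ fluidPotential d L τ G := Finset.sum_nonneg fun _ _ => sq_nonneg _

lemma abs_fluidDev_le {d j : ℕ} (hj : j < d) {L τ ε : ℝ} (hL : 0 < L) (hn : 0 < n)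
    {G : SimpleGraph (Fin n)} (hε : 0 ≤ ε) (h : fluidPotential d L τ G ≤ ε ^ 2) :
    |fluidDev j τ G| ≤ ε * (n * L ^ j) := by
  have h0 : (0 : ℝ) < n := by exact_mod_cast hn
  have h1 : (fluidDev j τ G / (n * L ^ j)) ^ 2 ≤ ε ^ 2 :=
    (Finset.single_le_sum (f := fun j => (fluidDev j τ G / (n * L ^ j)) ^ 2)
      (fun _ _ => sq_nonneg _) (Finset.mem_range.2 hj)).trans h
  have h2 := abs_le_of_sq_le_sq h1 hε
  rw [abs_div, abs_of_pos (by positivity : (0 : ℝ) < n * L ^ j),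
    div_le_iff₀ (by positivity)] at h2
  exact h2

lemma sum_degreeCount (d : ℕ) (G : SimpleGraph (Fin n)) :
    ((unsat d G).card : ℝ) = ∑ j ∈ Finset.range d, (degreeCount j G : ℝ) := by
  simp_rw [degreeCount_cast]
  rw [Finset.sum_comm, unsat, ← Finset.sum_boole]
  refine Finset.sum_congr rfl fun v _ => ?_
  rw [Finset.sum_ite_eq]
  simp

/-- The cross terms of the drift are at most a multiple of the potential. -/
lemma sum_fluidDev_mul_le {d : ℕ} {L τ : ℝ} (hL : 1 ≤ L) (hn : 0 < n) (G : SimpleGraph (Fin n)) :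
    ∑ j ∈ Finset.range d, fluidDev j τ G *
      (Real.exp τ * predCount j G - n * (j * τ ^ (j - 1) / j.factorial)) / (n * L ^ j) ^ 2 ≤
      fluidPotential d L τ G / L := by
  have hL0 : 0 < L := by linarith
  have h0 : (0 : ℝ) < n := by exact_mod_cast hn
  rcases d with _ | d
  · simp [fluidPotential]
  rw [Finset.sum_range_succ']
  have e0 : fluidDev 0 τ G * (Real.exp τ * predCount 0 G -
      n * (((0 : ℕ) : ℝ) * τ ^ (0 - 1) / (0 : ℕ).factorial)) / (n * L ^ 0) ^ 2 = 0 := by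
    simp [predCount_zero]
  -- The derivative of τ^(j+1)/(j+1)! is τ^j/j!, so the drift of each deviation is exactly the
  -- previous deviation. The normalisations of the two differ by one factor L, which is where the
  -- gain 1/L comes from.
  have e1 : ∀ j : ℕ, Real.exp τ * predCount (j + 1) G -
      n * (((j + 1 : ℕ) : ℝ) * τ ^ (j + 1 - 1) / (j + 1).factorial) = fluidDev j τ G := by
    intro j
    rw [fluidDev, predCount_succ, Nat.factorial_succ, Nat.add_sub_cancel]
    have : ((j + 1 : ℕ) : ℝ) ≠ 0 := by positivity
    have : (j.factorial : ℝ) ≠ 0 := by positivity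
    push_cast
    field_simp
  rw [e0, add_zero]
  set z : ℕ → ℝ := fun j => fluidDev j τ G / (n * L ^ j) with hz
  have e2 : ∀ j : ℕ, fluidDev (j + 1) τ G * (Real.exp τ * predCount (j + 1) G -
      n * (((j + 1 : ℕ) : ℝ) * τ ^ (j + 1 - 1) / (j + 1).factorial)) / (n * L ^ (j + 1)) ^ 2 =
      z (j + 1) * z j / L := by
    intro j
    rw [e1, hz]
    field_simp
    ring
  simp_rw [e2]
  rw [← Finset.sum_div]
  refine div_le_div_of_nonneg_right ?_ hL0.le
  have e3 : fluidPotential (d + 1) L τ G = ∑ j ∈ Finset.range (d + 1), z j ^ 2 := rfl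
  have e4 : ∑ j ∈ Finset.range (d + 1), z j ^ 2 = ∑ j ∈ Finset.range d, z j ^ 2 + z d ^ 2 :=
    Finset.sum_range_succ _ _
  have e5 : ∑ j ∈ Finset.range (d + 1), z j ^ 2 =
      ∑ j ∈ Finset.range d, z (j + 1) ^ 2 + z 0 ^ 2 := Finset.sum_range_succ' _ _
  have e6 : ∑ j ∈ Finset.range d, z (j + 1) * z j ≤
      ∑ j ∈ Finset.range d, (z (j + 1) ^ 2 + z j ^ 2) / 2 :=
    Finset.sum_le_sum fun j _ => by nlinarith [sq_nonneg (z (j + 1) - z j)]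
  rw [← Finset.sum_div, Finset.sum_add_distrib] at e6
  rw [e3]
  nlinarith [sq_nonneg (z d), sq_nonneg (z 0)]

/-- The constant in the one-step bound for the potential. -/
def stepConst (d : ℕ) : ℝ := d * ((158 + 12 * d) * (2 * d ^ 2 * (3 * d) ^ d) ^ 2)

lemma stepConst_nonneg (d : ℕ) : 0 ≤ stepConst d := by unfold stepConst; positivity

-- The second-moment expansion is applied to each index and summed: the cross terms cost 2h/L times
-- the potential, with h = 2/u. The assumption that the potential is at most 1 serves only to bound
-- the size of one jump; the bound on `τ` keeps all powers of it polylogarithmic in n.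
set_option maxHeartbeats 1000000 in
lemma pexp_step_fluidPotential_le {d : ℕ} (hd : 1 ≤ d) {L τ : ℝ} (hL : 1 ≤ L) (hn : 0 < n)
    {G : SimpleGraph (Fin n)} (hu : 2 * d ≤ (unsat d G).card) (hτ0 : 0 ≤ τ) (hτ : τ ≤ 2 * d * L)
    (hV : fluidPotential d L τ G ≤ 1) :
    pexp (step d G) (fluidPotential d L (τ + 2 / (unsat d G).card)) ≤
      (1 + 2 * (2 / (unsat d G).card) / L) * fluidPotential d L τ G +
        stepConst d * L ^ (2 * d) * (2 / ((unsat d G).card : ℝ)) ^ 2 := by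
  classical
  have hd1 : (1 : ℝ) ≤ d := by exact_mod_cast hd
  have hn0 : (0 : ℝ) < n := by exact_mod_cast hn
  have hu1 : (2 * d : ℝ) ≤ (unsat d G).card := by exact_mod_cast hu
  have hudef := sum_degreeCount d G
  have hpred : ∀ {i}, i < d → predCount i G + degreeCount i G ≤ (unsat d G).card :=
    fun hi => predCount_add_degreeCount_le hi G
  have hmean : ∀ {i}, i < d → |pexp (step d G) (fun H => (degreeCount i H : ℝ)) - degreeCount i G -
      2 / (unsat d G).card * (predCount i G - degreeCount i G)| ≤
      2 * d * (2 / (unsat d G).card) := fun hi => abs_pexp_step_degreeCount_le hi hu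
  have hsup : ∀ i, ∀ H ∈ (step d G).support,
      |(degreeCount i H : ℝ) - degreeCount i G| ≤ 2 := by
    intro i H hH
    unfold step at hH
    rw [dif_pos (available_nonempty_of_card hd hu), PMF.mem_support_map_iff] at hH
    obtain ⟨e, he, rfl⟩ := hH
    rw [PMF.mem_support_uniformOfFinset_iff] at he
    exact abs_degreeCount_addEdge_sub_le he i
  generalize ((unsat d G).card : ℝ) = u at *
  have hu0 : 0 < u := by linarith
  obtain ⟨h, hh⟩ : ∃ h, h = 2 / u := ⟨_, rfl⟩
  simp only [← hh] at hmean ⊢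
  have hhu : h * u = 2 := by rw [hh]; field_simp
  have hh0 : 0 < h := by rw [hh]; positivity
  have hh1 : h ≤ 1 := by rw [hh, div_le_one hu0]; linarith
  -- A common bound for all powers up to `d` of L, τ and τ + 1, the last because τ ≤ 2dL and 1 ≤ dL.
  set M : ℝ := (3 * d * L) ^ d with hM
  have hdL : 1 ≤ d * L := one_le_mul_of_one_le_of_one_le hd1 hL
  have hM0 : 0 ≤ M := by positivity
  have hMj : ∀ {a : ℝ} {i : ℕ}, i ≤ d → 0 ≤ a → a ≤ 3 * d * L → a ^ i ≤ M := by
    intro a i hi ha0 ha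
    exact (pow_le_pow_left₀ ha0 ha i).trans (pow_le_pow_right₀ (by linarith) hi)
  set B : ℝ := 2 * d ^ 2 * n * M with hB
  have hdd : (d : ℝ) ≤ d ^ 2 := by nlinarith
  have hdev : ∀ {j}, j < d → |fluidDev j τ G| ≤ n * L ^ j := by
    intro j hj
    have := abs_fluidDev_le hj (by linarith : 0 < L) hn zero_le_one (by simpa using hV)
    simpa using this
  have hfac : ∀ j : ℕ, ∀ {a : ℝ}, 0 ≤ a → a / j.factorial ≤ a := fun j a ha =>
    div_le_self ha (by exact_mod_cast Nat.factorial_pos j)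
  -- Since the potential is at most 1, each e^τ D_j with j < d is at most n(τ^j/j! + L^j) ≤ 2nM.
  -- Summing over j bounds e^τ u, and hu = 2 turns this into a bound by Bh.
  have hexp : Real.exp τ ≤ B * h := by
    have h1 : Real.exp τ * u ≤ ∑ j ∈ Finset.range d, 2 * n * M := by
      rw [hudef, Finset.mul_sum]
      refine Finset.sum_le_sum fun j hj => ?_
      have hj' := Finset.mem_range.1 hj
      have h2 := (abs_le.1 (hdev hj')).2
      have h3 : L ^ j ≤ M := hMj hj'.le (by linarith) (by nlinarith)
      have h4 : τ ^ j / j.factorial ≤ M :=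
        (hfac j (by positivity)).trans (hMj hj'.le hτ0 (by linarith))
      unfold fluidDev at h2
      nlinarith [mul_le_mul_of_nonneg_left h3 hn0.le, mul_le_mul_of_nonneg_left h4 hn0.le]
    rw [Finset.sum_const, Finset.card_range, nsmul_eq_mul] at h1
    have h2 : Real.exp τ * 2 ≤ (d * (2 * n * M)) * h := by
      calc Real.exp τ * 2 = (Real.exp τ * u) * h := by rw [← hhu]; ring
        _ ≤ _ := by gcongr
    have h3 : d * (2 * n * M) * h ≤ B * h := by
      have : d * (2 * n * M) ≤ B := by
        rw [hB]
        have : 0 ≤ (n : ℝ) * M := by positivity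
        nlinarith
      gcongr
    have := Real.exp_pos τ
    linarith
  have hterm : ∀ j ∈ Finset.range d,
      pexp (step d G) (fun H => (fluidDev j (τ + h) H / (n * L ^ j)) ^ 2) ≤
        (fluidDev j τ G / (n * L ^ j)) ^ 2 + 2 * h * (fluidDev j τ G *
          (Real.exp τ * predCount j G - n * (j * τ ^ (j - 1) / j.factorial)) / (n * L ^ j) ^ 2) +
        (158 + 12 * d) * (2 * d ^ 2 * M) ^ 2 * h ^ 2 := by
    intro j hj
    have hj' := Finset.mem_range.1 hj
    have hjd : (j : ℝ) ≤ d := by exact_mod_cast hj'.le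
    have hp := hpred hj'
    have hp0 := predCount_nonneg j G
    have hD0 : (0 : ℝ) ≤ degreeCount j G := Nat.cast_nonneg _
    have key := pexp_sq_le (step d G) (fun H => (degreeCount j H : ℝ)) (D := degreeCount j G)
      (P := predCount j G) (K := 2 * d) (h := h) (τ := τ) (B := B) (q := n * (τ ^ j / j.factorial))
      (q₁ := n * ((τ + h) ^ j / j.factorial)) (q' := n * (j * τ ^ (j - 1) / j.factorial))
      hh0 hh1 hD0 hp0 (by rw [← hhu]; gcongr; linarith) (by rw [← hhu]; gcongr; linarith)
      (hsup j) (hmean hj') hexp ?_ ?_ ?_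
    · have h1 : pexp (step d G) (fun H => (fluidDev j (τ + h) H / (n * L ^ j)) ^ 2) =
          ((n * L ^ j) ^ 2)⁻¹ * pexp (step d G) (fun H => (Real.exp (τ + h) * degreeCount j H -
            n * ((τ + h) ^ j / j.factorial)) ^ 2) := by
        rw [← pexp_const_mul]
        congr 1
        funext H
        rw [fluidDev, div_pow, inv_mul_eq_div]
      have hLj : 1 ≤ L ^ j := one_le_pow₀ hL
      rw [h1]
      refine (mul_le_mul_of_nonneg_left key (by positivity)).trans ?_
      have h2 : ((n * L ^ j) ^ 2)⁻¹ * ((158 + 6 * (2 * d)) * B ^ 2 * h ^ 2) ≤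
          (158 + 12 * d) * (2 * d ^ 2 * M) ^ 2 * h ^ 2 := by
        rw [inv_mul_eq_div, div_le_iff₀ (by positivity), hB]
        calc (158 + 6 * (2 * d)) * (2 * d ^ 2 * n * M) ^ 2 * h ^ 2
            = (158 + 12 * d) * (2 * d ^ 2 * M) ^ 2 * h ^ 2 * (n * 1) ^ 2 := by ring
          _ ≤ _ := by gcongr
      have h3 : ((n * L ^ j) ^ 2)⁻¹ * ((Real.exp τ * degreeCount j G - n * (τ ^ j / j.factorial)) ^ 2 +
          2 * h * ((Real.exp τ * degreeCount j G - n * (τ ^ j / j.factorial)) *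
            (Real.exp τ * predCount j G - n * (j * τ ^ (j - 1) / j.factorial)))) =
          (fluidDev j τ G / (n * L ^ j)) ^ 2 + 2 * h * (fluidDev j τ G *
          (Real.exp τ * predCount j G - n * (j * τ ^ (j - 1) / j.factorial)) / (n * L ^ j) ^ 2) := by
        unfold fluidDev
        rw [div_pow, inv_mul_eq_div]
        ring
      rw [mul_add, h3]
      linarith
    · have h1 := pow_taylor_le j hτ0 hh0.le hh1
      have h2 : n * ((τ + h) ^ j / j.factorial) - n * (τ ^ j / j.factorial) -
          h * (n * (j * τ ^ (j - 1) / j.factorial)) =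
          n * (((τ + h) ^ j - τ ^ j - h * (j * τ ^ (j - 1))) / j.factorial) := by ring
      rw [h2, abs_mul, abs_div, Nat.abs_cast, Nat.abs_cast]
      have h3 : (τ + 1) ^ j ≤ M := hMj hj'.le (by linarith) (by nlinarith)
      calc n * (|(τ + h) ^ j - τ ^ j - h * (j * τ ^ (j - 1))| / j.factorial)
          ≤ n * (h ^ 2 * (d ^ 2 * M)) := by
            gcongr
            refine (hfac j (abs_nonneg _)).trans (h1.trans ?_)
            gcongr
        _ ≤ B * h ^ 2 := by
            rw [hB]
            have : 0 ≤ n * (h ^ 2 * (d ^ 2 * M)) := by positivity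
            nlinarith
    · rw [abs_of_nonneg (by positivity)]
      have h3 : τ ^ (j - 1) ≤ M := hMj (by omega) hτ0 (by nlinarith)
      calc n * (j * τ ^ (j - 1) / j.factorial) ≤ n * (d * M) := by
            gcongr
            refine (hfac j (by positivity)).trans ?_
            gcongr
        _ ≤ B := by
            rw [hB]
            have : 0 ≤ (n : ℝ) * M := by positivity
            nlinarith
    · refine (hdev hj').trans ?_
      have h3 : L ^ j ≤ M := hMj hj'.le (by linarith) (by nlinarith)
      calc n * L ^ j ≤ n * M := by gcongr
        _ ≤ B := by
            rw [hB]
            have : 0 ≤ (n : ℝ) * M := by positivity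
            nlinarith
  have hsum := Finset.sum_le_sum hterm
  rw [← pexp_sum, Finset.sum_add_distrib, Finset.sum_add_distrib, ← Finset.mul_sum,
    Finset.sum_const, Finset.card_range, nsmul_eq_mul] at hsum
  refine hsum.trans ?_
  have hc := sum_fluidDev_mul_le (d := d) (τ := τ) hL hn G
  have h1 : d * ((158 + 12 * d) * (2 * d ^ 2 * M) ^ 2 * h ^ 2) =
      stepConst d * L ^ (2 * d) * h ^ 2 := by
    rw [hM, stepConst, mul_pow (3 * (d : ℝ)) L d, pow_mul']
    ring
  rw [h1]
  have h2 : (1 + 2 * h / L) * fluidPotential d L τ G =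
      fluidPotential d L τ G + 2 * h * (fluidPotential d L τ G / L) := by ring
  rw [h2]
  have h3 := mul_le_mul_of_nonneg_left hc (by positivity : 0 ≤ 2 * h)
  unfold fluidPotential at *
  linarith

/-! ### Concentration by backward induction -/

/-- The expectation of `β` after `r` further steps, as a function of the current graph. -/
def expectAfter (d : ℕ) (β : SimpleGraph (Fin n) → ℝ) : ℕ → SimpleGraph (Fin n) → ℝ
  | 0 => β
  | r + 1 => fun G => pexp (step d G) (expectAfter d β r)

lemma pexp_expectAfter (d : ℕ) (β : SimpleGraph (Fin n) → ℝ) (r s : ℕ) :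
    pexp (graphLaw d n s) (expectAfter d β r) = pexp (graphLaw d n (s + r)) β := by
  induction r generalizing s with
  | zero => rfl
  | succ r ih =>
    have := ih (s + 1)
    rw [pexp_graphLaw_succ] at this
    rw [show s + (r + 1) = s + 1 + r by ring, ← this]
    rfl

lemma expectAfter_le_one (d : ℕ) {β : SimpleGraph (Fin n) → ℝ} (hβ : ∀ G, β G ≤ 1) (r : ℕ)
    (G : SimpleGraph (Fin n)) : expectAfter d β r G ≤ 1 := by
  induction r generalizing G with
  | zero => exact hβ G
  | succ r ih =>
    have := pexp_mono (step d G) (h := expectAfter d β r) (g := fun _ => 1) fun a _ => ih a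
    rwa [pexp_const] at this

lemma fluidPotential_bot {d : ℕ} (L : ℝ) (hn : 0 < n) :
    fluidPotential d L 0 (⊥ : SimpleGraph (Fin n)) = 0 := by
  have h0 : (n : ℝ) ≠ 0 := by exact_mod_cast hn.ne'
  refine Finset.sum_eq_zero fun j _ => ?_
  have h1 : ∀ v, deg (⊥ : SimpleGraph (Fin n)) v = 0 := by simp [deg]
  have h2 : fluidDev j 0 (⊥ : SimpleGraph (Fin n)) = 0 := by
    unfold fluidDev
    rw [degreeCount_cast]
    simp_rw [h1]
    rcases j with _ | j <;> simp
  rw [h2]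
  simp

/-- From log y ≤ y - 1 at y = (x - 2)/x. One step lowers the deficiency by 2, so sums of 2/x over
steps telescope to logarithms. -/
lemma two_div_le_log_sub {x : ℝ} (hx : 2 < x) : 2 / x ≤ Real.log x - Real.log (x - 2) := by
  have h0 : 0 < x := by linarith
  have h1 : 0 < x - 2 := by linarith
  have h2 := Real.log_le_sub_one_of_pos (div_pos h1 h0)
  rw [Real.log_div h1.ne' h0.ne'] at h2
  have h3 : (x - 2) / x - 1 = -(2 / x) := by field_simp; ring
  linarith

/-- A function of the graph after `S` steps that is controlled by the potential, at every possible
internal time, has small expectation. -/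
theorem pexp_graphLaw_le_of_fluidPotential {d S : ℕ} (hd : 1 ≤ d) {w : ℝ} (hw : 1 ≤ w)
    (hL : 1 ≤ Real.log n) (hdn : d ≤ n) (hS : 2 * S + 2 * d ^ 2 ≤ d * n)
    {β : SimpleGraph (Fin n) → ℝ} (hβ1 : ∀ G, β G ≤ 1)
    (hβ : ∀ G, Reach d S G → ∀ τ, 0 ≤ τ → τ ≤ 2 * d * Real.log n →
      β G ≤ w * fluidPotential d (Real.log n) τ G) :
    pexp (graphLaw d n S) β ≤
      w * Real.exp (4 * d) * (stepConst d * (2 * d ^ 2)) * Real.log n ^ (2 * d) /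
        (d * n - 2 * S) := by
  have hd1 : (1 : ℝ) ≤ d := by exact_mod_cast hd
  have hn : 0 < n := by omega
  have hn0 : (0 : ℝ) < n := by exact_mod_cast hn
  set L := Real.log n with hLdef
  have hL0 : 0 < L := by linarith
  have hS' : (2 * S + 2 * d ^ 2 : ℝ) ≤ d * n := by exact_mod_cast hS
  set x : ℕ → ℝ := fun s => d * n - 2 * s with hx
  have hxS : 2 * (d : ℝ) ^ 2 ≤ x S := by simp only [hx]; linarith
  have hxS2 : 2 ≤ x S := by nlinarith
  have hxs : ∀ s, s ≤ S → x S ≤ x s := by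
    intro s hs
    have : (s : ℝ) ≤ S := by exact_mod_cast hs
    simp only [hx]; linarith
  have hxsucc : ∀ s, x (s + 1) = x s - 2 := by
    intro s
    simp only [hx]
    push_cast
    ring
  -- A deterministic bound for the random internal time: its increments 2/u are at most 2d/x, whose
  -- sum telescopes.
  set b : ℕ → ℝ := fun s => d * (Real.log (d * n) - Real.log (x s)) with hb
  have hlogdn : Real.log (d * n) ≤ 2 * L := by
    rw [Real.log_mul (by positivity) (by positivity)]
    have : Real.log d ≤ Real.log n := Real.log_le_log (by linarith) (by exact_mod_cast hdn)
    linarith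
  have hbS : ∀ s, s ≤ S → b s ≤ 2 * d * L := by
    intro s hs
    have h1 : 0 ≤ Real.log (x s) := Real.log_nonneg (by linarith [hxs s hs])
    simp only [hb]
    nlinarith
  set K : ℝ := stepConst d * L ^ (2 * d) * (2 * d ^ 2) with hK
  have hK0 : 0 ≤ K := by have := stepConst_nonneg d; positivity
  -- The claim holds for every admissible `τ`, so the clock, which depends on the history, need not
  -- be part of the state. The exponential collects the growth factors of the remaining steps, and
  -- `K` times the difference of reciprocals collects their noise.
  have main : ∀ r s, s + r = S → ∀ G : SimpleGraph (Fin n), Reach d s G → ∀ τ, 0 ≤ τ → τ ≤ b s →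
      expectAfter d β r G ≤ w * (Real.exp (2 * (b S - b s) / L) *
        (fluidPotential d L τ G + K * (1 / x S - 1 / x s))) := by
    intro r
    induction r with
    | zero =>
      intro s hs G hG τ hτ0 hτ
      rw [add_zero] at hs
      subst hs
      simpa [expectAfter] using hβ G hG τ hτ0 (hτ.trans (hbS s le_rfl))
    | succ r ih =>
      intro s hs G hG τ hτ0 hτ
      have hsS : s + 1 ≤ S := by omega
      have hxs1 := hxs (s + 1) hsS
      have hx1 := hxsucc s
      have hxpos : 0 < x s := by linarith
      have hux : x s ≤ d * (unsat d G).card := hG.le_card_unsat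
      have hu1 : 2 * (d : ℝ) ≤ (unsat d G).card := by
        by_contra hc
        push Not at hc
        nlinarith
      have hu : 2 * d ≤ (unsat d G).card := by exact_mod_cast hu1
      have hh : 2 / ((unsat d G).card : ℝ) ≤ d * (2 / x s) := by
        rw [← mul_div_assoc, div_le_div_iff₀ (by linarith) hxpos]
        linarith
      have hh0 : 0 ≤ 2 / ((unsat d G).card : ℝ) := by positivity
      have hbb : d * (2 / x s) ≤ b (s + 1) - b s := by
        have := two_div_le_log_sub (x := x s) (by linarith)
        simp only [hb]
        rw [hx1]
        nlinarith
      have hbs : b s ≤ b (s + 1) := by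
        have : 0 ≤ d * (2 / x s) := by positivity
        linarith
      have hbs1 : b (s + 1) ≤ b S := by
        have := Real.log_le_log (by linarith) hxs1
        simp only [hb]
        nlinarith
      have hVnn := fluidPotential_nonneg d L τ G
      have hcnn : 0 ≤ 1 / x S - 1 / x s :=
        sub_nonneg.2 (one_div_le_one_div_of_le (by linarith) (by linarith))
      have hexp1 : 1 ≤ Real.exp (2 * (b S - b s) / L) :=
        Real.one_le_exp (div_nonneg (by linarith) hL0.le)
      by_cases hV : fluidPotential d L τ G ≤ 1
      · set h := 2 / ((unsat d G).card : ℝ) with hhdef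
        have hstep := pexp_step_fluidPotential_le hd hL hn hu hτ0 (hτ.trans (hbS s (by omega))) hV
        rw [← hhdef] at hstep
        set a := Real.exp (2 * (b S - b (s + 1)) / L) with ha
        have ha0 : 0 < a := Real.exp_pos _
        have h1 : expectAfter d β (r + 1) G ≤ w * (a * (pexp (step d G)
            (fluidPotential d L (τ + h)) + K * (1 / x S - 1 / x (s + 1)))) := by
          rw [← pexp_const (step d G) (K * (1 / x S - 1 / x (s + 1))), ← pexp_add,
            ← pexp_const_mul, ← pexp_const_mul]
          refine pexp_mono _ fun H hH => ?_
          have hs2 : 2 * s + d * d < d * n := by nlinarith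
          exact ih (s + 1) (by omega) H (reach_of_mem_support_step hG hs2 hH) (τ + h)
            (by linarith) (by linarith)
        refine h1.trans (mul_le_mul_of_nonneg_left ?_ (by linarith))
        have h2 : a * (1 + 2 * h / L) ≤ Real.exp (2 * (b S - b s) / L) := by
          have : 1 + 2 * h / L ≤ Real.exp (2 * (b (s + 1) - b s) / L) := by
            have h3 := Real.add_one_le_exp (2 * h / L)
            have h4 : 2 * h / L ≤ 2 * (b (s + 1) - b s) / L := by
              gcongr
              linarith
            have := Real.exp_le_exp.2 h4
            linarith
          calc a * (1 + 2 * h / L) ≤ a * Real.exp (2 * (b (s + 1) - b s) / L) := by gcongr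
            _ = _ := by
              rw [ha, ← Real.exp_add]
              congr 1
              ring
        -- With h ≤ 2d/x, the noise h² is at most 2d² times 2/(x(x - 2)), which is the telescoping
        -- difference 1/(x - 2) - 1/x.
        have h5 : stepConst d * L ^ (2 * d) * h ^ 2 ≤ K * (1 / x (s + 1) - 1 / x s) := by
          have h6 : 1 / x (s + 1) - 1 / x s = 2 / (x s * (x s - 2)) := by
            rw [hx1]
            have : x s - 2 ≠ 0 := by linarith
            field_simp
            ring
          have h7 : h ^ 2 ≤ (d * (2 / x s)) ^ 2 := pow_le_pow_left₀ hh0 hh 2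
          have h8 : (d * (2 / x s)) ^ 2 ≤ 2 * d ^ 2 * (2 / (x s * (x s - 2))) := by
            have e : (d * (2 / x s)) ^ 2 = 2 * d ^ 2 * (2 / (x s * x s)) := by
              field_simp
            rw [e]
            have : 0 < x s - 2 := by linarith
            gcongr
            linarith
          have := stepConst_nonneg d
          calc stepConst d * L ^ (2 * d) * h ^ 2
              ≤ stepConst d * L ^ (2 * d) * (2 * d ^ 2 * (2 / (x s * (x s - 2)))) :=
                mul_le_mul_of_nonneg_left (h7.trans h8) (by positivity)
            _ = K * (1 / x (s + 1) - 1 / x s) := by rw [h6, hK]; ring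
        have ha1 : a ≤ Real.exp (2 * (b S - b s) / L) := by
          rw [ha]
          gcongr
        calc a * (pexp (step d G) (fluidPotential d L (τ + h)) + K * (1 / x S - 1 / x (s + 1)))
            ≤ a * ((1 + 2 * h / L) * fluidPotential d L τ G + K * (1 / x S - 1 / x s)) := by
              refine mul_le_mul_of_nonneg_left ?_ ha0.le
              have : K * (1 / x S - 1 / x (s + 1)) + K * (1 / x (s + 1) - 1 / x s) =
                  K * (1 / x S - 1 / x s) := by ring
              linarith
          _ = (a * (1 + 2 * h / L)) * fluidPotential d L τ G + a * (K * (1 / x S - 1 / x s)) := by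
              ring
          _ ≤ Real.exp (2 * (b S - b s) / L) * fluidPotential d L τ G +
              Real.exp (2 * (b S - b s) / L) * (K * (1 / x S - 1 / x s)) := by gcongr
          _ = _ := by ring
      -- If the potential exceeds 1 the right-hand side is at least 1 and `β ≤ 1` suffices; this
      -- replaces a stopping time.
      · push Not at hV
        refine (expectAfter_le_one d hβ1 (r + 1) G).trans ?_
        have : 1 ≤ fluidPotential d L τ G + K * (1 / x S - 1 / x s) := by
          have := mul_nonneg hK0 hcnn
          linarith
        exact one_le_mul_of_one_le_of_one_le hw (one_le_mul_of_one_le_of_one_le hexp1 this)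
  have h0 := main S 0 (by omega) ⊥ (reach_bot d) 0 le_rfl (by simp [hb, hx])
  rw [fluidPotential_bot L hn, zero_add] at h0
  have h1 := pexp_expectAfter d β S 0
  rw [zero_add] at h1
  rw [← h1]
  simp only [graphLaw, pexp_pure]
  refine h0.trans ?_
  have hb0 : b 0 = 0 := by simp [hb, hx]
  -- Growth at rate 2/L over an internal time of at most 2dL costs only the constant factor e^(4d).
  have h2 : Real.exp (2 * (b S - b 0) / L) ≤ Real.exp (4 * d) := by
    rw [hb0, Real.exp_le_exp, div_le_iff₀ hL0]
    have := hbS S le_rfl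
    linarith
  have h3 : K * (1 / x S - 1 / x 0) ≤ K * (1 / x S) := by
    have : 0 ≤ 1 / x 0 := one_div_nonneg.2 (by linarith [hxs 0 (by omega)])
    gcongr
    linarith
  have h4 : 0 ≤ 1 / x S := one_div_nonneg.2 (by linarith)
  calc w * (Real.exp (2 * (b S - b 0) / L) * (K * (1 / x S - 1 / x 0)))
      ≤ w * (Real.exp (2 * (b S - b 0) / L) * (K * (1 / x S))) := by gcongr
    _ ≤ w * (Real.exp (4 * d) * (K * (1 / x S))) := by gcongr
    _ = _ := by
      rw [hK]
      ring

/-! ### From a small potential to the degree ratios -/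

lemma Reach.deficiency_eq_sum {d s : ℕ} {G : SimpleGraph (Fin n)} (hG : Reach d s G) :
    (d * n : ℝ) - 2 * s = ∑ i ∈ Finset.range d, ((d : ℝ) - i) * degreeCount i G := by
  rw [hG.deficiency]
  simp_rw [degreeCount_cast, Finset.mul_sum]
  rw [Finset.sum_comm, unsat, Finset.sum_filter]
  refine Finset.sum_congr rfl fun v _ => ?_
  simp only [mul_ite, mul_one, mul_zero]
  rw [Finset.sum_ite_eq]
  simp

/-- The limiting ratio of `D_j log ^ (d - 1 - j) n` and the deficiency. -/
def limitRatio (d j : ℕ) : ℝ := (d - 1).factorial / j.factorial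

lemma limitRatio_pos (d j : ℕ) : 0 < limitRatio d j := by unfold limitRatio; positivity

/-- The quotient of the normalised degree count and the normalised deficiency as a function of the
normalised internal time, the errors and the reciprocal of `log n`. -/
def ratioFun (d : ℕ) (j : Fin d) (p : ℝ × (Fin d → ℝ) × ℝ) : ℝ :=
  (p.1 ^ (j : ℕ) / (j : ℕ).factorial + p.2.1 j) /
    ∑ i : Fin d, ((d : ℝ) - (i : ℕ)) * p.2.2 ^ (d - 1 - (i : ℕ)) *
      (p.1 ^ (i : ℕ) / (i : ℕ).factorial + p.2.1 i)

/-- At the limit point only i = d - 1 survives, through 0^0 = 1: asymptotically the whole deficiency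
sits on vertices of degree d - 1. -/
lemma ratioFun_denom {d : ℕ} (hd : 1 ≤ d) :
    ∑ i : Fin d, ((d : ℝ) - (i : ℕ)) * (0 : ℝ) ^ (d - 1 - (i : ℕ)) *
      ((1 : ℝ) ^ (i : ℕ) / (i : ℕ).factorial + 0) = 1 / (d - 1).factorial := by
  rw [Finset.sum_eq_single (⟨d - 1, by omega⟩ : Fin d)]
  · have : ((d : ℝ) - ((d - 1 : ℕ) : ℝ)) = 1 := by
      rw [Nat.cast_sub hd]
      simp
    simp [this]
  · intro i _ hi
    have : d - 1 - (i : ℕ) ≠ 0 := by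
      intro h
      apply hi
      ext
      have := i.2
      simp
      omega
    simp [this]
  · simp

/-- Continuity at the point (1, 0, 0), where the denominator equals 1/(d - 1)! and so does not
vanish. -/
lemma eventually_ratioFun {d : ℕ} (hd : 1 ≤ d) {η : ℝ} (hη : 0 < η) :
    ∃ δ > 0, ∀ σ w : ℝ, ∀ e : Fin d → ℝ, |σ - 1| < δ → |w| < δ → (∀ i, |e i| < δ) →
      ∀ j : Fin d, |ratioFun d j (σ, e, w) - limitRatio d j| ≤ η := by
  have hcont : ∀ j : Fin d, ∀ᶠ p in nhds ((1 : ℝ), (0 : Fin d → ℝ), (0 : ℝ)),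
      |ratioFun d j p - limitRatio d j| ≤ η := by
    intro j
    have hval : ratioFun d j ((1 : ℝ), (0 : Fin d → ℝ), (0 : ℝ)) = limitRatio d j := by
      unfold ratioFun limitRatio
      simp only [Pi.zero_apply]
      rw [ratioFun_denom hd]
      simp
      field_simp
    have hc : ContinuousAt (ratioFun d j) ((1 : ℝ), (0 : Fin d → ℝ), (0 : ℝ)) := by
      unfold ratioFun
      refine ContinuousAt.div (by fun_prop) (by fun_prop) ?_
      simp only [Pi.zero_apply]
      rw [ratioFun_denom hd]
      positivity
    have := hc.eventually (Metric.closedBall_mem_nhds (ratioFun d j (1, 0, 0)) hη)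
    filter_upwards [this] with p hp
    rw [← hval, ← Real.dist_eq]
    exact hp
  obtain ⟨δ, hδ, H⟩ := Metric.eventually_nhds_iff.1 (Filter.eventually_all.2 hcont)
  refine ⟨δ, hδ, fun σ w e hσ hw he j => H ?_ j⟩
  rw [Prod.dist_eq, Prod.dist_eq, max_lt_iff, max_lt_iff, Real.dist_eq, Real.dist_eq, sub_zero,
    dist_pi_lt_iff hδ]
  refine ⟨hσ, fun i => ?_, hw⟩
  rw [Real.dist_eq]
  simpa using he i

/-- Numerator and deficiency are both multiplied by e^τ and divided by powers of L times n. The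
factor e^τ cancels in the quotient, so only τ/L has to be known, not τ to within a constant. -/
lemma ratio_eq_ratioFun {d S : ℕ} {L τ : ℝ} (hL : 0 < L) (hn : 0 < n)
    {G : SimpleGraph (Fin n)} (hG : Reach d S G) (j : Fin d) :
    degreeCount j G * L ^ (d - 1 - (j : ℕ)) / (d * n - 2 * S) =
      ratioFun d j (τ / L, fun i => fluidDev i τ G / (n * L ^ (i : ℕ)), 1 / L) := by
  have hn0 : (0 : ℝ) < n := by exact_mod_cast hn
  have hE := Real.exp_pos τ
  have h1 : ∀ i : ℕ, (τ / L) ^ i / i.factorial + fluidDev i τ G / (n * L ^ i) =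
      Real.exp τ * degreeCount i G / (n * L ^ i) := by
    intro i
    unfold fluidDev
    rw [div_pow]
    field_simp
    ring
  have hLd : L ^ (d - 1) ≠ 0 := by positivity
  unfold ratioFun
  simp only [h1]
  have h2 : ∑ i : Fin d, ((d : ℝ) - (i : ℕ)) * (1 / L) ^ (d - 1 - (i : ℕ)) *
      (Real.exp τ * degreeCount i G / (n * L ^ (i : ℕ))) =
      Real.exp τ / (n * L ^ (d - 1)) * (d * n - 2 * S) := by
    rw [hG.deficiency_eq_sum, Finset.mul_sum, Finset.sum_range]
    refine Finset.sum_congr rfl fun i _ => ?_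
    have e : L ^ (d - 1) = L ^ (d - 1 - (i : ℕ)) * L ^ (i : ℕ) := by
      rw [← pow_add]
      congr 1
      have := i.2
      omega
    rw [e, one_div, inv_pow]
    field_simp
  have e : L ^ (d - 1) = L ^ (d - 1 - (j : ℕ)) * L ^ (j : ℕ) := by
    rw [← pow_add]
    congr 1
    have := j.2
    omega
  rw [h2, e]
  field_simp

/-- If the potential is small for some internal time, the degree counts are close to their
predicted values. -/
lemma degreeCount_close_of_fluidPotential {d : ℕ} (hd : 1 ≤ d) {η : ℝ} (hη : 0 < η) :
    ∃ ε > 0, ε ≤ 1 ∧ ∃ δ > 0, ∃ L₀ : ℝ, ∀ (n S : ℕ) (G : SimpleGraph (Fin n)) (τ L x : ℝ),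
      L = Real.log n → x = d * n - 2 * S →
      Reach d S G → L₀ ≤ L → 1 ≤ x → Real.log x ≤ δ * L → 0 ≤ τ → τ ≤ 2 * d * L →
      fluidPotential d L τ G ≤ ε ^ 2 →
      ∀ j < d, |degreeCount j G * L ^ (d - 1 - j) / x - limitRatio d j| ≤ η := by
  obtain ⟨δ₀, hδ₀, hF⟩ := eventually_ratioFun hd hη
  have hd1 : (1 : ℝ) ≤ d := by exact_mod_cast hd
  -- The bound 1/2 ensures e^τ D_0 ≥ n/2, from which the lower bound for τ follows; the bound by δ₀
  -- keeps the normalised deviations inside the continuity neighbourhood.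
  obtain ⟨ε, hε⟩ : ∃ ε : ℝ, ε = min (1 / 2) (δ₀ / 2) := ⟨_, rfl⟩
  have hε0 : 0 < ε := by rw [hε]; positivity
  have hε1 : ε ≤ 1 / 2 := hε ▸ min_le_left _ _
  have hε2 : ε < δ₀ := lt_of_le_of_lt (hε ▸ min_le_right _ _) (half_lt_self hδ₀)
  obtain ⟨M, hM⟩ : ∃ M : ℝ, M = d * (d * ((2 * d) ^ d + 1)) := ⟨_, rfl⟩
  have hM0 : 0 < M := by rw [hM]; positivity
  have hlog : ∀ᶠ L : ℝ in atTop, Real.log M + (d : ℝ) * Real.log L ≤ δ₀ / 2 * L := by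
    have h1 : Tendsto (fun L : ℝ => Real.log M / L + d * (Real.log L / L)) atTop
        (nhds (0 + d * 0)) := by
      refine (tendsto_const_nhds.div_atTop tendsto_id).add (Tendsto.const_mul _ ?_)
      exact Real.isLittleO_log_id_atTop.tendsto_div_nhds_zero
    rw [mul_zero, add_zero] at h1
    filter_upwards [h1.eventually (gt_mem_nhds (half_pos hδ₀)), eventually_gt_atTop 0] with L h2 h3
    have : Real.log M / L + d * (Real.log L / L) = (Real.log M + d * Real.log L) / L := by
      field_simp
    rw [this, div_lt_iff₀ h3] at h2
    exact h2.le
  obtain ⟨L₁, hL₁⟩ := eventually_atTop.1 hlog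
  refine ⟨ε, hε0, by linarith, δ₀ / 4, by positivity, max L₁ (max 1 (4 / δ₀ + 1)), ?_⟩
  intro n S G τ L x hLdef hxdef hG hL hx1 hxδ hτ0 hτ hV j hj
  have hx : 0 < x := by linarith
  have hLa := (le_max_left _ _).trans hL
  have hLb := ((le_max_left _ _).trans (le_max_right _ _)).trans hL
  have hLc := ((le_max_right _ _).trans (le_max_right _ _)).trans hL
  have hlogL := hL₁ _ hLa
  have hn : 0 < n := by
    rcases Nat.eq_zero_or_pos n with rfl | h
    · simp [hLdef] at hLb
      linarith
    · exact h
  have hn0 : (0 : ℝ) < n := by exact_mod_cast hn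
  have hratio := ratio_eq_ratioFun (L := L) (τ := τ) (by linarith) hn hG ⟨j, hj⟩
  have hsum := hG.deficiency_eq_sum
  rw [← hxdef] at hsum hratio
  have hL0 : 0 < L := by linarith
  have hdev : ∀ i < d, |fluidDev i τ G| ≤ ε * (n * L ^ i) :=
    fun i hi => abs_fluidDev_le hi hL0 hn hε0.le hV
  have he : ∀ i : Fin d, |fluidDev i τ G / (n * L ^ (i : ℕ))| < δ₀ := by
    intro i
    rw [abs_div, abs_of_pos (by positivity : (0 : ℝ) < n * L ^ (i : ℕ)), div_lt_iff₀ (by positivity)]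
    refine (hdev i i.2).trans_lt ?_
    gcongr
  have hw : |1 / L| < δ₀ := by
    rw [abs_of_pos (by positivity), div_lt_iff₀ hL0]
    have : δ₀ * (4 / δ₀ + 1) ≤ δ₀ * L := by gcongr
    have h2 : δ₀ * (4 / δ₀ + 1) = 4 + δ₀ := by field_simp
    linarith
  have hδL : 4 ≤ δ₀ * L := by
    have : δ₀ * (4 / δ₀ + 1) ≤ δ₀ * L := by gcongr
    have h2 : δ₀ * (4 / δ₀ + 1) = 4 + δ₀ := by field_simp
    linarith
  have hexpL : Real.exp L = n := by rw [hLdef, Real.exp_log hn0]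
  -- From n/2 ≤ e^τ D_0 ≤ e^τ x; the constant 1 absorbs log 2, as 2 ≤ e.
  have hlow : L - Real.log x - 1 ≤ τ := by
    have h0 := (abs_le.1 (hdev 0 (by omega))).1
    have hD0 : (degreeCount 0 G : ℝ) ≤ x := by
      rw [hsum]
      have h1 : ((d : ℝ) - (0 : ℕ)) * degreeCount 0 G ≤
          ∑ i ∈ Finset.range d, ((d : ℝ) - i) * degreeCount i G := by
        refine Finset.single_le_sum (f := fun i : ℕ => ((d : ℝ) - i) * degreeCount i G) ?_
          (Finset.mem_range.2 (by omega))
        intro i hi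
        have : (i : ℝ) ≤ d := by exact_mod_cast (Finset.mem_range.1 hi).le
        exact mul_nonneg (by linarith) (Nat.cast_nonneg _)
      have h2 : (0 : ℝ) ≤ degreeCount 0 G := Nat.cast_nonneg _
      push_cast at h1
      nlinarith
    unfold fluidDev at h0
    simp only [pow_zero, Nat.factorial_zero, Nat.cast_one, mul_one, div_one] at h0
    have hE := Real.exp_pos τ
    have h3 : (n : ℝ) / 2 ≤ Real.exp τ * x := by
      have : Real.exp τ * degreeCount 0 G ≤ Real.exp τ * x := by gcongr
      nlinarith
    have h4 : Real.exp (L - Real.log x - 1) ≤ Real.exp τ := by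
      rw [Real.exp_sub, Real.exp_sub, hexpL, Real.exp_log hx, div_div, div_le_iff₀ (by positivity)]
      have : (2 : ℝ) ≤ Real.exp 1 := by linarith [Real.add_one_le_exp 1]
      calc (n : ℝ) = n / 2 * 2 := by ring
        _ ≤ (Real.exp τ * x) * Real.exp 1 := by gcongr
        _ = _ := by ring
    exact Real.exp_le_exp.1 h4
  -- Conversely e^τ ≤ e^τ x, and e^τ x is a combination of the e^τ D_i, each at most n times a power
  -- of L. With the lower bound this gives τ/L close to 1.
  have hup : τ ≤ L + (Real.log M + d * Real.log L) := by
    have h1 : Real.exp τ * x ≤ n * (M * L ^ d) := by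
      have h2 : ∀ i ∈ Finset.range d, Real.exp τ * (((d : ℝ) - i) * degreeCount i G) ≤
          d * (n * (((2 * d) ^ d + 1) * L ^ d)) := by
        intro i hi
        have hi' := Finset.mem_range.1 hi
        have h3 := (abs_le.1 (hdev i hi')).2
        have hid : (i : ℝ) ≤ d := by exact_mod_cast hi'.le
        have h4 : τ ^ i / i.factorial ≤ (2 * d) ^ d * L ^ d := by
          calc τ ^ i / i.factorial ≤ τ ^ i :=
                div_le_self (by positivity) (by exact_mod_cast Nat.factorial_pos i)
            _ ≤ (2 * d * L) ^ i := by gcongr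
            _ ≤ (2 * d * L) ^ d := pow_le_pow_right₀ (by nlinarith) hi'.le
            _ = _ := by rw [mul_pow]
        have h5 : L ^ i ≤ L ^ d := pow_le_pow_right₀ hLb hi'.le
        have h6 : Real.exp τ * degreeCount i G ≤ n * (((2 * d) ^ d + 1) * L ^ d) := by
          unfold fluidDev at h3
          have h7 : n * (τ ^ i / i.factorial) ≤ n * ((2 * d) ^ d * L ^ d) := by gcongr
          have h8 : ε * (n * L ^ i) ≤ 1 * (n * L ^ d) := by gcongr; linarith
          have h10 : n * (((2 * d) ^ d + 1) * L ^ d) =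
              n * ((2 * (d : ℝ)) ^ d * L ^ d) + 1 * (n * L ^ d) := by ring
          rw [h10]
          linarith
        have h9 : (0 : ℝ) ≤ i := Nat.cast_nonneg _
        calc Real.exp τ * (((d : ℝ) - i) * degreeCount i G)
            = ((d : ℝ) - i) * (Real.exp τ * degreeCount i G) := by ring
          _ ≤ d * (n * (((2 * d) ^ d + 1) * L ^ d)) := by
            gcongr
            linarith
      rw [hsum, Finset.mul_sum]
      refine (Finset.sum_le_sum h2).trans (le_of_eq ?_)
      rw [Finset.sum_const, Finset.card_range, nsmul_eq_mul, hM]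
      ring
    have h2 : Real.exp τ ≤ Real.exp (L + (Real.log M + d * Real.log L)) := by
      rw [Real.exp_add, Real.exp_add, hexpL, Real.exp_log hM0, ← Real.log_pow,
        Real.exp_log (by positivity)]
      exact (le_mul_of_one_le_right (Real.exp_pos τ).le hx1).trans h1
    exact Real.exp_le_exp.1 h2
  have hσ : |τ / L - 1| < δ₀ := by
    have : τ / L - 1 = (τ - L) / L := by field_simp
    rw [this, abs_div, abs_of_pos hL0, div_lt_iff₀ hL0, abs_lt]
    constructor <;> linarith
  have := hF (τ / L) (1 / L) _ hσ hw he ⟨j, hj⟩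
  rw [← hratio] at this
  exact this

/-! ### Weighted tuples and the upper drift -/

/-- The weight of a vertex of degree `i` at level `m`. -/
def levelWeight (lam : ℝ) (m i : ℕ) : ℝ := if i ≤ m then lam ^ (m - i) else 0

lemma levelWeight_nonneg {lam : ℝ} (hl : 0 ≤ lam) (m i : ℕ) : 0 ≤ levelWeight lam m i := by
  unfold levelWeight
  split_ifs <;> positivity

/-- Below the level a new edge lowers the exponent by one, and at the level the weight drops to
zero. Vertices entering degree m from below are thus paid for in advance by the weights, and no
separate gain term appears. -/
lemma levelWeight_succ_le {lam : ℝ} (hl : 1 ≤ lam) (m i : ℕ) :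
    levelWeight lam m (i + 1) ≤ lam⁻¹ * levelWeight lam m i := by
  have h0 : 0 < lam := by linarith
  unfold levelWeight
  by_cases h : i + 1 ≤ m
  · rw [if_pos h, if_pos (by omega), show m - i = (m - (i + 1)) + 1 by omega, pow_succ]
    field_simp
    exact le_rfl
  · rw [if_neg h]
    split_ifs <;> positivity

/-- The weighted number of injective `k`-tuples of vertices of degrees at most the given levels. -/
def tupleSum {k : ℕ} (lam : ℝ) (m : Fin k → ℕ) (G : SimpleGraph (Fin n)) : ℝ :=
  ∑ v : Fin k ↪ Fin n, ∏ l, levelWeight lam (m l) (deg G (v l))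

lemma tupleSum_nonneg {k : ℕ} {lam : ℝ} (hl : 0 ≤ lam) (m : Fin k → ℕ) (G : SimpleGraph (Fin n)) :
    0 ≤ tupleSum lam m G :=
  Finset.sum_nonneg fun _ _ => Finset.prod_nonneg fun _ _ => levelWeight_nonneg hl _ _

open Classical in
/-- Adding a pair that hits a tuple decreases the weight of the tuple by a factor `lam`. -/
lemma prod_levelWeight_addEdge_le {d k : ℕ} {lam : ℝ} (hl : 1 ≤ lam) (m : Fin k → ℕ)
    {G : SimpleGraph (Fin n)} {e : Sym2 (Fin n)} (he : e ∈ availablePairs d G)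
    (v : Fin k ↪ Fin n) :
    ∏ l, levelWeight lam (m l) (deg (addEdge G e) (v l)) ≤
      (1 - (1 - lam⁻¹) * if ∃ l, v l ∈ e then 1 else 0) *
        ∏ l, levelWeight lam (m l) (deg G (v l)) := by
  have h0 : 0 < lam := by linarith
  have hinv : lam⁻¹ ≤ 1 := inv_le_one_of_one_le₀ hl
  have hnn := fun l i => levelWeight_nonneg h0.le (m l) i
  have h1 : ∏ l, levelWeight lam (m l) (deg (addEdge G e) (v l)) ≤
      ∏ l, ((if v l ∈ e then lam⁻¹ else 1) * levelWeight lam (m l) (deg G (v l))) := by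
    refine Finset.prod_le_prod (fun l _ => hnn l _) fun l _ => ?_
    rw [deg_addEdge he]
    split_ifs
    · exact levelWeight_succ_le hl _ _
    · simp
  refine h1.trans ?_
  rw [Finset.prod_mul_distrib]
  refine mul_le_mul_of_nonneg_right ?_ (Finset.prod_nonneg fun l _ => hnn l _)
  have hnn' : ∀ l, 0 ≤ if v l ∈ e then lam⁻¹ else 1 := fun l => by split_ifs <;> positivity
  have hle' : ∀ l, (if v l ∈ e then lam⁻¹ else 1) ≤ 1 := fun l => by
    split_ifs
    · exact hinv
    · exact le_rfl
  by_cases hx : ∃ l, v l ∈ e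
  · rw [if_pos hx, mul_one, sub_sub_cancel]
    obtain ⟨l, hl⟩ := hx
    rw [← Finset.mul_prod_erase _ _ (Finset.mem_univ l), if_pos hl]
    exact mul_le_of_le_one_right (by positivity)
      (Finset.prod_le_one (fun l _ => hnn' l) fun l _ => hle' l)
  · rw [if_neg hx, mul_zero, sub_zero]
    exact Finset.prod_le_one (fun l _ => hnn' l) fun l _ => hle' l

open Classical in
/-- Few available pairs contain two vertices of a given tuple. -/
lemma sum_pairCount_le {d k : ℕ} (G : SimpleGraph (Fin n)) (v : Fin k ↪ Fin n) :
    ∑ l, (pairCount d G (v l) : ℝ) ≤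
      ∑ e ∈ availablePairs d G, (if ∃ l, v l ∈ e then (1 : ℝ) else 0) + (k : ℝ) ^ 2 := by
  -- The sum over members of the tuple counts a pair twice only if both its ends are in the tuple;
  -- there are at most k² such pairs.
  set P : Finset (Sym2 (Fin n)) :=
    (Finset.univ : Finset (Fin k × Fin k)).image (fun p => s(v p.1, v p.2)) with hP
  have hPcard : (P.card : ℝ) ≤ (k : ℝ) ^ 2 := by
    have : P.card ≤ k ^ 2 := by
      refine Finset.card_image_le.trans ?_
      simp [sq]
    exact_mod_cast this
  have h1 : ∑ l, (pairCount d G (v l) : ℝ) =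
      ∑ e ∈ availablePairs d G, ∑ l, (if v l ∈ e then (1 : ℝ) else 0) := by
    rw [Finset.sum_comm]
    refine Finset.sum_congr rfl fun l _ => ?_
    rw [Finset.sum_boole, pairCount]
  have h2 : ∀ e ∈ availablePairs d G, ∑ l, (if v l ∈ e then (1 : ℝ) else 0) ≤
      (if ∃ l, v l ∈ e then (1 : ℝ) else 0) + if e ∈ P then 1 else 0 := by
    intro e he
    rw [Finset.sum_boole]
    by_cases hx : ∃ l, v l ∈ e
    · rw [if_pos hx]
      by_cases hc : (Finset.univ.filter (fun l => v l ∈ e)).card ≤ 1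
      · have : ((Finset.univ.filter (fun l => v l ∈ e)).card : ℝ) ≤ 1 := by exact_mod_cast hc
        split_ifs <;> linarith
      · push Not at hc
        obtain ⟨a, ha, b, hb, hab⟩ := Finset.one_lt_card.1 hc
        have hmem : e = s(v a, v b) := by
          rw [Finset.mem_filter] at ha hb
          exact (Sym2.mem_and_mem_iff (fun h => hab (v.injective h))).1 ⟨ha.2, hb.2⟩
        have hPe : e ∈ P := Finset.mem_image.2 ⟨(a, b), Finset.mem_univ _, hmem.symm⟩
        rw [if_pos hPe]
        have h3 : (Finset.univ.filter (fun l => v l ∈ e)).card ≤ 2 := by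
          rw [← card_mem_of_mem_available he, ← Finset.card_map v]
          refine Finset.card_le_card fun w hw => ?_
          obtain ⟨l, hl, rfl⟩ := Finset.mem_map.1 hw
          rw [Finset.mem_filter] at hl ⊢
          exact ⟨Finset.mem_univ _, hl.2⟩
        have : ((Finset.univ.filter (fun l => v l ∈ e)).card : ℝ) ≤ 2 := by exact_mod_cast h3
        linarith
    · rw [if_neg hx, Finset.filter_false_of_mem fun l _ hl => hx ⟨l, hl⟩]
      split_ifs <;> simp
  rw [h1]
  refine (Finset.sum_le_sum h2).trans ?_
  rw [Finset.sum_add_distrib]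
  gcongr
  rw [Finset.sum_boole]
  refine le_trans ?_ hPcard
  have : ((availablePairs d G).filter (fun e => e ∈ P)).card ≤ P.card :=
    Finset.card_le_card fun e he => (Finset.mem_filter.1 he).2
  exact_mod_cast this

/-- The real inequality behind the lower bound for the probability to hit a tuple. -/
lemma hit_prob_lower {d k u x Q H : ℝ} (hd : 1 ≤ d) (hk : 0 ≤ k) (hu : 2 * d ≤ u) (hux : u ≤ x)
    (hxu : x ≤ d * u) (hQ0 : 0 < Q) (hQ : 2 * Q ≤ u * (u - 1)) (hH0 : 0 ≤ H)
    (hH : k * (u - d) ≤ H + k ^ 2) :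
    2 * k / x - 2 * d ^ 2 * k * (d + k) / x ^ 2 ≤ H / Q := by
  have hu0 : 0 < u := by linarith
  have hx0 : 0 < x := by linarith
  have h1 : 2 * k / u - 2 * k * (d + k) / u ^ 2 ≤ H / Q := by
    have e : 2 * k / u - 2 * k * (d + k) / u ^ 2 = 2 * (k * (u - d) - k ^ 2) / u ^ 2 := by
      field_simp
      ring
    rw [e, div_le_div_iff₀ (by positivity) hQ0]
    have h2 : 2 * (k * (u - d) - k ^ 2) * Q ≤ 2 * H * Q := by
      have : k * (u - d) - k ^ 2 ≤ H := by linarith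
      nlinarith
    have h3 : H * (2 * Q) ≤ H * u ^ 2 := by
      apply mul_le_mul_of_nonneg_left _ hH0
      nlinarith
    linarith
  -- The inequality u ≤ x goes the right way: a smaller u only makes hits more likely. Hence the
  -- upper bound needs no concentration of u.
  have h2 : 2 * k / x ≤ 2 * k / u := by gcongr
  have h3 : 2 * k * (d + k) / u ^ 2 ≤ 2 * d ^ 2 * k * (d + k) / x ^ 2 := by
    rw [div_le_div_iff₀ (by positivity) (by positivity)]
    have : x ^ 2 ≤ (d * u) ^ 2 := by gcongr
    calc 2 * k * (d + k) * x ^ 2 ≤ 2 * k * (d + k) * (d * u) ^ 2 := by gcongr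
      _ = _ := by ring
  linarith

/-- One step decreases the expected weighted tuple count at least by the expected factor. -/
theorem pexp_step_tupleSum_le {d k s : ℕ} (hd : 1 ≤ d) {lam x : ℝ} (hl : 1 ≤ lam) {m : Fin k → ℕ}
    (hm : ∀ l, m l < d) {G : SimpleGraph (Fin n)} (hG : Reach d s G) (hx : x = d * n - 2 * s)
    (hxd : 2 * (d : ℝ) ^ 2 ≤ x) :
    pexp (step d G) (tupleSum lam m) ≤
      (1 - 2 * k / x + 2 * d ^ 2 * k * (d + k) / x ^ 2 + 2 * k / (lam * x)) *
        tupleSum lam m G := by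
  classical
  have hd1 : (1 : ℝ) ≤ d := by exact_mod_cast hd
  have h0 : 0 < lam := by linarith
  have hx0 : 0 < x := by nlinarith
  have hux : ((unsat d G).card : ℝ) ≤ x := hx ▸ hG.card_unsat_le
  have hxu : x ≤ d * (unsat d G).card := hx ▸ hG.le_card_unsat
  have hu1 : 2 * (d : ℝ) ≤ (unsat d G).card := by
    by_contra hc
    push Not at hc
    nlinarith
  have hne := available_nonempty_of_card hd (by exact_mod_cast hu1 : 2 * d ≤ (unsat d G).card)
  have hQ0 : (0 : ℝ) < (availablePairs d G).card := by exact_mod_cast Finset.card_pos.2 hne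
  have hsum : pexp (step d G) (tupleSum lam m) = ∑ v : Fin k ↪ Fin n,
      pexp (step d G) (fun a => ∏ l, levelWeight lam (m l) (deg a (v l))) := pexp_sum _ _ _
  rw [hsum, tupleSum, Finset.mul_sum]
  refine Finset.sum_le_sum fun v _ => ?_
  set Φ := ∏ l, levelWeight lam (m l) (deg G (v l)) with hΦ
  have hΦ0 : 0 ≤ Φ := Finset.prod_nonneg fun l _ => levelWeight_nonneg h0.le _ _
  set H : ℝ := ∑ e ∈ availablePairs d G, (if ∃ l, v l ∈ e then (1 : ℝ) else 0) with hH
  have hH0 : 0 ≤ H := Finset.sum_nonneg fun e _ => by split_ifs <;> norm_num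
  have h1 : pexp (step d G) (fun a => ∏ l, levelWeight lam (m l) (deg a (v l))) ≤
      (1 - (1 - lam⁻¹) * (H / (availablePairs d G).card)) * Φ := by
    rw [pexp_step hne, div_le_iff₀ hQ0]
    refine (Finset.sum_le_sum fun e he => prod_levelWeight_addEdge_le hl m he v).trans
      (le_of_eq ?_)
    rw [← Finset.sum_mul, Finset.sum_sub_distrib, ← Finset.mul_sum, ← hH, Finset.sum_const,
      nsmul_eq_mul, mul_one, ← hΦ]
    field_simp
  refine h1.trans ?_
  -- A tuple of positive weight has all degrees at most its levels, hence below `d`, so all its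
  -- vertices can be hit; tuples of weight zero remain at zero.
  rcases eq_or_lt_of_le hΦ0 with hz | hpos
  · rw [← hz, mul_zero, mul_zero]
  · refine mul_le_mul_of_nonneg_right ?_ hΦ0
    have hun : ∀ l, v l ∈ unsat d G := by
      intro l
      rw [mem_unsat]
      by_contra hc
      push Not at hc
      have hw : levelWeight lam (m l) (deg G (v l)) = 0 :=
        if_neg (by have := hm l; omega)
      exact hpos.ne' (Finset.prod_eq_zero (Finset.mem_univ l) hw)
    have h2 : k * ((unsat d G).card - d : ℝ) ≤ H + (k : ℝ) ^ 2 := by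
      refine le_trans ?_ (sum_pairCount_le G v)
      have : ∑ l : Fin k, ((unsat d G).card - d : ℝ) ≤ ∑ l, (pairCount d G (v l) : ℝ) := by
        refine Finset.sum_le_sum fun l _ => ?_
        have := card_unsat_le_pairCount_add (hun l)
        have : ((unsat d G).card : ℝ) ≤ pairCount d G (v l) + d := by exact_mod_cast this
        linarith
      rwa [Finset.sum_const, Finset.card_univ, Fintype.card_fin, nsmul_eq_mul] at this
    have h3 := hit_prob_lower hd1 (Nat.cast_nonneg k) hu1 hux hxu hQ0
      (two_mul_card_available_le d G) hH0 h2
    have hinv : lam⁻¹ ≤ 1 := inv_le_one_of_one_le₀ hl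
    have hinv0 : 0 < lam⁻¹ := inv_pos.2 h0
    have h4 := mul_le_mul_of_nonneg_left h3 (by linarith : 0 ≤ 1 - lam⁻¹)
    have h5 : 2 * (k : ℝ) / (lam * x) = lam⁻¹ * (2 * k / x) := by field_simp
    have h6 : 0 ≤ lam⁻¹ * (2 * d ^ 2 * k * (d + k) / x ^ 2) := by positivity
    rw [h5]
    linarith

/-! ### Falling factorials and the lower drift -/

open Classical in
/-- The falling factorial of a degree count counts the injective tuples of vertices of that
degree. -/
lemma descFactorial_degreeCount (j k : ℕ) (G : SimpleGraph (Fin n)) :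
    ((degreeCount j G).descFactorial k : ℝ) =
      ∑ v : Fin k ↪ Fin n, if ∀ l, deg G (v l) = j then (1 : ℝ) else 0 := by
  rw [Finset.sum_boole]
  congr 1
  have h1 : degreeCount j G = Fintype.card {v : Fin n // deg G v = j} := by
    rw [degreeCount_eq, Fintype.card_subtype]
  have h2 : (degreeCount j G).descFactorial k =
      Fintype.card (Fin k ↪ {v : Fin n // deg G v = j}) := by
    rw [Fintype.card_embedding_eq, h1, Fintype.card_fin]
  rw [h2, ← Fintype.card_subtype]
  refine Fintype.card_congr
    { toFun := fun v => ⟨v.trans (Function.Embedding.subtype _), fun l => (v l).2⟩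
      invFun := fun v => ⟨fun l => ⟨v.1 l, v.2 l⟩, fun a b h => v.1.injective (by simpa using h)⟩
      left_inv := fun v => by ext; rfl
      right_inv := fun v => by ext; rfl }

open Classical in
/-- Lower bound for the probability that all vertices of a tuple keep their degrees. -/
lemma pexp_step_forall_deg_ge {d k j s : ℕ} (hd : 1 ≤ d) (hj : j < d) {x : ℝ}
    {G : SimpleGraph (Fin n)} (hG : Reach d s G) (hx : x = d * n - 2 * s)
    (hxd : 2 * (d : ℝ) ^ 2 ≤ x) (v : Fin k ↪ Fin n) :
    (1 - 2 * k / x - 4 * d ^ 3 * k / x ^ 2 - 2 * k * d ^ 2 * (unsat (d - 1) G).card / x ^ 2) *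
      (if ∀ l, deg G (v l) = j then (1 : ℝ) else 0) ≤
      pexp (step d G) (fun H => if ∀ l, deg H (v l) = j then (1 : ℝ) else 0) := by
  have hd1 : (1 : ℝ) ≤ d := by exact_mod_cast hd
  have hx0 : 0 < x := by nlinarith
  have hux : ((unsat d G).card : ℝ) ≤ x := hx ▸ hG.card_unsat_le
  have hxu : x ≤ d * (unsat d G).card := hx ▸ hG.le_card_unsat
  have hu1 : 2 * (d : ℝ) ≤ (unsat d G).card := by
    by_contra hc
    push Not at hc
    nlinarith
  have hu : 2 * d ≤ (unsat d G).card := by exact_mod_cast hu1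
  have hne := available_nonempty_of_card hd hu
  have hQ0 : (0 : ℝ) < (availablePairs d G).card := by exact_mod_cast Finset.card_pos.2 hne
  split_ifs with hv
  swap
  · rw [mul_zero]
    exact pexp_nonneg _ fun H => by split_ifs <;> norm_num
  rw [mul_one]
  have hun : ∀ l, v l ∈ unsat d G := fun l => by rw [mem_unsat, hv l]; exact hj
  have h1 : 1 - ∑ l, (pairCount d G (v l) : ℝ) / (availablePairs d G).card ≤
      pexp (step d G) (fun H => if ∀ l, deg H (v l) = j then (1 : ℝ) else 0) := by
    rw [pexp_step hne, le_div_iff₀ hQ0, ← Finset.sum_div, sub_mul, div_mul_cancel₀ _ hQ0.ne', one_mul]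
    have h2 : ∑ l, (pairCount d G (v l) : ℝ) =
        ∑ e ∈ availablePairs d G, ∑ l, (if v l ∈ e then (1 : ℝ) else 0) := by
      rw [Finset.sum_comm]
      refine Finset.sum_congr rfl fun l _ => ?_
      rw [Finset.sum_boole, pairCount]
    have h3 : ((availablePairs d G).card : ℝ) = ∑ e ∈ availablePairs d G, (1 : ℝ) := by simp
    rw [h2, h3, ← Finset.sum_sub_distrib]
    refine Finset.sum_le_sum fun e he => ?_
    split_ifs with hx
    · have : 0 ≤ ∑ l, (if v l ∈ e then (1 : ℝ) else 0) :=
        Finset.sum_nonneg fun l _ => by split_ifs <;> norm_num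
      linarith
    · push Not at hx
      obtain ⟨l, hl⟩ := hx
      rw [deg_addEdge he, hv l] at hl
      have hle : v l ∈ e := by
        by_contra hc
        simp [hc] at hl
      have : (if v l ∈ e then (1 : ℝ) else 0) ≤ ∑ l, (if v l ∈ e then (1 : ℝ) else 0) :=
        Finset.single_le_sum (f := fun l => if v l ∈ e then (1 : ℝ) else 0)
          (fun l _ => by split_ifs <;> norm_num) (Finset.mem_univ l)
      rw [if_pos hle] at this
      linarith
  refine le_trans ?_ h1
  set u : ℝ := ((unsat d G).card : ℝ) with hudef
  have hu0 : 0 < u := by linarith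
  have h2 : ∑ l, (pairCount d G (v l) : ℝ) / (availablePairs d G).card ≤
      k * (2 / u + 4 * d / u ^ 2) := by
    have : ∑ l, (pairCount d G (v l) : ℝ) / (availablePairs d G).card ≤
        ∑ l : Fin k, (2 / u + 4 * d / u ^ 2) := by
      refine Finset.sum_le_sum fun l _ => ?_
      have := (abs_le.1 (abs_pairCount_div_sub_le hd hu (hun l))).2
      linarith
    rwa [Finset.sum_const, Finset.card_univ, Fintype.card_fin, nsmul_eq_mul] at this
  -- An unsaturated vertex contributes d - deg - 1 to x - u, which vanishes at degree d - 1; `unsat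
  -- (d - 1) G` is the set of vertices of degree at most d - 2.
  have h3 : x - u ≤ d * (unsat (d - 1) G).card := by
    have hu' : u = ∑ w ∈ unsat d G, (1 : ℝ) := by simp [hudef]
    have hW' : (d : ℝ) * (unsat (d - 1) G).card = ∑ w ∈ unsat (d - 1) G, (d : ℝ) := by
      simp [mul_comm]
    rw [hx, hG.deficiency, hu', hW', ← Finset.sum_sub_distrib]
    have h4 : unsat (d - 1) G ⊆ unsat d G := fun w hw => by
      rw [mem_unsat] at *
      omega
    rw [← Finset.sum_subset h4]
    · refine Finset.sum_le_sum fun w _ => ?_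
      have : (0 : ℝ) ≤ deg G w := Nat.cast_nonneg _
      linarith
    · intro w hw hw'
      rw [mem_unsat] at *
      have : deg G w + 1 = d := by omega
      have : (deg G w : ℝ) + 1 = d := by exact_mod_cast this
      linarith
  have h4 : 2 / u ≤ 2 / x + 2 * d ^ 2 * (unsat (d - 1) G).card / x ^ 2 := by
    have e : 2 / u = 2 / x + 2 * (x - u) / (u * x) := by field_simp; ring
    rw [e]
    refine add_le_add le_rfl ?_
    rw [div_le_div_iff₀ (by positivity) (by positivity)]
    have h5 : (x - u) * x ≤ (d * (unsat (d - 1) G).card) * (d * u) :=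
      mul_le_mul h3 hxu hx0.le (by positivity)
    nlinarith
  have h5 : 4 * d / u ^ 2 ≤ 4 * d ^ 3 / x ^ 2 := by
    rw [div_le_div_iff₀ (by positivity) (by positivity)]
    have : x ^ 2 ≤ (d * u) ^ 2 := by gcongr
    calc 4 * d * x ^ 2 ≤ 4 * d * (d * u) ^ 2 := by gcongr
      _ = _ := by ring
  have h6 : k * (2 / u + 4 * d / u ^ 2) ≤
      k * (2 / x + 2 * d ^ 2 * (unsat (d - 1) G).card / x ^ 2 + 4 * d ^ 3 / x ^ 2) := by
    gcongr
  have h7 : k * (2 / x + 2 * d ^ 2 * (unsat (d - 1) G).card / x ^ 2 + 4 * d ^ 3 / x ^ 2) =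
      2 * k / x + 4 * d ^ 3 * k / x ^ 2 + 2 * k * d ^ 2 * (unsat (d - 1) G).card / x ^ 2 := by ring
  linarith

/-- The product of the number of vertices of degree at most `d - 2` and a falling factorial is
controlled by a weighted tuple count of one more index. -/
lemma card_unsat_mul_descFactorial_le {d k j : ℕ} {lam : ℝ} (hd : 2 ≤ d) (hl : 1 ≤ lam)
    (G : SimpleGraph (Fin n)) :
    ((unsat (d - 1) G).card : ℝ) * ((degreeCount j G).descFactorial k : ℝ) ≤
      k * ((degreeCount j G).descFactorial k : ℝ) +
        tupleSum lam (Fin.cons (d - 2) (fun _ : Fin k => j)) G := by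
  classical
  have h0 : 0 < lam := by linarith
  set m : Fin (k + 1) → ℕ := Fin.cons (d - 2) (fun _ : Fin k => j) with hm
  set φ : (Fin k ↪ Fin n) → ℝ := fun v => if ∀ l, deg G (v l) = j then (1 : ℝ) else 0 with hφ
  have hφ0 : ∀ v, 0 ≤ φ v := fun v => by simp only [hφ]; split_ifs <;> norm_num
  set ψ : Fin n → ℝ := fun w => if deg G w < d - 1 then (1 : ℝ) else 0 with hψ
  have hψ0 : ∀ w, 0 ≤ ψ w := fun w => by simp only [hψ]; split_ifs <;> norm_num
  have hψ1 : ∀ w, ψ w ≤ 1 := fun w => by simp only [hψ]; split_ifs <;> norm_num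
  have hW : ((unsat (d - 1) G).card : ℝ) = ∑ w, ψ w := by rw [unsat, ← Finset.sum_boole]
  -- A (k + 1)-tuple is a k-tuple together with a vertex outside its range. The at most k choices
  -- inside the range account for the separate term k [D_j]_k.
  have hT : ∑ v : Fin k ↪ Fin n, ∑ w : {w // w ∉ Set.range v}, ψ w * φ v ≤ tupleSum lam m G := by
    unfold tupleSum
    rw [← Equiv.sum_comp (Equiv.embeddingFinSucc k (Fin n)).symm, Fintype.sum_sigma]
    refine Finset.sum_le_sum fun v _ => Finset.sum_le_sum fun w _ => ?_
    rw [Equiv.coe_embeddingFinSucc_symm, Fin.prod_univ_succ]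
    simp only [Fin.cons_zero, Fin.cons_succ, hm]
    refine mul_le_mul ?_ ?_ (hφ0 v) (levelWeight_nonneg h0.le _ _)
    · simp only [hψ]
      split_ifs with hw
      · rw [levelWeight, if_pos (by omega)]
        exact one_le_pow₀ hl
      · exact levelWeight_nonneg h0.le _ _
    · simp only [hφ]
      split_ifs with hv
      · rw [Finset.prod_eq_one]
        intro l _
        simp [levelWeight, hv l]
      · exact Finset.prod_nonneg fun l _ => levelWeight_nonneg h0.le _ _
  rw [hW, descFactorial_degreeCount, Finset.sum_mul_sum, Finset.sum_comm]
  refine le_trans ?_ (add_le_add_right hT _)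
  rw [Finset.mul_sum, ← Finset.sum_add_distrib]
  refine Finset.sum_le_sum fun v _ => ?_
  rw [← Fintype.sum_subtype_add_sum_subtype (fun w => w ∈ Set.range v) (fun w => ψ w * φ v)]
  refine add_le_add ?_ le_rfl
  refine (Finset.sum_le_sum (g := fun _ => φ v) fun w _ => ?_).trans (le_of_eq ?_)
  · exact mul_le_of_le_one_left (hφ0 v) (hψ1 w)
  have hcard : ∀ I : Fintype {w // w ∈ Set.range v}, (@Finset.univ _ I).card = k := fun I =>
    (@Fintype.card_congr _ _ I _ (Equiv.ofInjective v v.injective).symm).trans (Fintype.card_fin k)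
  rw [Finset.sum_const, nsmul_eq_mul, hcard]

/-- One step decreases the expected falling factorial of a degree count at most by the expected
factor, up to an error governed by a weighted tuple count. -/
theorem pexp_step_descFactorial_ge {d k j s : ℕ} (hd : 2 ≤ d) (hj : j < d) {lam x : ℝ}
    (hl : 1 ≤ lam) {G : SimpleGraph (Fin n)} (hG : Reach d s G) (hx : x = d * n - 2 * s)
    (hxd : 2 * (d : ℝ) ^ 2 ≤ x) :
    (1 - 2 * k / x - (4 * d ^ 3 * k + 2 * k ^ 2 * d ^ 2) / x ^ 2) *
        ((degreeCount j G).descFactorial k : ℝ) -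
      2 * k * d ^ 2 / x ^ 2 * tupleSum lam (Fin.cons (d - 2) (fun _ : Fin k => j)) G ≤
      pexp (step d G) (fun H => ((degreeCount j H).descFactorial k : ℝ)) := by
  classical
  have h1 : (1 - 2 * k / x - 4 * d ^ 3 * k / x ^ 2 -
      2 * k * d ^ 2 * (unsat (d - 1) G).card / x ^ 2) * ((degreeCount j G).descFactorial k : ℝ) ≤
      pexp (step d G) (fun H => ((degreeCount j H).descFactorial k : ℝ)) := by
    simp_rw [descFactorial_degreeCount]
    rw [pexp_sum, Finset.mul_sum]
    exact Finset.sum_le_sum fun v _ => pexp_step_forall_deg_ge (by omega) hj hG hx hxd v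
  refine le_trans ?_ h1
  have h2 := card_unsat_mul_descFactorial_le (k := k) (j := j) hd hl G
  have h3 := mul_le_mul_of_nonneg_left h2 (by positivity : 0 ≤ 2 * k * (d : ℝ) ^ 2 / x ^ 2)
  have e1 : 2 * k * (d : ℝ) ^ 2 * (unsat (d - 1) G).card / x ^ 2 *
      ((degreeCount j G).descFactorial k : ℝ) = 2 * k * (d : ℝ) ^ 2 / x ^ 2 *
        ((unsat (d - 1) G).card * ((degreeCount j G).descFactorial k : ℝ)) := by ring
  have e2 : (2 * (k : ℝ) ^ 2 * d ^ 2) / x ^ 2 * ((degreeCount j G).descFactorial k : ℝ) =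
      2 * k * (d : ℝ) ^ 2 / x ^ 2 * (k * ((degreeCount j G).descFactorial k : ℝ)) := by ring
  rw [add_div]
  linarith

/-! ### Telescoping the drifts -/

/-- The logarithm of the decay of the weighted tuple counts, as a function of the deficiency. -/
def upperRate (d k : ℕ) (lam x : ℝ) : ℝ :=
  k * Real.log (x + 2) + 2 * d ^ 2 * k * (d + k) / x - k / lam * Real.log x

/-- Each term of `upperRate` telescopes one term of the factor, after 1 + y ≤ e^y. The main term
uses log(x + 2) because -2/x must be bounded from above: 2/x ≥ log(x + 2) - log x, whereas log x -
log(x - 2) would err on the wrong side. -/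
lemma upper_factor_le (d k : ℕ) {lam x : ℝ} (hl : 0 < lam) (hx : 2 < x) :
    1 - 2 * k / x + 2 * d ^ 2 * k * (d + k) / x ^ 2 + 2 * k / (lam * x) ≤
      Real.exp (upperRate d k lam (x - 2) - upperRate d k lam x) := by
  have hx0 : 0 < x := by linarith
  have hx2 : 0 < x - 2 := by linarith
  have h1 : -(2 / x) ≤ Real.log x - Real.log (x + 2) := by
    have h := Real.log_le_sub_one_of_pos (div_pos (by linarith : 0 < x + 2) hx0)
    rw [Real.log_div (by linarith) hx0.ne'] at h
    have e : (x + 2) / x - 1 = 2 / x := by field_simp; ring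
    linarith
  have h2 := two_div_le_log_sub hx
  have h3 : 1 / x ^ 2 ≤ 1 / (x - 2) - 1 / x := by
    have e : 1 / (x - 2) - 1 / x = 2 / ((x - 2) * x) := by
      field_simp
      ring
    rw [e, div_le_div_iff₀ (by positivity) (by positivity)]
    nlinarith
  have key : -(2 * k / x) + 2 * d ^ 2 * k * (d + k) / x ^ 2 + 2 * k / (lam * x) ≤
      upperRate d k lam (x - 2) - upperRate d k lam x := by
    unfold upperRate
    have a1 := mul_le_mul_of_nonneg_left h1 (Nat.cast_nonneg k : (0 : ℝ) ≤ k)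
    have a2 := mul_le_mul_of_nonneg_left h2 (by positivity : (0 : ℝ) ≤ k / lam)
    have a3 := mul_le_mul_of_nonneg_left h3 (by positivity : (0 : ℝ) ≤ 2 * d ^ 2 * k * (d + k))
    have e1 : 2 * (k : ℝ) / x = k * (2 / x) := by ring
    have e2 : 2 * (k : ℝ) / (lam * x) = k / lam * (2 / x) := by field_simp
    have e3 : 2 * (d : ℝ) ^ 2 * k * (d + k) / x ^ 2 = 2 * d ^ 2 * k * (d + k) * (1 / x ^ 2) := by
      ring
    have e4 : ∀ y : ℝ, 2 * (d : ℝ) ^ 2 * k * (d + k) / y = 2 * d ^ 2 * k * (d + k) * (1 / y) := by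
      intro y
      ring
    rw [e1, e2, e3, e4, e4, sub_add_cancel]
    linarith
  have := Real.add_one_le_exp (upperRate d k lam (x - 2) - upperRate d k lam x)
  linarith

/-- The decay of the expected weighted tuple counts. -/
theorem pexp_graphLaw_tupleSum_le {d k : ℕ} (hd : 1 ≤ d) {lam : ℝ} (hl : 1 ≤ lam)
    {m : Fin k → ℕ} (hm : ∀ l, m l < d) (s r : ℕ) (h : 2 * (s + r) + 2 * d ^ 2 ≤ d * n) :
    pexp (graphLaw d n (s + r)) (tupleSum lam m) ≤
      Real.exp (upperRate d k lam (d * n - 2 * (s + r : ℕ)) - upperRate d k lam (d * n - 2 * s)) *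
        pexp (graphLaw d n s) (tupleSum lam m) := by
  have hd1 : (1 : ℝ) ≤ d := by exact_mod_cast hd
  induction r with
  | zero => simp
  | succ r ih =>
    have hx : (2 * (s + r) + 2 + 2 * d ^ 2 : ℝ) ≤ d * n := by
      have : 2 * (s + r) + 2 + 2 * d ^ 2 ≤ d * n := by omega
      exact_mod_cast this
    obtain ⟨x, hxdef⟩ : ∃ x : ℝ, x = d * n - 2 * (s + r : ℕ) := ⟨_, rfl⟩
    have hx2 : (d * n - 2 * (s + (r + 1) : ℕ) : ℝ) = x - 2 := by
      rw [hxdef]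
      push_cast
      ring
    have hxd : 2 + 2 * (d : ℝ) ^ 2 ≤ x := by
      rw [hxdef]
      push_cast
      linarith
    have ih' := ih (by omega)
    rw [← hxdef] at ih'
    rw [hx2, ← add_assoc, pexp_graphLaw_succ]
    have h1 : pexp (graphLaw d n (s + r)) (fun G => pexp (step d G) (tupleSum lam m)) ≤
        Real.exp (upperRate d k lam (x - 2) - upperRate d k lam x) *
          pexp (graphLaw d n (s + r)) (tupleSum lam m) := by
      rw [← pexp_const_mul]
      refine pexp_mono _ fun G hG => ?_
      have hdd : d * d = d ^ 2 := by ring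
      have hR : Reach d (s + r) G := reach_of_mem_support (by omega) hG
      refine (pexp_step_tupleSum_le hd hl hm hR hxdef (by linarith)).trans ?_
      exact mul_le_mul_of_nonneg_right (upper_factor_le d k (by linarith) (by nlinarith))
        (tupleSum_nonneg (by linarith) m G)
    refine h1.trans ((mul_le_mul_of_nonneg_left ih' (Real.exp_pos _).le).trans (le_of_eq ?_))
    rw [← mul_assoc, ← Real.exp_add]
    congr 2
    ring

/-- The error constant in the lower bound for one step. -/
def lowerConst (d k : ℕ) : ℝ := 4 * d ^ 3 * k + 2 * k ^ 2 * d ^ 2 + (2 * k + 1) ^ 2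

/-- The decay factor in the lower bound, as a function of the deficiency. -/
def lowerRate (d k : ℕ) (x : ℝ) : ℝ := x ^ k * Real.exp (-(lowerConst d k / x))

lemma lowerConst_pos (d k : ℕ) : 0 < lowerConst d k := by unfold lowerConst; positivity

lemma lowerRate_pos (d k : ℕ) {x : ℝ} (hx : 0 < x) : 0 < lowerRate d k x := by
  unfold lowerRate; positivity

/-- The quotient is at most e^(-a) ≤ 1/(1 + a) with a = 2k/x + C/x². The summand (2k + 1)² of the
constant C pays for the second-order term when 1/(1 + a) is compared with the linear factor. -/
lemma lower_factor_ge (d k : ℕ) {x : ℝ} (hx2 : 2 < x) (hx : lowerConst d k ≤ x) :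
    lowerRate d k (x - 2) / lowerRate d k x ≤
      1 - 2 * k / x - (4 * d ^ 3 * k + 2 * k ^ 2 * d ^ 2) / x ^ 2 := by
  have hx0 : 0 < x := by linarith
  have hx1 : 0 < x - 2 := by linarith
  set C := lowerConst d k with hC
  obtain ⟨c, hc⟩ : ∃ c : ℝ, c = 4 * d ^ 3 * k + 2 * k ^ 2 * d ^ 2 := ⟨_, rfl⟩
  have hc0 : 0 ≤ c := by rw [hc]; positivity
  have hCc : C = c + (2 * k + 1) ^ 2 := by rw [hC, hc, lowerConst]
  have hC0 : 0 < C := lowerConst_pos d k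
  have hk0 : (0 : ℝ) ≤ k := Nat.cast_nonneg k
  have h1 : lowerRate d k (x - 2) / lowerRate d k x ≤ Real.exp (-(2 * k / x + C / x ^ 2)) := by
    rw [div_le_iff₀ (lowerRate_pos d k hx0)]
    unfold lowerRate
    rw [← hC]
    have e1 : ((x - 2) / x) ^ k ≤ Real.exp (-(2 * k / x)) := by
      have : (x - 2) / x ≤ Real.exp (-(2 / x)) := by
        have h := Real.add_one_le_exp (-(2 / x))
        have e : (x - 2) / x = -(2 / x) + 1 := by field_simp; ring
        rwa [e]
      calc ((x - 2) / x) ^ k ≤ Real.exp (-(2 / x)) ^ k := by gcongr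
        _ = _ := by
          rw [← Real.exp_nat_mul]
          congr 1
          ring
    have e2 : Real.exp (-(C / (x - 2))) ≤ Real.exp (-(C / x ^ 2)) * Real.exp (-(C / x)) := by
      rw [← Real.exp_add, Real.exp_le_exp]
      have h3 : 1 / x ^ 2 ≤ 1 / (x - 2) - 1 / x := by
        have e : 1 / (x - 2) - 1 / x = 2 / ((x - 2) * x) := by
          field_simp
          ring
        rw [e, div_le_div_iff₀ (by positivity) (by positivity)]
        nlinarith
      have h4 := mul_le_mul_of_nonneg_left h3 hC0.le
      have h5 : ∀ y, C / y = C * (1 / y) := fun y => by ring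
      rw [h5 (x - 2), h5 (x ^ 2), h5 x]
      linarith
    calc (x - 2) ^ k * Real.exp (-(C / (x - 2)))
        = ((x - 2) / x) ^ k * x ^ k * Real.exp (-(C / (x - 2))) := by
          rw [← mul_pow, div_mul_cancel₀ _ hx0.ne']
      _ ≤ Real.exp (-(2 * k / x)) * x ^ k * (Real.exp (-(C / x ^ 2)) * Real.exp (-(C / x))) := by
          gcongr
      _ = _ := by
          rw [neg_add, Real.exp_add]
          ring
  refine h1.trans ?_
  rw [← hc]
  set a := 2 * k / x + C / x ^ 2 with ha
  have ha0 : 0 ≤ a := by positivity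
  have h2 : Real.exp (-a) ≤ 1 / (1 + a) := by
    rw [Real.exp_neg, ← one_div]
    exact one_div_le_one_div_of_le (by linarith) (by linarith [Real.add_one_le_exp a])
  refine h2.trans ?_
  rw [div_le_iff₀ (by linarith)]
  have hCx : C / x ≤ 1 := (div_le_one hx0).2 hx
  have hcx : c / x ≤ 1 := by
    rw [div_le_one hx0]
    have : 0 ≤ (2 * (k : ℝ) + 1) ^ 2 := by positivity
    linarith
  have h3 : a * (2 * k / x + c / x ^ 2) ≤ (2 * k + 1) ^ 2 / x ^ 2 := by
    have e : a * (2 * k / x + c / x ^ 2) = (2 * k + C / x) * (2 * k + c / x) / x ^ 2 := by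
      rw [ha]
      field_simp
    rw [e]
    gcongr
    rw [sq]
    gcongr
  have h4 : a - 2 * k / x - c / x ^ 2 = (2 * k + 1) ^ 2 / x ^ 2 := by
    rw [ha, hCc]
    ring
  nlinarith

/-- The error constant in the accumulated lower bound. -/
def lossConst (d k : ℕ) : ℝ := 2 * k * d ^ 2 * 2 ^ k * Real.exp 1

/-- Lower bound for the expected falling factorial moment in terms of an earlier moment. -/
theorem pexp_graphLaw_descFactorial_ge {d k j : ℕ} (hd : 2 ≤ d) (hj : j < d) {lam B : ℝ}
    (hl : 1 ≤ lam) (hB : 0 ≤ B) (s r : ℕ) (h : 2 * (s + r) + 2 * d ^ 2 ≤ d * n)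
    (hlow : lowerConst d k ≤ d * n - 2 * (s + r : ℕ))
    (hup : ∀ i ≤ r, pexp (graphLaw d n (s + i))
      (tupleSum lam (Fin.cons (d - 2) (fun _ : Fin k => j))) ≤
        B * (d * n - 2 * (s + i : ℕ)) ^ (k + 1)) :
    pexp (graphLaw d n s) (fun G => ((degreeCount j G).descFactorial k : ℝ)) /
        lowerRate d k (d * n - 2 * s) -
        lossConst d k * B * (Real.log (d * n - 2 * s) - Real.log (d * n - 2 * (s + r : ℕ))) ≤
      pexp (graphLaw d n (s + r)) (fun G => ((degreeCount j G).descFactorial k : ℝ)) /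
        lowerRate d k (d * n - 2 * (s + r : ℕ)) := by
  have hd1 : (2 : ℝ) ≤ d := by exact_mod_cast hd
  induction r with
  | zero => simp
  | succ r ih =>
    have hx : (2 * (s + r) + 2 + 2 * d ^ 2 : ℝ) ≤ d * n := by
      have : 2 * (s + r) + 2 + 2 * d ^ 2 ≤ d * n := by omega
      exact_mod_cast this
    obtain ⟨x, hxdef⟩ : ∃ x : ℝ, x = d * n - 2 * (s + r : ℕ) := ⟨_, rfl⟩
    have hx2 : (d * n - 2 * (s + (r + 1) : ℕ) : ℝ) = x - 2 := by
      rw [hxdef]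
      push_cast
      ring
    have hxd : 2 + 2 * (d : ℝ) ^ 2 ≤ x := by
      rw [hxdef]
      push_cast
      linarith
    have hx10 : 10 ≤ x := by nlinarith
    have hlow' : lowerConst d k ≤ x - 2 := by rwa [hx2] at hlow
    have ih' := ih (by omega) (by rw [← hxdef]; linarith) fun i hi => hup i (by omega)
    have hup' := hup r (by omega)
    rw [← hxdef] at ih' hup'
    rw [hx2, ← add_assoc, pexp_graphLaw_succ]
    set a := pexp (graphLaw d n (s + r)) (fun G => ((degreeCount j G).descFactorial k : ℝ)) with ha
    set b := pexp (graphLaw d n (s + r))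
      (tupleSum lam (Fin.cons (d - 2) (fun _ : Fin k => j))) with hb
    have ha0 : 0 ≤ a := pexp_nonneg _ fun G => Nat.cast_nonneg _
    set q : ℝ := 1 - 2 * k / x - (4 * d ^ 3 * k + 2 * k ^ 2 * d ^ 2) / x ^ 2 with hq
    have hstep : q * a - 2 * k * d ^ 2 / x ^ 2 * b ≤ pexp (graphLaw d n (s + r))
        (fun G => pexp (step d G) (fun H => ((degreeCount j H).descFactorial k : ℝ))) := by
      rw [ha, hb, sub_eq_add_neg, ← neg_mul, ← pexp_const_mul, ← pexp_const_mul, ← pexp_add]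
      refine pexp_mono _ fun G hG => ?_
      have hdd : d * d = d ^ 2 := by ring
      have hR : Reach d (s + r) G := reach_of_mem_support (by omega) hG
      have := pexp_step_descFactorial_ge (k := k) hd hj hl hR hxdef (by linarith)
      linarith
    have hr0 := lowerRate_pos d k (by linarith : 0 < x)
    have hr2 := lowerRate_pos d k (by linarith : 0 < x - 2)
    have hfac := lower_factor_ge d k (by linarith : 2 < x) (by linarith)
    rw [← hq, div_le_iff₀ hr0] at hfac
    have h1 : a / lowerRate d k x ≤ q * a / lowerRate d k (x - 2) := by
      rw [div_le_div_iff₀ hr0 hr2]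
      nlinarith
    -- A joint moment of order B x^(k+1) makes the loss O(B/x) relative to the rate, so the losses
    -- add up to a logarithm. The factors 2^k and e of `lossConst` come from replacing the rate at x
    -- - 2 by x^k.
    have hloss : 2 * k * d ^ 2 / x ^ 2 * b / lowerRate d k (x - 2) ≤
        lossConst d k * B * (2 / x) := by
      have e1 : x ^ k ≤ 2 ^ k * (x - 2) ^ k := by
        rw [← mul_pow]
        exact pow_le_pow_left₀ (by linarith) (by linarith) k
      have e2 : 1 ≤ Real.exp 1 * Real.exp (-(lowerConst d k / (x - 2))) := by
        rw [← Real.exp_add]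
        apply Real.one_le_exp
        have : lowerConst d k / (x - 2) ≤ 1 := (div_le_one (by linarith)).2 hlow'
        linarith
      have e3 : x ^ k ≤ 2 ^ k * Real.exp 1 * lowerRate d k (x - 2) := by
        calc x ^ k ≤ 2 ^ k * (x - 2) ^ k * 1 := by rw [mul_one]; exact e1
          _ ≤ 2 ^ k * (x - 2) ^ k *
              (Real.exp 1 * Real.exp (-(lowerConst d k / (x - 2)))) := by
              have : 0 < x - 2 := by linarith
              gcongr
          _ = _ := by unfold lowerRate; ring
      rw [div_le_iff₀ hr2]
      have hx0 : 0 < x := by linarith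
      calc 2 * k * d ^ 2 / x ^ 2 * b ≤ 2 * k * d ^ 2 / x ^ 2 * (B * x ^ (k + 1)) := by gcongr
        _ = 2 * k * d ^ 2 * B * x ^ k / x := by
          field_simp
          ring
        _ ≤ 2 * k * d ^ 2 * B * (2 ^ k * Real.exp 1 * lowerRate d k (x - 2)) / x := by gcongr
        _ = lossConst d k * B * (1 / x) * lowerRate d k (x - 2) := by unfold lossConst; ring
        _ ≤ lossConst d k * B * (2 / x) * lowerRate d k (x - 2) := by
          have : 0 ≤ lossConst d k := by unfold lossConst; positivity
          gcongr
          norm_num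
    have hlog := two_div_le_log_sub (by linarith : 2 < x)
    have hlc : 0 ≤ lossConst d k * B := mul_nonneg (by unfold lossConst; positivity) hB
    have h2 := mul_le_mul_of_nonneg_left hlog hlc
    have h3 : (q * a - 2 * k * d ^ 2 / x ^ 2 * b) / lowerRate d k (x - 2) ≤
        pexp (graphLaw d n (s + r)) (fun G => pexp (step d G)
          (fun H => ((degreeCount j H).descFactorial k : ℝ))) / lowerRate d k (x - 2) := by
      gcongr
    rw [sub_div] at h3
    have h4 : lossConst d k * B * (Real.log (d * n - 2 * s) - Real.log (x - 2)) =
        lossConst d k * B * (Real.log (d * n - 2 * s) - Real.log x) +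
          lossConst d k * B * (Real.log x - Real.log (x - 2)) := by ring
    rw [h4]
    linarith

/-! ### Moments at the burn time -/

/-- The weighted number of vertices at a given level. -/
def levelSum (lam : ℝ) (m : ℕ) (G : SimpleGraph (Fin n)) : ℝ := ∑ v, levelWeight lam m (deg G v)

lemma levelSum_nonneg {lam : ℝ} (hl : 0 ≤ lam) (m : ℕ) (G : SimpleGraph (Fin n)) :
    0 ≤ levelSum lam m G := Finset.sum_nonneg fun _ _ => levelWeight_nonneg hl _ _

lemma tupleSum_le_prod {k : ℕ} {lam : ℝ} (hl : 0 ≤ lam) (m : Fin k → ℕ)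
    (G : SimpleGraph (Fin n)) : tupleSum lam m G ≤ ∏ l, levelSum lam (m l) G := by
  unfold tupleSum levelSum
  rw [Finset.prod_univ_sum, Fintype.piFinset_univ]
  have h := Finset.sum_map (Finset.univ : Finset (Fin k ↪ Fin n))
    ⟨fun v => (v : Fin k → Fin n), DFunLike.coe_injective⟩
    (fun f => ∏ l, levelWeight lam (m l) (deg G (f l)))
  simp only [Function.Embedding.coeFn_mk] at h
  rw [← h]
  exact Finset.sum_le_sum_of_subset_of_nonneg (Finset.subset_univ _)
    fun f _ _ => Finset.prod_nonneg fun l _ => levelWeight_nonneg hl _ _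

lemma levelSum_eq (lam : ℝ) (m : ℕ) (G : SimpleGraph (Fin n)) :
    levelSum lam m G = ∑ i ∈ Finset.range (m + 1), (degreeCount i G : ℝ) * lam ^ (m - i) := by
  unfold levelSum
  simp_rw [degreeCount_cast, Finset.sum_mul]
  rw [Finset.sum_comm]
  refine Finset.sum_congr rfl fun v _ => ?_
  simp only [ite_mul, one_mul, zero_mul]
  rw [Finset.sum_ite_eq, levelWeight]
  simp

/-- A crude bound for atypical graphs, whose small probability pays for the power of lam. -/
lemma levelSum_le_card {d m : ℕ} {lam : ℝ} (hl : 1 ≤ lam) (hm : m < d) (G : SimpleGraph (Fin n)) :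
    levelSum lam m G ≤ (unsat d G).card * lam ^ d := by
  unfold levelSum
  rw [unsat, ← Finset.sum_boole, Finset.sum_mul]
  refine Finset.sum_le_sum fun v _ => ?_
  unfold levelWeight
  by_cases h : deg G v ≤ m
  · rw [if_pos h, if_pos (by omega), one_mul]
    exact pow_le_pow_right₀ hl (by omega)
  · rw [if_neg h]
    split_ifs <;> positivity

/-- All degree counts are close to their predicted values. -/
def Typical (d : ℕ) (η L x : ℝ) (G : SimpleGraph (Fin n)) : Prop :=
  ∀ i < d, |(degreeCount i G : ℝ) * L ^ (d - 1 - i) / x - limitRatio d i| ≤ η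

/-- A vertex count at degree i < m is smaller by L^(m-i) = lam^(2(m-i)) than at degree m, while its
weight is only lam^(m-i). The lower degrees thus contribute O(1/lam) in relative terms, and `hlam`
makes this at most η. -/
lemma Typical.levelSum_le {d m : ℕ} {η lam L x : ℝ} (hm : m < d) (hη1 : η ≤ 1)
    (hl : 1 ≤ lam) (hL : L = lam ^ 2) (hlam : d * ((d - 1).factorial + 1) ≤ η * lam) (hx : 0 < x)
    {G : SimpleGraph (Fin n)} (hG : Typical d η L x G) :
    levelSum lam m G ≤ (limitRatio d m + 2 * η) * (x / L ^ (d - 1 - m)) := by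
  have h0 : 0 < lam := by linarith
  have hL0 : 0 < L := by rw [hL]; positivity
  set q := x / L ^ (d - 1 - m) with hq
  have hq0 : 0 < q := by positivity
  have hterm : ∀ i ≤ m, (degreeCount i G : ℝ) * lam ^ (m - i) ≤
      (limitRatio d i + η) * q / lam ^ (m - i) := by
    intro i hi
    have h1 := (abs_le.1 (hG i (by omega))).2
    have h2 : (degreeCount i G : ℝ) * L ^ (d - 1 - i) / x ≤ limitRatio d i + η := by linarith
    rw [div_le_iff₀ hx] at h2
    rw [le_div_iff₀ (by positivity), hq, ← mul_div_assoc, le_div_iff₀ (by positivity)]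
    have e : L ^ (d - 1 - i) = L ^ (d - 1 - m) * (lam ^ (m - i) * lam ^ (m - i)) := by
      rw [← sq, ← pow_mul, mul_comm (m - i) 2, pow_mul, ← hL, ← pow_add]
      congr 1
      omega
    rw [e] at h2
    linarith
  rw [levelSum_eq, Finset.sum_range_succ]
  have h1 := hterm m le_rfl
  rw [Nat.sub_self, pow_zero, div_one] at h1
  have h2 : ∑ i ∈ Finset.range m, (degreeCount i G : ℝ) * lam ^ (m - i) ≤ η * q := by
    have h3 : ∀ i ∈ Finset.range m, (degreeCount i G : ℝ) * lam ^ (m - i) ≤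
        ((d - 1).factorial + 1) * q / lam := by
      intro i hi
      have hi' := Finset.mem_range.1 hi
      refine (hterm i hi'.le).trans ?_
      have h4 : limitRatio d i ≤ (d - 1).factorial :=
        div_le_self (by positivity) (by exact_mod_cast Nat.factorial_pos i)
      have h5 : lam ≤ lam ^ (m - i) := le_self_pow₀ hl (by omega)
      gcongr
    refine (Finset.sum_le_sum h3).trans ?_
    rw [Finset.sum_const, Finset.card_range, nsmul_eq_mul, ← mul_div_assoc, div_le_iff₀ h0]
    have hmd : (m : ℝ) ≤ d := by exact_mod_cast hm.le
    calc (m : ℝ) * (((d - 1).factorial + 1) * q) ≤ d * (((d - 1).factorial + 1) * q) := by gcongr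
      _ = (d * ((d - 1).factorial + 1)) * q := by ring
      _ ≤ (η * lam) * q := by gcongr
      _ = η * q * lam := by ring
  have h3 : (degreeCount m G : ℝ) * lam ^ (m - m) = degreeCount m G := by simp
  rw [h3]
  linarith

open Classical in
/-- The indicator of the graphs that are not typical. -/
def atypical (d : ℕ) (η L x : ℝ) (G : SimpleGraph (Fin n)) : ℝ :=
  if Typical d η L x G then 0 else 1

lemma atypical_nonneg (d : ℕ) (η L x : ℝ) (G : SimpleGraph (Fin n)) : 0 ≤ atypical d η L x G := by
  unfold atypical
  split_ifs <;> norm_num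

lemma atypical_le_one (d : ℕ) (η L x : ℝ) (G : SimpleGraph (Fin n)) : atypical d η L x G ≤ 1 := by
  unfold atypical
  split_ifs <;> norm_num

/-- The graph is typical with high probability as long as the deficiency is not too small. -/
theorem pexp_graphLaw_atypical_le {d : ℕ} (hd : 1 ≤ d) {η : ℝ} (hη : 0 < η) :
    ∃ C > 0, ∃ δ > 0, ∃ L₀ : ℝ, ∀ (n S : ℕ) (L x : ℝ), L = Real.log n → x = d * n - 2 * S →
      L₀ ≤ L → d ≤ n → 2 * S + 2 * d ^ 2 ≤ d * n → Real.log x ≤ δ * L →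
      pexp (graphLaw d n S) (atypical d η L x) ≤ C * L ^ (2 * d) / x := by
  obtain ⟨ε, hε, hε1, δ, hδ, L₀, H⟩ := degreeCount_close_of_fluidPotential hd hη
  have hw : 1 ≤ (ε ^ 2)⁻¹ := (one_le_inv₀ (by positivity)).2 (pow_le_one₀ hε.le hε1)
  refine ⟨(ε ^ 2)⁻¹ * Real.exp (4 * d) * (stepConst d * (2 * d ^ 2)) + 1, ?_, δ, hδ, max L₀ 1, ?_⟩
  · have := stepConst_nonneg d
    positivity
  intro n S L x hL hx hL₀ hdn hS hxδ
  have hL1 : 1 ≤ L := (le_max_right _ _).trans hL₀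
  have hd1 : (1 : ℝ) ≤ d := by exact_mod_cast hd
  have hS' : (2 * S + 2 * d ^ 2 : ℝ) ≤ d * n := by exact_mod_cast hS
  have hx1 : 1 ≤ x := by nlinarith
  have key := pexp_graphLaw_le_of_fluidPotential hd hw (hL ▸ hL1) hdn hS
    (β := atypical d η L x) (atypical_le_one d η L x) ?_
  · rw [← hL, ← hx] at key
    refine key.trans ?_
    have : 0 ≤ L ^ (2 * d) := by positivity
    gcongr
    linarith
  -- Markov's inequality: an atypical graph has potential above ε² at every admissible time, so its
  -- indicator is at most the potential over ε².
  · intro G hG τ hτ0 hτ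
    rw [← hL] at hτ ⊢
    have hV0 := fluidPotential_nonneg d L τ G
    unfold atypical
    split_ifs with hT
    · positivity
    · by_contra hc
      push Not at hc
      refine hT (H n S G τ L x hL hx hG ((le_max_left _ _).trans hL₀) hx1 hxδ hτ0 hτ ?_)
      rw [inv_mul_eq_div, div_lt_one (by positivity)] at hc
      exact hc.le

/-- Upper bound for the expected weighted tuple count in terms of the probability of an atypical
graph. -/
lemma pexp_graphLaw_tupleSum_le_of_typical {d k s : ℕ} {m : Fin k → ℕ} (hm : ∀ l, m l < d)
    {η lam L x : ℝ} (hη : 0 < η) (hη1 : η ≤ 1) (hl : 1 ≤ lam) (hL : L = lam ^ 2)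
    (hlam : d * ((d - 1).factorial + 1) ≤ η * lam) (hxs : x = d * n - 2 * s) (hx : 0 < x)
    (hs : 2 * s + d * d < d * n + 2) :
    pexp (graphLaw d n s) (tupleSum lam m) ≤
      ∏ l, ((limitRatio d (m l) + 2 * η) * (x / L ^ (d - 1 - m l))) +
        (x * lam ^ d) ^ k * pexp (graphLaw d n s) (atypical d η L x) := by
  have h0 : 0 < lam := by linarith
  have hL0 : 0 < L := by rw [hL]; positivity
  rw [← pexp_const_mul, ← pexp_const (graphLaw d n s)
    (∏ l, ((limitRatio d (m l) + 2 * η) * (x / L ^ (d - 1 - m l)))), ← pexp_add]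
  refine pexp_mono _ fun G hG => ?_
  have hR : Reach d s G := reach_of_mem_support hs hG
  refine (tupleSum_le_prod h0.le m G).trans ?_
  unfold atypical
  split_ifs with hT
  · rw [mul_zero, add_zero]
    exact Finset.prod_le_prod (fun l _ => levelSum_nonneg h0.le _ _)
      fun l _ => hT.levelSum_le (hm l) hη1 hl hL hlam hx
  · rw [mul_one]
    have h1 : 0 ≤ ∏ l, ((limitRatio d (m l) + 2 * η) * (x / L ^ (d - 1 - m l))) :=
      Finset.prod_nonneg fun l _ => by
        have := limitRatio_pos d (m l)
        positivity
    have h2 : ∏ l, levelSum lam (m l) G ≤ ∏ _l : Fin k, (x * lam ^ d) := by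
      refine Finset.prod_le_prod (fun l _ => levelSum_nonneg h0.le _ _) fun l _ => ?_
      refine (levelSum_le_card hl (hm l) G).trans ?_
      gcongr
      exact hxs ▸ hR.card_unsat_le
    rw [Finset.prod_const, Finset.card_univ, Fintype.card_fin] at h2
    linarith

/-- Lower bound for the expected falling factorial in terms of the probability of an atypical
graph. -/
lemma le_pexp_graphLaw_descFactorial_of_typical {d k j s : ℕ} (hj : j < d) {η L x : ℝ}
    (hL : 0 < L) (hx : 0 < x) (hk : (k : ℝ) ≤ (limitRatio d j - η) * (x / L ^ (d - 1 - j))) :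
    ((limitRatio d j - η) * (x / L ^ (d - 1 - j)) - k) ^ k *
        (1 - pexp (graphLaw d n s) (atypical d η L x)) ≤
      pexp (graphLaw d n s) (fun G => ((degreeCount j G).descFactorial k : ℝ)) := by
  set A := (limitRatio d j - η) * (x / L ^ (d - 1 - j)) with hA
  have h1 : (A - k) ^ k * (1 - pexp (graphLaw d n s) (atypical d η L x)) =
      pexp (graphLaw d n s) (fun G => (A - k) ^ k + -((A - k) ^ k) * atypical d η L x G) := by
    rw [pexp_add, pexp_const, pexp_const_mul]
    ring
  rw [h1]
  refine pexp_mono _ fun G _ => ?_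
  unfold atypical
  split_ifs with hT
  · rw [mul_zero, add_zero]
    have h2 := (abs_le.1 (hT j hj)).1
    have h3 : limitRatio d j - η ≤ (degreeCount j G : ℝ) * L ^ (d - 1 - j) / x := by linarith
    rw [le_div_iff₀ hx] at h3
    have h4 : A ≤ degreeCount j G := by
      rw [hA, ← mul_div_assoc, div_le_iff₀ (by positivity)]
      exact h3
    have h5 : (k : ℝ) ≤ degreeCount j G := hk.trans h4
    have h6 : k ≤ degreeCount j G := by exact_mod_cast h5
    have h7 := Nat.pow_sub_le_descFactorial (degreeCount j G) k
    have h8 : (degreeCount j G - k) ^ k ≤ (degreeCount j G).descFactorial k :=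
      (Nat.pow_le_pow_left (by omega) k).trans h7
    have h9 : ((degreeCount j G : ℝ) - k) ^ k ≤ (degreeCount j G).descFactorial k := by
      rw [← Nat.cast_sub h6]
      exact_mod_cast h8
    refine le_trans ?_ h9
    exact pow_le_pow_left₀ (by linarith) (by linarith) k
  · rw [mul_one, add_neg_cancel]
    exact Nat.cast_nonneg _

/-! ### Explicit bounds from the burn time to the end -/

/-- Explicit upper bound for the expected weighted tuple count at deficiency `x`, started from
deficiency `x₁`. -/
theorem pexp_graphLaw_tupleSum_le_explicit {d K S r : ℕ} (hd : 1 ≤ d) {m : Fin K → ℕ}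
    (hm : ∀ l, m l < d) {η lam L C x₁ x : ℝ} (hη : 0 < η) (hη1 : η ≤ 1) (hl : 1 ≤ lam)
    (hL : L = lam ^ 2) (hlam : d * ((d - 1).factorial + 1) ≤ η * lam)
    (hx₁ : x₁ = d * n - 2 * S) (hx : x = d * n - 2 * (S + r : ℕ))
    (hS : 2 * (S + r) + 2 * d ^ 2 ≤ d * n) (hLx : L ^ (2 * d * K + 2 * d + 1) ≤ x₁) (hC : 0 ≤ C)
    (hbad : pexp (graphLaw d n S) (atypical d η L x₁) ≤ C * L ^ (2 * d) / x₁) :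
    pexp (graphLaw d n (S + r)) (tupleSum lam m) ≤
      (x + 2) ^ K / L ^ (∑ l, (d - 1 - m l)) *
        Real.exp (2 * d ^ 2 * K * (d + K) / x + K / lam * Real.log x₁) *
        (∏ l, (limitRatio d (m l) + 2 * η) + C / L) := by
  have h0 : 0 < lam := by linarith
  have hL1 : 1 ≤ L := by rw [hL]; exact one_le_pow₀ hl
  have hL0 : 0 < L := by linarith
  have hd1 : (1 : ℝ) ≤ d := by exact_mod_cast hd
  have hS' : (2 * (S + r) + 2 * d ^ 2 : ℝ) ≤ d * n := by exact_mod_cast hS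
  have hr0 : (0 : ℝ) ≤ r := Nat.cast_nonneg r
  have hx2 : 2 ≤ x := by rw [hx]; push_cast; nlinarith
  have hxx : x ≤ x₁ := by rw [hx, hx₁]; push_cast; linarith
  have hx0 : 0 < x := by linarith
  have hx₁0 : 0 < x₁ := by linarith
  have hdd : d * d = d ^ 2 := by ring
  set Q := ∑ l, (d - 1 - m l) with hQ
  set P := ∏ l, (limitRatio d (m l) + 2 * η) with hP
  have hP0 : 0 ≤ P := Finset.prod_nonneg fun l _ => by
    have := limitRatio_pos d (m l)
    positivity
  have h1 := pexp_graphLaw_tupleSum_le hd hl hm S r hS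
  rw [← hx, ← hx₁] at h1
  have h2 := pexp_graphLaw_tupleSum_le_of_typical hm hη hη1 hl hL hlam hx₁ hx₁0 (by omega)
  have h3 : ∏ l, ((limitRatio d (m l) + 2 * η) * (x₁ / L ^ (d - 1 - m l))) =
      x₁ ^ K / L ^ Q * P := by
    rw [Finset.prod_mul_distrib, Finset.prod_div_distrib, Finset.prod_const, Finset.card_univ,
      Fintype.card_fin, Finset.prod_pow_eq_pow_sum, mul_comm]
  have hQK : Q ≤ d * K := by
    have : ∑ l, (d - 1 - m l) ≤ ∑ _l : Fin K, d := Finset.sum_le_sum fun l _ => by omega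
    rw [Finset.sum_const, Finset.card_univ, Fintype.card_fin, smul_eq_mul, mul_comm] at this
    exact this
  -- The exponent in `hLx` is spent as follows: dK on the weights (lam ≤ L), dK on L^Q, 2d on the
  -- probability of atypical graphs, and one factor L is left over.
  have h4 : (x₁ * lam ^ d) ^ K * pexp (graphLaw d n S) (atypical d η L x₁) ≤
      x₁ ^ K / L ^ Q * (C / L) := by
    have hlL : lam ≤ L := by rw [hL]; exact le_self_pow₀ hl (by norm_num)
    have hp := pexp_nonneg (graphLaw d n S) (atypical_nonneg d η L x₁)
    calc (x₁ * lam ^ d) ^ K * pexp (graphLaw d n S) (atypical d η L x₁)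
        ≤ (x₁ * L ^ d) ^ K * (C * L ^ (2 * d) / x₁) := by gcongr
      _ = x₁ ^ K * C * (L ^ (d * K + 2 * d) / x₁) := by
          rw [mul_pow, ← pow_mul, pow_add]
          ring
      _ ≤ x₁ ^ K * C * (1 / (L ^ Q * L)) := by
          refine mul_le_mul_of_nonneg_left ?_ (by positivity)
          rw [div_le_div_iff₀ hx₁0 (by positivity), one_mul, ← pow_succ, ← pow_add]
          refine le_trans (pow_le_pow_right₀ hL1 ?_) hLx
          have : 2 * d * K = d * K + d * K := by ring
          omega
      _ = _ := by field_simp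
  have h5 : Real.exp (upperRate d K lam x - upperRate d K lam x₁) ≤
      ((x + 2) / (x₁ + 2)) ^ K *
        Real.exp (2 * d ^ 2 * K * (d + K) / x + K / lam * Real.log x₁) := by
    have e1 : ((x + 2) / (x₁ + 2)) ^ K =
        Real.exp (K * (Real.log (x + 2) - Real.log (x₁ + 2))) := by
      rw [Real.exp_nat_mul, Real.exp_sub, Real.exp_log (by linarith), Real.exp_log (by linarith)]
    rw [e1, ← Real.exp_add, Real.exp_le_exp]
    unfold upperRate
    have e2 : 0 ≤ 2 * (d : ℝ) ^ 2 * K * (d + K) / x₁ := by positivity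
    have e3 : 0 ≤ K / lam * Real.log x := by
      have := Real.log_nonneg (by linarith : 1 ≤ x)
      positivity
    linarith
  have h6 : pexp (graphLaw d n S) (tupleSum lam m) ≤ x₁ ^ K / L ^ Q * (P + C / L) := by
    rw [mul_add]
    linarith
  have h7 : ((x + 2) / (x₁ + 2)) ^ K * x₁ ^ K ≤ (x + 2) ^ K := by
    rw [← mul_pow]
    refine pow_le_pow_left₀ (by positivity) ?_ K
    rw [div_mul_eq_mul_div, div_le_iff₀ (by linarith)]
    nlinarith
  set E := Real.exp (2 * d ^ 2 * K * (d + K) / x + K / lam * Real.log x₁) with hE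
  have hE0 : 0 < E := Real.exp_pos _
  have hPC : 0 ≤ P + C / L := by positivity
  calc pexp (graphLaw d n (S + r)) (tupleSum lam m)
      ≤ (((x + 2) / (x₁ + 2)) ^ K * E) * (x₁ ^ K / L ^ Q * (P + C / L)) := by
        refine h1.trans (mul_le_mul h5 h6 (pexp_nonneg _ fun G => tupleSum_nonneg h0.le m G) ?_)
        positivity
    _ = (((x + 2) / (x₁ + 2)) ^ K * x₁ ^ K) / L ^ Q * E * (P + C / L) := by ring
    _ ≤ (x + 2) ^ K / L ^ Q * E * (P + C / L) := by gcongr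

lemma descFactorial_le_tupleSum {j k : ℕ} {lam : ℝ} (hl : 0 ≤ lam) (G : SimpleGraph (Fin n)) :
    ((degreeCount j G).descFactorial k : ℝ) ≤ tupleSum lam (fun _ : Fin k => j) G := by
  rw [descFactorial_degreeCount]
  refine Finset.sum_le_sum fun v _ => ?_
  split_ifs with h
  · rw [Finset.prod_eq_one]
    intro l _
    simp [levelWeight, h l]
  · exact Finset.prod_nonneg fun l _ => levelWeight_nonneg hl _ _

/-- The constant in the bound for the joint moments with one more index. -/
def jointConst (d j k : ℕ) (C : ℝ) : ℝ :=
  2 ^ (k + 1) * Real.exp 2 * ((limitRatio d (d - 2) + 2) * (limitRatio d j + 2) ^ k + C)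

lemma jointConst_nonneg (d j k : ℕ) {C : ℝ} (hC : 0 ≤ C) : 0 ≤ jointConst d j k C := by
  have := limitRatio_pos d (d - 2)
  have := limitRatio_pos d j
  unfold jointConst
  positivity

/-- Explicit lower bound for the expected falling factorial at deficiency `x`, started from
deficiency `x₁`. -/
theorem pexp_graphLaw_descFactorial_ge_explicit {d j k S r : ℕ} (hd : 2 ≤ d) (hj : j ≤ d - 2)
    {η lam L C x₁ x : ℝ} (hη : 0 < η) (hη1 : η ≤ 1) (hl : 1 ≤ lam)
    (hL : L = lam ^ 2) (hlam : d * ((d - 1).factorial + 1) ≤ η * lam)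
    (hx₁ : x₁ = d * n - 2 * S) (hx : x = d * n - 2 * (S + r : ℕ))
    (hS : 2 * (S + r) + 2 * d ^ 2 ≤ d * n) (hLx : L ^ (2 * d * (k + 1) + 2 * d + 1) ≤ x₁)
    (hC : 0 ≤ C) (hCL : C ≤ L) (hbad : pexp (graphLaw d n S) (atypical d η L x₁) ≤
      C * L ^ (2 * d) / x₁) (hlow : lowerConst d k ≤ x)
    (hxC : 2 * d ^ 2 * (k + 1 : ℕ) * (d + (k + 1 : ℕ)) ≤ x)
    (hlog : (k + 1 : ℕ) / lam * Real.log x₁ ≤ 1) (hkL : 0 ≤ limitRatio d j - η - k / L) :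
    lowerRate d k x / L ^ ((d - 1 - j) * k) * ((limitRatio d j - η - k / L) ^ k * (1 - C / L) -
        lossConst d k * jointConst d j k C * (Real.log x₁ / L)) ≤
      pexp (graphLaw d n (S + r)) (fun G => ((degreeCount j G).descFactorial k : ℝ)) := by
  have h0 : 0 < lam := by linarith
  have hL1 : 1 ≤ L := by rw [hL]; exact one_le_pow₀ hl
  have hL0 : 0 < L := by linarith
  have hd1 : (2 : ℝ) ≤ d := by exact_mod_cast hd
  have hS' : (2 * (S + r) + 2 * d ^ 2 : ℝ) ≤ d * n := by exact_mod_cast hS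
  have hr0 : (0 : ℝ) ≤ r := Nat.cast_nonneg r
  have hx2 : 2 ≤ x := by rw [hx]; push_cast; nlinarith
  have hxx : x ≤ x₁ := by rw [hx, hx₁]; push_cast; linarith
  have hx0 : 0 < x := by linarith
  have hx₁0 : 0 < x₁ := by linarith
  set q := d - 1 - j with hq
  have hJ0 := jointConst_nonneg d j k hC
  -- The additional index has level d - 2 and contributes the single extra factor L. It is what
  -- beats the factor log x₁ from the accumulated losses.
  set B := jointConst d j k C / L ^ (1 + q * k) with hB
  have hB0 : 0 ≤ B := by positivity
  set m : Fin (k + 1) → ℕ := Fin.cons (d - 2) (fun _ : Fin k => j) with hm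
  have hmd : ∀ l, m l < d := by
    intro l
    refine Fin.cases ?_ (fun i => ?_) l
    · simp only [hm, Fin.cons_zero]; omega
    · simp only [hm, Fin.cons_succ]; omega
  have hup : ∀ i ≤ r, pexp (graphLaw d n (S + i)) (tupleSum lam m) ≤
      B * (d * n - 2 * (S + i : ℕ)) ^ (k + 1) := by
    intro i hi
    have hir : (i : ℝ) ≤ r := by exact_mod_cast hi
    have h1 := pexp_graphLaw_tupleSum_le_explicit (r := i) (by omega) hmd hη hη1 hl hL hlam hx₁ rfl
      (by omega) hLx hC hbad
    set y : ℝ := d * n - 2 * (S + i : ℕ) with hy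
    have hxy : x ≤ y := by rw [hx, hy]; push_cast; linarith
    refine h1.trans ?_
    have hQ : ∑ l, (d - 1 - m l) = 1 + q * k := by
      rw [Fin.sum_univ_succ]
      simp only [hm, Fin.cons_zero, Fin.cons_succ, Finset.sum_const, Finset.card_univ,
        Fintype.card_fin, smul_eq_mul]
      rw [mul_comm k]
      congr 1
      omega
    have hP : ∏ l, (limitRatio d (m l) + 2 * η) ≤
        (limitRatio d (d - 2) + 2) * (limitRatio d j + 2) ^ k := by
      have := limitRatio_pos d (d - 2)
      have := limitRatio_pos d j
      rw [Fin.prod_univ_succ]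
      simp only [hm, Fin.cons_zero, Fin.cons_succ, Finset.prod_const, Finset.card_univ,
        Fintype.card_fin]
      gcongr <;> linarith
    have hCC : C / L ≤ C := div_le_self hC hL1
    have hP0 : 0 ≤ ∏ l, (limitRatio d (m l) + 2 * η) := Finset.prod_nonneg fun l _ => by
      have := limitRatio_pos d (m l)
      positivity
    have hexp : Real.exp (2 * d ^ 2 * (k + 1 : ℕ) * (d + (k + 1 : ℕ)) / y +
        (k + 1 : ℕ) / lam * Real.log x₁) ≤ Real.exp 2 := by
      rw [Real.exp_le_exp]
      have : 2 * (d : ℝ) ^ 2 * (k + 1 : ℕ) * (d + (k + 1 : ℕ)) / y ≤ 1 :=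
        (div_le_one (by linarith)).2 (hxC.trans hxy)
      linarith
    have hy2 : (y + 2) ^ (k + 1) ≤ 2 ^ (k + 1) * y ^ (k + 1) := by
      rw [← mul_pow]
      exact pow_le_pow_left₀ (by linarith) (by linarith) _
    rw [hQ]
    have hy0 : 0 < y := by linarith
    calc (y + 2) ^ (k + 1) / L ^ (1 + q * k) * Real.exp (2 * d ^ 2 * (k + 1 : ℕ) *
          (d + (k + 1 : ℕ)) / y + (k + 1 : ℕ) / lam * Real.log x₁) *
          (∏ l, (limitRatio d (m l) + 2 * η) + C / L)
        ≤ (2 ^ (k + 1) * y ^ (k + 1)) / L ^ (1 + q * k) * Real.exp 2 *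
          ((limitRatio d (d - 2) + 2) * (limitRatio d j + 2) ^ k + C) := by gcongr
      _ = B * y ^ (k + 1) := by
        rw [hB, jointConst]
        ring
  have hmain := pexp_graphLaw_descFactorial_ge (k := k) (j := j) hd (by omega) hl hB0 S r hS
    (hx ▸ hlow) hup
  rw [← hx, ← hx₁] at hmain
  have hkx : k * L ^ q / x₁ ≤ k / L := by
    rw [div_le_div_iff₀ hx₁0 hL0, mul_assoc, ← pow_succ]
    refine mul_le_mul_of_nonneg_left (le_trans (pow_le_pow_right₀ hL1 ?_) hLx) (Nat.cast_nonneg k)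
    omega
  have hq0 : 0 < x₁ / L ^ q := by positivity
  have hA : (limitRatio d j - η - k / L) * (x₁ / L ^ q) ≤
      (limitRatio d j - η) * (x₁ / L ^ q) - k := by
    have h1 := mul_le_mul_of_nonneg_right hkx hq0.le
    have h2 : k * L ^ q / x₁ * (x₁ / L ^ q) = k := by field_simp
    rw [h2] at h1
    rw [sub_mul]
    linarith
  have hA0 : 0 ≤ (limitRatio d j - η - k / L) * (x₁ / L ^ q) := mul_nonneg hkL hq0.le
  have hstart := le_pexp_graphLaw_descFactorial_of_typical (n := n) (d := d) (k := k) (j := j)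
    (s := S) (by omega) (η := η) hL0 hx₁0 (by linarith)
  set a := pexp (graphLaw d n S) (fun G => ((degreeCount j G).descFactorial k : ℝ)) with ha
  have hbad' : pexp (graphLaw d n S) (atypical d η L x₁) ≤ C / L := by
    refine hbad.trans ?_
    rw [div_le_div_iff₀ hx₁0 hL0, mul_assoc, ← pow_succ]
    refine mul_le_mul_of_nonneg_left (le_trans (pow_le_pow_right₀ hL1 ?_) hLx) hC
    omega
  have hCL1 : C / L ≤ 1 := (div_le_one hL0).2 hCL
  have h1 : ((limitRatio d j - η - k / L) * (x₁ / L ^ q)) ^ k * (1 - C / L) ≤ a := by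
    refine le_trans ?_ hstart
    refine mul_le_mul (pow_le_pow_left₀ hA0 hA k) (by linarith) (by linarith) ?_
    exact pow_nonneg (by linarith) k
  have hrate : lowerRate d k x₁ ≤ x₁ ^ k := by
    unfold lowerRate
    refine mul_le_of_le_one_right (by positivity) (Real.exp_le_one_iff.2 ?_)
    have : 0 ≤ lowerConst d k / x₁ := div_nonneg (lowerConst_pos d k).le hx₁0.le
    linarith
  have hr1 := lowerRate_pos d k hx₁0
  have hrx := lowerRate_pos d k hx0
  have h2 : (limitRatio d j - η - k / L) ^ k * (1 - C / L) / L ^ (q * k) ≤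
      a / lowerRate d k x₁ := by
    have e : (limitRatio d j - η - k / L) ^ k * (1 - C / L) / L ^ (q * k) =
        ((limitRatio d j - η - k / L) * (x₁ / L ^ q)) ^ k * (1 - C / L) / x₁ ^ k := by
      rw [mul_pow, div_pow, ← pow_mul]
      field_simp
    have hnn : 0 ≤ ((limitRatio d j - η - k / L) * (x₁ / L ^ q)) ^ k * (1 - C / L) :=
      mul_nonneg (pow_nonneg hA0 k) (by linarith)
    rw [e]
    exact div_le_div₀ (hnn.trans h1) h1 hr1 hrate
  have hlc : 0 ≤ lossConst d k * B := mul_nonneg (by unfold lossConst; positivity) hB0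
  have h3 : lossConst d k * B * (Real.log x₁ - Real.log x) ≤
      lossConst d k * jointConst d j k C * (Real.log x₁ / L) / L ^ (q * k) := by
    have hlx := Real.log_nonneg (by linarith : 1 ≤ x)
    calc lossConst d k * B * (Real.log x₁ - Real.log x) ≤ lossConst d k * B * Real.log x₁ := by
          gcongr
          linarith
      _ = _ := by
          rw [hB, pow_add, pow_one]
          field_simp
  have h4 : (limitRatio d j - η - k / L) ^ k * (1 - C / L) / L ^ (q * k) -
      lossConst d k * jointConst d j k C * (Real.log x₁ / L) / L ^ (q * k) ≤
      pexp (graphLaw d n (S + r)) (fun G => ((degreeCount j G).descFactorial k : ℝ)) /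
        lowerRate d k x := by linarith
  rw [← sub_div, le_div_iff₀ hrx] at h4
  refine le_trans (le_of_eq ?_) h4
  ring

end Graphs

/-! ### Choice of parameters and limits -/

/-- The exponent of `log n` in the number of remaining steps at which the concentration of the
degree counts is used. -/
def burnExponent (d k : ℕ) (γ : ℝ) : ℕ := 2 * d * (k + 1) + 2 * d + 1 + ⌈γ⌉₊

/-- The number of remaining steps at which the concentration of the degree counts is used. -/
def burnTime (d k : ℕ) (γ : ℝ) (n : ℕ) : ℕ := ⌈Real.log n ^ burnExponent d k γ⌉₊

lemma tendsto_log_natCast : Tendsto (fun n : ℕ => Real.log n) atTop atTop :=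
  Real.tendsto_log_atTop.comp tendsto_natCast_atTop_atTop

lemma f_eq {d j : ℕ} (hd : 2 ≤ d) (hj : j ≤ d - 2) (t n : ℕ) :
    f j d t n = 2 * limitRatio d j * t / Real.log n ^ (d - 1 - j) := by
  have h1 : ((d - 1).descFactorial (d - 1 - j) : ℝ) = limitRatio d j := by
    have h := Nat.factorial_mul_descFactorial (show d - 1 - j ≤ d - 1 by omega)
    rw [show d - 1 - (d - 1 - j) = j by omega] at h
    rw [limitRatio, eq_div_iff (by positivity), mul_comm]
    exact_mod_cast h
  rw [f, h1]

/-- The deficiency after `d * n / 2 - t` steps. -/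
lemma deficiency_bounds {d n t : ℕ} (ht : t ≤ d * n / 2) :
    (2 * t : ℝ) ≤ d * n - 2 * (d * n / 2 - t : ℕ) ∧
      (d * n - 2 * (d * n / 2 - t : ℕ) : ℝ) ≤ 2 * t + 1 := by
  have h1 : 2 * t + 2 * (d * n / 2 - t) ≤ d * n := by omega
  have h2 : d * n ≤ 2 * t + 2 * (d * n / 2 - t) + 1 := by omega
  have h3 : (2 * t + 2 * (d * n / 2 - t : ℕ) : ℝ) ≤ d * n := by exact_mod_cast h1
  have h4 : (d * n : ℝ) ≤ 2 * t + 2 * (d * n / 2 - t : ℕ) + 1 := by exact_mod_cast h2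
  constructor <;> linarith

/-- The summand ⌈γ⌉ of the exponent puts the burn time before the target time, and any power of log
n is o(n). The factor 2 absorbs the rounding. -/
lemma eventually_burnTime (d k : ℕ) (hd : 1 ≤ d) {γ : ℝ} {t : ℕ → ℕ}
    (htγ : ∀ᶠ n : ℕ in atTop, (t n : ℝ) < Real.log (n : ℝ) ^ γ) :
    ∀ᶠ n : ℕ in atTop, t n ≤ burnTime d k γ n ∧ burnTime d k γ n ≤ d * n / 2 ∧
      (burnTime d k γ n : ℝ) ≤ 2 * Real.log n ^ burnExponent d k γ := by
  have hlit : (fun x : ℝ => Real.log x ^ burnExponent d k γ) =o[atTop] id :=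
    Real.isLittleO_pow_log_id_atTop
  have h4 := tendsto_natCast_atTop_atTop.eventually
    (hlit.bound (by norm_num : (0 : ℝ) < 1 / 4))
  filter_upwards [htγ, tendsto_log_natCast.eventually_ge_atTop 1, h4,
    eventually_ge_atTop 1] with n h1 h2 h3 hn
  have hpow : 1 ≤ Real.log n ^ burnExponent d k γ := one_le_pow₀ h2
  have hceil : (burnTime d k γ n : ℝ) < Real.log n ^ burnExponent d k γ + 1 :=
    Nat.ceil_lt_add_one (by linarith)
  have hle : Real.log n ^ γ ≤ Real.log n ^ burnExponent d k γ := by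
    rw [← Real.rpow_natCast]
    refine Real.rpow_le_rpow_of_exponent_le h2 ((Nat.le_ceil γ).trans ?_)
    unfold burnExponent
    push_cast
    have : (0 : ℝ) ≤ 2 * d * (k + 1) + 2 * d + 1 := by positivity
    linarith
  refine ⟨?_, ?_, by linarith⟩
  · have : (t n : ℝ) ≤ burnTime d k γ n := by
      have := Nat.le_ceil (Real.log n ^ burnExponent d k γ)
      unfold burnTime
      linarith
    exact_mod_cast this
  · rw [id, Real.norm_of_nonneg (by linarith), Real.norm_of_nonneg (Nat.cast_nonneg n)] at h3
    have hr : (2 * burnTime d k γ n : ℝ) ≤ n := by linarith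
    have hr' : 2 * burnTime d k γ n ≤ n := by exact_mod_cast hr
    have : n ≤ d * n := Nat.le_mul_of_pos_left n hd
    omega

/-- The bound for the logarithm of the deficiency at the burn time. -/
def logBound (d k : ℕ) (γ : ℝ) (n : ℕ) : ℝ :=
  Real.log 5 + burnExponent d k γ * Real.log (Real.log n)

/-- Needed because the upper bound carries the factor exp(k log x₁ / lam) with lam = √(log n), and
log x₁ is O(log log n). -/
lemma tendsto_logBound_div_sqrt (d k : ℕ) (γ : ℝ) :
    Tendsto (fun n : ℕ => logBound d k γ n / √(Real.log n)) atTop (nhds 0) := by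
  have h1 : Tendsto (fun x : ℝ => Real.log x / √x) atTop (nhds 0) := by
    have := (isLittleO_log_rpow_atTop (by norm_num : (0 : ℝ) < 1 / 2)).tendsto_div_nhds_zero
    simpa [Real.sqrt_eq_rpow] using this
  have h2 : Tendsto (fun x : ℝ => Real.log 5 / √x) atTop (nhds 0) :=
    tendsto_const_nhds.div_atTop Real.tendsto_sqrt_atTop
  have h3 := (h2.add (h1.const_mul (burnExponent d k γ : ℝ))).comp tendsto_log_natCast
  rw [mul_zero, add_zero] at h3
  refine h3.congr fun n => ?_
  simp only [Function.comp_apply, logBound]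
  ring

lemma tendsto_logBound_div (d k : ℕ) (γ : ℝ) :
    Tendsto (fun n : ℕ => logBound d k γ n / Real.log n) atTop (nhds 0) := by
  have h1 : Tendsto (fun n : ℕ => 1 / √(Real.log n)) atTop (nhds 0) :=
    tendsto_const_nhds.div_atTop (Real.tendsto_sqrt_atTop.comp tendsto_log_natCast)
  have h2 := (tendsto_logBound_div_sqrt d k γ).mul h1
  rw [mul_zero] at h2
  refine h2.congr' ?_
  filter_upwards [tendsto_log_natCast.eventually_gt_atTop 0] with n hn
  rw [div_mul_div_comm, mul_one, Real.mul_self_sqrt hn.le]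

set_option maxHeartbeats 1000000 in
/-- The factorial moment is squeezed between two multiples of the prediction whose limits are close
to one. -/
theorem exists_squeeze {d j k : ℕ} (hd : 2 ≤ d) (hj : j ≤ d - 2) {γ : ℝ}
    {t : ℕ → ℕ} (ht : Tendsto t atTop atTop)
    (htγ : ∀ᶠ n : ℕ in atTop, (t n : ℝ) < Real.log (n : ℝ) ^ γ) {η : ℝ} (hη : 0 < η) (hη1 : η ≤ 1)
    (hηc : η < limitRatio d j) :
    ∃ lo up : ℕ → ℝ,
      Tendsto lo atTop (nhds ((limitRatio d j - η) ^ k / limitRatio d j ^ k)) ∧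
      Tendsto up atTop (nhds ((limitRatio d j + 2 * η) ^ k / limitRatio d j ^ k)) ∧
      ∀ᶠ n in atTop, lo n * f j d (t n) n ^ k ≤ factorialMoment d n j k (d * n / 2 - t n) ∧
        factorialMoment d n j k (d * n / 2 - t n) ≤ up n * f j d (t n) n ^ k := by
  obtain ⟨C, hC, δ, hδ, L₀, hA⟩ := pexp_graphLaw_atypical_le (by omega : 1 ≤ d) hη
  obtain ⟨c, hc⟩ : ∃ c, c = limitRatio d j := ⟨_, rfl⟩
  have hc0 : 0 < c := hc ▸ limitRatio_pos d j
  rw [← hc] at hηc ⊢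
  have hd1 : (2 : ℝ) ≤ d := by exact_mod_cast hd
  have hTt : Tendsto (fun n => (t n : ℝ)) atTop atTop := tendsto_natCast_atTop_atTop.comp ht
  have hTL := tendsto_log_natCast
  have hinvt : Tendsto (fun n => 1 / (2 * (t n : ℝ))) atTop (nhds 0) :=
    tendsto_const_nhds.div_atTop (hTt.const_mul_atTop (by norm_num : (0 : ℝ) < 2))
  have hinvL : ∀ a : ℝ, Tendsto (fun n : ℕ => a / Real.log n) atTop (nhds 0) := fun a =>
    tendsto_const_nhds.div_atTop hTL
  have hls := tendsto_logBound_div_sqrt d k γ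
  have hll := tendsto_logBound_div d k γ
  set core : ℕ → ℝ := fun n => (c - η - k / Real.log n) ^ k * (1 - C / Real.log n) -
    lossConst d k * jointConst d j k C * (logBound d k γ n / Real.log n) with hcore
  have hcorelim : Tendsto core atTop (nhds ((c - η) ^ k)) := by
    have h := (((tendsto_const_nhds (x := c - η)).sub (hinvL k)).pow k).mul
      ((tendsto_const_nhds (x := (1 : ℝ))).sub (hinvL C)) |>.sub
      (hll.const_mul (lossConst d k * jointConst d j k C))
    simpa using h
  set lo : ℕ → ℝ := fun n =>
    Real.exp (-(lowerConst d k * (1 / (2 * (t n : ℝ))))) * core n / c ^ k with hlo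
  set up : ℕ → ℝ := fun n => (1 + 3 * (1 / (2 * (t n : ℝ)))) ^ k *
    Real.exp (2 * d ^ 2 * k * (d + k) * (1 / (2 * (t n : ℝ))) +
      k * (logBound d k γ n / √(Real.log n))) * ((c + 2 * η) ^ k + C / Real.log n) / c ^ k with hup
  refine ⟨lo, up, ?_, ?_, ?_⟩
  · have h : Tendsto lo atTop (nhds (Real.exp (-(lowerConst d k * 0)) * (c - η) ^ k / c ^ k)) :=
      ((Real.continuous_exp.tendsto _).comp
        (hinvt.const_mul (lowerConst d k)).neg).mul hcorelim |>.div_const (c ^ k)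
    rwa [mul_zero, neg_zero, Real.exp_zero, one_mul] at h
  · have h1 := ((tendsto_const_nhds (x := (1 : ℝ))).add (hinvt.const_mul 3)).pow k
    have h2 := (Real.continuous_exp.tendsto _).comp
      ((hinvt.const_mul (2 * (d : ℝ) ^ 2 * k * (d + k))).add (hls.const_mul (k : ℝ)))
    have h3 := (tendsto_const_nhds (x := (c + 2 * η) ^ k)).add (hinvL C)
    have h : Tendsto up atTop (nhds ((1 + 3 * 0) ^ k * Real.exp (2 * d ^ 2 * k * (d + k) * 0 +
        k * 0) * ((c + 2 * η) ^ k + 0) / c ^ k)) := ((h1.mul h2).mul h3).div_const (c ^ k)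
    simpa only [mul_zero, add_zero, one_pow, Real.exp_zero, one_mul] using h
  · set Γ := burnExponent d k γ with hΓ
    have hev1 := eventually_burnTime d k (by omega) htγ
    have hlamT : Tendsto (fun n : ℕ => √(Real.log n)) atTop atTop :=
      Real.tendsto_sqrt_atTop.comp hTL
    have hls1 : ∀ᶠ n in atTop, logBound d k γ n / √(Real.log n) < 1 / (k + 1) :=
      hls.eventually (gt_mem_nhds (by positivity))
    have hll1 : ∀ᶠ n in atTop, logBound d k γ n / Real.log n < δ := hll.eventually (gt_mem_nhds hδ)
    have hcorepos : ∀ᶠ n in atTop, 0 < core n :=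
      hcorelim.eventually (lt_mem_nhds (pow_pos (by linarith) k))
    have hkL : ∀ᶠ n : ℕ in atTop, (k : ℝ) / Real.log n < c - η :=
      (hinvL k).eventually (gt_mem_nhds (by linarith))
    filter_upwards [hev1, hls1, hll1, hcorepos, hkL, hTL.eventually_ge_atTop 1,
      hTL.eventually_ge_atTop L₀, hTL.eventually_ge_atTop C, eventually_ge_atTop d,
      hlamT.eventually_ge_atTop (d * ((d - 1).factorial + 1) / η),
      hTt.eventually_ge_atTop (d ^ 2 + 1), hTt.eventually_ge_atTop (lowerConst d k),
      hTt.eventually_ge_atTop (2 * d ^ 2 * (k + 1 : ℕ) * (d + (k + 1 : ℕ)))]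
      with n hn1 hn2 hn3 hn4 hn5 hL1 hLL₀ hLC hdn hlam ht1 ht2 ht3
    obtain ⟨htt, hth, htb⟩ := hn1
    obtain ⟨T, hT⟩ : ∃ T, T = burnTime d k γ n := ⟨_, rfl⟩
    obtain ⟨L, hL⟩ : ∃ L : ℝ, L = Real.log n := ⟨_, rfl⟩
    -- The weight base must grow faster than log log n, so that hits which do not destroy a tuple
    -- cost nothing in the limit, and slower than L, so that lower degrees do not contribute.
    obtain ⟨lam, hlamdef⟩ : ∃ l : ℝ, l = √L := ⟨_, rfl⟩
    simp only [hlo, hup]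
    rw [← hL, ← hlamdef] at hn2 hlam
    rw [← hL] at hn3 hn5 hL1 hLL₀ hLC
    rw [← hT] at htt hth htb
    rw [← hL, ← hΓ] at htb
    have hcoren : core n = (c - η - k / L) ^ k * (1 - C / L) -
        lossConst d k * jointConst d j k C * (logBound d k γ n / L) := by rw [hL]
    have hL0 : 0 < L := by linarith
    have hLlam : L = lam ^ 2 := by rw [hlamdef, Real.sq_sqrt hL0.le]
    have hl : 1 ≤ lam := by rw [hlamdef]; exact Real.one_le_sqrt.2 hL1
    have hl0 : 0 < lam := by linarith
    rw [div_le_iff₀ hη, mul_comm lam] at hlam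
    obtain ⟨hx₁a, hx₁b⟩ := deficiency_bounds hth
    obtain ⟨hxa, hxb⟩ := deficiency_bounds (htt.trans hth)
    set S := d * n / 2 - T with hS
    have hSr : d * n / 2 - t n = S + (T - t n) := by omega
    rw [hSr] at hxa hxb ⊢
    set r := T - t n with hr
    obtain ⟨x₁, hx₁⟩ : ∃ x : ℝ, x = d * n - 2 * S := ⟨_, rfl⟩
    obtain ⟨x, hx⟩ : ∃ x : ℝ, x = d * n - 2 * (S + r : ℕ) := ⟨_, rfl⟩
    rw [← hx₁] at hx₁a hx₁b
    rw [← hx] at hxa hxb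
    have ht0 : (0 : ℝ) < t n := by nlinarith
    have hx0 : 0 < x := by linarith
    have hLΓ : L ^ Γ ≤ T := by
      rw [hT, hL]
      exact Nat.le_ceil _
    have hLΓ1 : 1 ≤ L ^ Γ := one_le_pow₀ hL1
    have hx₁0 : 0 < x₁ := by linarith
    have hLx : L ^ (2 * d * (k + 1) + 2 * d + 1) ≤ x₁ := by
      refine (pow_le_pow_right₀ hL1 (?_ : _ ≤ Γ)).trans (by linarith)
      rw [hΓ, burnExponent]
      omega
    have hLx' : L ^ (2 * d * k + 2 * d + 1) ≤ x₁ := by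
      refine (pow_le_pow_right₀ hL1 ?_).trans hLx
      have : 2 * d * k ≤ 2 * d * (k + 1) := Nat.mul_le_mul_left _ (by omega)
      omega
    have hlogx₁ : Real.log x₁ ≤ logBound d k γ n := by
      -- From x₁ ≤ 2T + 1, T ≤ 2 L^Γ and 1 ≤ L^Γ.
      have h1 : x₁ ≤ 5 * L ^ Γ := by linarith
      have h2 := Real.log_le_log hx₁0 h1
      rw [Real.log_mul (by norm_num) (by positivity), Real.log_pow] at h2
      rw [logBound, ← hL]
      exact h2
    have hcast : (2 * d ^ 2 : ℝ) ≤ d * n - 2 * (S + r : ℕ) := by rw [← hx]; linarith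
    have hSn : 2 * (S + r) + 2 * d ^ 2 ≤ d * n := by
      have : (2 * (S + r : ℕ) + 2 * d ^ 2 : ℝ) ≤ d * n := by linarith
      exact_mod_cast this
    have hlx : Real.log x₁ ≤ δ * L := by
      rw [div_lt_iff₀ hL0] at hn3
      linarith
    have hbad := hA n S L x₁ hL hx₁ hLL₀ hdn (by omega) hlx
    have hf : f j d (t n) n ^ k = c ^ k * ((2 * (t n : ℝ)) ^ k / L ^ ((d - 1 - j) * k)) := by
      rw [f_eq hd hj, ← hL, ← hc, div_pow, ← pow_mul, ← mul_div_assoc, ← mul_pow]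
      congr 2
      ring
    have hc' : c ^ k ≠ 0 := by positivity
    have hcancel : ∀ a b : ℝ, a / c ^ k * (c ^ k * b) = a * b := fun a b => by field_simp
    rw [factorialMoment_eq, hf, hcancel, hcancel]
    constructor
    · have key := pexp_graphLaw_descFactorial_ge_explicit (n := n) (k := k) hd hj hη hη1 hl hLlam hlam
        hx₁ hx hSn hLx hC.le hLC hbad (by linarith) (by linarith) ?_ (by rw [← hc]; linarith)
      · refine le_trans ?_ key
        rw [← hc]
        have h1 : core n ≤ (c - η - k / L) ^ k * (1 - C / L) -
            lossConst d k * jointConst d j k C * (Real.log x₁ / L) := by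
          rw [hcoren]
          have hJ := jointConst_nonneg d j k hC.le
          have hlc : 0 ≤ lossConst d k := by unfold lossConst; positivity
          gcongr
        have h2 : (2 * (t n : ℝ)) ^ k * Real.exp (-(lowerConst d k * (1 / (2 * (t n : ℝ))))) ≤
            lowerRate d k x := by
          unfold lowerRate
          have := lowerConst_pos d k
          gcongr
          rw [div_eq_mul_one_div]
          gcongr
        calc Real.exp (-(lowerConst d k * (1 / (2 * (t n : ℝ))))) * core n *
              ((2 * (t n : ℝ)) ^ k / L ^ ((d - 1 - j) * k))
            = ((2 * (t n : ℝ)) ^ k * Real.exp (-(lowerConst d k * (1 / (2 * (t n : ℝ)))))) /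
              L ^ ((d - 1 - j) * k) * core n := by ring
          _ ≤ _ := by
            have := lowerRate_pos d k hx0
            gcongr
      · rw [div_mul_eq_mul_div, div_le_one hl0]
        rw [div_lt_div_iff₀ hl0 (by positivity)] at hn2
        push_cast
        have : (k + 1 : ℝ) * Real.log x₁ ≤ (k + 1) * logBound d k γ n := by gcongr
        linarith
    · have key := pexp_graphLaw_tupleSum_le_explicit (n := n) (K := k) (m := fun _ => j)
        (by omega : 1 ≤ d) (fun _ => by omega) hη hη1 hl hLlam hlam hx₁ hx hSn hLx' hC.le hbad
      have h0 : pexp (graphLaw d n (S + r)) (fun G => ((degreeCount j G).descFactorial k : ℝ)) ≤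
          pexp (graphLaw d n (S + r)) (tupleSum lam (fun _ : Fin k => j)) :=
        pexp_mono _ fun G _ => descFactorial_le_tupleSum hl0.le G
      refine (h0.trans key).trans ?_
      simp only [Finset.sum_const, Finset.prod_const, Finset.card_univ, Fintype.card_fin,
        smul_eq_mul]
      rw [← hc, mul_comm k (d - 1 - j)]
      -- The 3 is the shift 2 of the rate plus the 1 by which x may exceed 2t when dn is odd.
      have h1 : (x + 2) ^ k ≤ (1 + 3 * (1 / (2 * (t n : ℝ)))) ^ k * (2 * (t n : ℝ)) ^ k := by
        rw [← mul_pow]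
        refine pow_le_pow_left₀ (by linarith) ?_ k
        have : (1 + 3 * (1 / (2 * (t n : ℝ)))) * (2 * t n) = 2 * t n + 3 := by
          field_simp
        rw [this]
        linarith
      have h2 : Real.exp (2 * d ^ 2 * k * (d + k) / x + k / lam * Real.log x₁) ≤
          Real.exp (2 * d ^ 2 * k * (d + k) * (1 / (2 * (t n : ℝ))) +
            k * (logBound d k γ n / lam)) := by
        rw [Real.exp_le_exp]
        have e1 : 2 * (d : ℝ) ^ 2 * k * (d + k) / x ≤
            2 * d ^ 2 * k * (d + k) * (1 / (2 * (t n : ℝ))) := by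
          rw [div_eq_mul_one_div]
          gcongr
        have e2 : k / lam * Real.log x₁ ≤ k * (logBound d k γ n / lam) := by
          rw [div_mul_eq_mul_div, mul_div_assoc]
          gcongr
        linarith
      rw [← hL, ← hlamdef]
      calc (x + 2) ^ k / L ^ ((d - 1 - j) * k) *
            Real.exp (2 * d ^ 2 * k * (d + k) / x + k / lam * Real.log x₁) *
            ((c + 2 * η) ^ k + C / L)
          ≤ ((1 + 3 * (1 / (2 * (t n : ℝ)))) ^ k * (2 * (t n : ℝ)) ^ k) / L ^ ((d - 1 - j) * k) *
            Real.exp (2 * d ^ 2 * k * (d + k) * (1 / (2 * (t n : ℝ))) +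
              k * (logBound d k γ n / lam)) * ((c + 2 * η) ^ k + C / L) := by gcongr
        _ = _ := by ring

end DegreeBounded

end

/-! ### Conclusion -/

theorem theorem1p6 (d j k : ℕ) (hd : 2 ≤ d) (hj : j ≤ d - 2) (hk : 1 ≤ k)
    (γ : ℝ) (hγ : 0 < γ) (t : ℕ → ℕ) (ht : Tendsto t atTop atTop)
    (htγ : ∀ᶠ n : ℕ in atTop, (t n : ℝ) < Real.log (n : ℝ) ^ γ) :
    (fun n : ℕ => DegreeBounded.factorialMoment d n j k (d * n / 2 - t n)) ~[atTop]
      (fun n : ℕ => DegreeBounded.f j d (t n) n ^ k) := by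
  have hc0 := DegreeBounded.limitRatio_pos d j
  have hfpos : ∀ᶠ n : ℕ in atTop, 0 < DegreeBounded.f j d (t n) n ^ k := by
    filter_upwards [ht.eventually_ge_atTop 1,
      DegreeBounded.tendsto_log_natCast.eventually_gt_atTop 0] with n h1 h2
    have : (0 : ℝ) < t n := by exact_mod_cast h1
    rw [DegreeBounded.f_eq hd hj]
    positivity
  rw [isEquivalent_iff_tendsto_one (hfpos.mono fun n h => h.ne')]
  have hsmall : ∀ᶠ η : ℝ in nhdsWithin 0 (Set.Ioi 0), η ≤ 1 ∧ η < DegreeBounded.limitRatio d j ∧ 0 < η := by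
    filter_upwards [self_mem_nhdsWithin, nhdsWithin_le_nhds (gt_mem_nhds hc0),
      nhdsWithin_le_nhds (gt_mem_nhds zero_lt_one)] with η h1 h2 h3
    exact ⟨h3.le, h2, h1⟩
  -- The limits of the two squeezing factors are the cases s = -1 and s = 2. Both tend to 1 as η
  -- decreases to 0, so for any a on either side of 1 a suitable η can be fixed before n tends to
  -- infinity.
  have hcont : ∀ s : ℝ, Tendsto (fun η : ℝ => (DegreeBounded.limitRatio d j + s * η) ^ k /
      DegreeBounded.limitRatio d j ^ k) (nhdsWithin 0 (Set.Ioi 0)) (nhds 1) := by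
    intro s
    have h : Continuous fun η : ℝ => (DegreeBounded.limitRatio d j + s * η) ^ k /
      DegreeBounded.limitRatio d j ^ k := by fun_prop
    have h1 := (h.tendsto 0).mono_left (nhdsWithin_le_nhds (s := Set.Ioi 0))
    have e : (DegreeBounded.limitRatio d j + s * 0) ^ k / DegreeBounded.limitRatio d j ^ k = 1 := by
      rw [mul_zero, add_zero, div_self (by positivity)]
    rwa [e] at h1
  rw [tendsto_order]
  constructor
  · intro a ha
    obtain ⟨η, hη, h1, h2, h3⟩ :=
      (((hcont (-1)).eventually (lt_mem_nhds ha)).and hsmall).exists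
    obtain ⟨lo, up, hlo, -, hev⟩ := DegreeBounded.exists_squeeze (k := k) hd hj ht htγ h3 h1 h2
    rw [neg_one_mul, ← sub_eq_add_neg] at hη
    filter_upwards [hev, hfpos, hlo.eventually (lt_mem_nhds hη)] with n hn hf hl
    rw [Pi.div_apply, lt_div_iff₀ hf]
    exact (mul_lt_mul_of_pos_right hl hf).trans_le hn.1
  · intro a ha
    obtain ⟨η, hη, h1, h2, h3⟩ :=
      (((hcont 2).eventually (gt_mem_nhds ha)).and hsmall).exists
    obtain ⟨lo, up, -, hup, hev⟩ := DegreeBounded.exists_squeeze (k := k) hd hj ht htγ h3 h1 h2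
    filter_upwards [hev, hfpos, hup.eventually (gt_mem_nhds hη)] with n hn hf hu
    rw [Pi.div_apply, div_lt_iff₀ hf]
    exact hn.2.trans_lt (mul_lt_mul_of_pos_right hu hf)
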